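/- All graphs are finite, simple, without isolated vertices, and taken up to isomorphism. A graph is *partially labeled* if some of its vertices carry distinct labels from a fixed countably infinite set (isomorphisms preserve labels), *fully labeled* if all vertices carry one, and *unlabeled* if none does. Let $\mathcal A$ be the real vector space of finite formal linear combinations of partially labeled graphs, including the empty graph $1$. It is an algebra with unit $1$ under the gluing product: $H_1H_2$ is obtained from the disjoint union by identifying vertices with the same label and keeping one copy of each doubled edge. Let $\mathcal A_\emptyset$ be the subalgebra spanned by the unlabeled graphs (there the product is disjoint union), whose elements we call *graph combinations*, and let $[[\cdot]]:\mathcal A\to\mathcal A_\emptyset$ be the linear map that forgets labels. A *sum of squares* (sos) is a finite sum $\sum_j[[a_j^2]]$ with $a_j\in\mathcal A$. It is a *$d$-sos* graph combination if it can be written in this way with all graphs occurring in the $a_j$ having at most $d$ edges. A graph combination $a$ is a *rational sos* if there are sos $b\neq 0$ and $c$ with $ab=c$. Each unlabeled graph factors uniquely into its connected components, so $\mathcal A_\emptyset$ is the polynomial ring in the connected unlabeled graphs $C\ne 1$, and a graph combination can be evaluated at a vector $\mathbf v=(v_C)_C$ of real numbers. For $d\ge 1$ the *$d$-sos-profile*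 $\mathcal S_d$ is the set of all $\mathbf v$ with $v_C\ge 0$ for all $C$ such that $a(\mathbf v)\ge 0$ for every $d$-sos graph combination $a$ (apart from nonnegativity, this restricts only the finitely many coordinates $C$ that occur in $d$-sos graph combinations). A graph combination $a$ is *sos-testable* if there is a $d\ge 1$ such that $a(\mathbf v)\ge 0$ for all $\mathbf v\in\mathcal S_d$. An unlabeled graph $H$ is a *trivial square* if whenever $H=[[F^2]]$ for a partially labeled graph $F$, then $F$ is a fully labeled copy of $H$. **Corollary 5.2.** Let $p\ge 1$ be an integer, and let $\overline H$ and $\underline H$ be two distinct (that is, non-isomorphic) unlabeled graphs with the same number of edges such that $\overline H$ is a trivial square in which every vertex has degree $p$ or $p+1$, and every vertex of $\underline H$ has degree at most $p+1$. Then the graph combination $\overline H-\underline H$ is not sos-testable, and it is not a rational sos. In particular, if $P_3$ denotes the path with three edges and $K_2$ the single edge, then $P_3-K_2^3$ is not sos-testable and is not a rational sos. -/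

import Mathlib

namespace GraphSOS

/-! ### Partially labeled graphs without isolated vertices, up to isomorphism -/

/-- A simple graph with finitely many edges on the fixed vertex pool `L ⊕ ℕ`. It stands for the
finite graph without isolated vertices whose vertex set is `support` (the pool elements that lie on
an edge). A vertex `Sum.inl l` carries the label `l`; a vertex `Sum.inr n` is unlabeled. -/
abbrev RawGraph (L : Type) : Type := {G : SimpleGraph (L ⊕ ℕ) // G.edgeSet.Finite}

namespace RawGraph

variable {L M N : Type}

theorem finite_edgeSet_map {X Y : Type*} {G : SimpleGraph X} (hG : G.edgeSet.Finite) (f : X → Y) :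
    (G.map f).edgeSet.Finite := by
  refine (hG.image (Sym2.map f)).subset ?_
  intro e
  induction e with
  | h a b =>
    rintro ⟨-, u, v, h, rfl, rfl⟩
    exact ⟨s(u, v), h, rfl⟩

/-- Transport of a graph along a map of the vertex pools (used for injective maps only). -/
def map (f : L ⊕ ℕ → M ⊕ ℕ) (G : RawGraph L) : RawGraph M :=
  ⟨G.1.map f, finite_edgeSet_map G.2 f⟩

/-- Union of two graphs: a doubled edge is kept once. -/
def union (G H : RawGraph L) : RawGraph L :=
  ⟨G.1 ⊔ H.1, by rw [SimpleGraph.edgeSet_sup]; exact G.2.union H.2⟩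

/-- The graph with no edges, hence no vertices. -/
def empty (L : Type) : RawGraph L := ⟨⊥, by simp⟩

theorem map_map (f : L ⊕ ℕ → M ⊕ ℕ) (g : M ⊕ ℕ → N ⊕ ℕ) (G : RawGraph L) :
    (G.map f).map g = G.map (g ∘ f) :=
  Subtype.ext (SimpleGraph.map_map _ _ _)

theorem map_id (G : RawGraph L) : G.map id = G :=
  Subtype.ext (SimpleGraph.map_id _)

theorem map_union (f : L ⊕ ℕ → M ⊕ ℕ) (G H : RawGraph L) :
    (G.union H).map f = (G.map f).union (H.map f) := by
  refine Subtype.ext ?_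
  ext a b
  simp only [map, union, SimpleGraph.map_adj', SimpleGraph.sup_adj]
  grind

theorem map_empty (f : L ⊕ ℕ → M ⊕ ℕ) : (empty L).map f = empty M := by
  refine Subtype.ext ?_
  ext a b
  simp [map, empty, SimpleGraph.map_adj']

theorem union_assoc (G H K : RawGraph L) : (G.union H).union K = G.union (H.union K) :=
  Subtype.ext (sup_assoc _ _ _)

theorem union_comm (G H : RawGraph L) : G.union H = H.union G := Subtype.ext (sup_comm _ _)

/-- Renaming of the unlabeled vertices; labels are kept. -/
def rename (f : ℕ → ℕ) (G : RawGraph L) : RawGraph L := G.map (Sum.map id f)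

theorem rename_rename (f g : ℕ → ℕ) (G : RawGraph L) :
    (G.rename f).rename g = G.rename (g ∘ f) := by
  simp only [rename, map_map, Sum.map_comp_map, Function.id_comp]

theorem rename_id (G : RawGraph L) : G.rename id = G := by
  simp only [rename, Sum.map_id_id, map_id]

theorem rename_union (f : ℕ → ℕ) (G H : RawGraph L) :
    (G.union H).rename f = (G.rename f).union (H.rename f) := map_union _ _ _

/-- Isomorphism of partially labeled graphs: a renaming of the unlabeled vertices. -/
instance setoid (L : Type) : Setoid (RawGraph L) where
  r G H := ∃ σ : Equiv.Perm ℕ, G.rename σ = H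
  iseqv :=
    { refl := fun G => ⟨1, G.rename_id⟩
      symm := by
        rintro G _ ⟨σ, rfl⟩
        refine ⟨σ.symm, ?_⟩
        rw [rename_rename, Equiv.symm_comp_self, rename_id]
      trans := by
        rintro G _ _ ⟨σ, rfl⟩ ⟨τ, rfl⟩
        exact ⟨σ.trans τ, by rw [rename_rename]; rfl⟩ }

theorem equiv_iff {G H : RawGraph L} : G ≈ H ↔ ∃ σ : Equiv.Perm ℕ, G.rename σ = H := Iff.rfl

theorem map_congr {f g : L ⊕ ℕ → M ⊕ ℕ} (G : RawGraph L) (h : ∀ x ∈ G.1.support, f x = g x) :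
    G.map f = G.map g := by
  refine Subtype.ext ?_
  ext a b
  simp only [map, SimpleGraph.map_adj']
  refine and_congr_right fun _ => ?_
  constructor
  · rintro ⟨u, v, huv, rfl, rfl⟩
    exact ⟨u, v, huv, (h u huv.mem_support_left).symm, (h v huv.mem_support_right).symm⟩
  · rintro ⟨u, v, huv, rfl, rfl⟩
    exact ⟨u, v, huv, h u huv.mem_support_left, h v huv.mem_support_right⟩

theorem finite_support (G : RawGraph L) : G.1.support.Finite := by
  have : G.1.support ⊆ ⋃ e ∈ G.1.edgeSet, {x | x ∈ e} := by
    rintro x ⟨y, hxy⟩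
    simp only [Set.mem_iUnion]
    exact ⟨s(x, y), hxy, by simp⟩
  refine (G.2.biUnion fun e _ => ?_).subset this
  induction e with
  | h a b =>
    refine (Set.toFinite {a, b}).subset ?_
    intro x hx
    simpa using hx

/-- Renaming along any injection gives an isomorphic graph. -/
theorem rename_equiv {f : ℕ → ℕ} (hf : Function.Injective f) (G : RawGraph L) :
    G ≈ G.rename f := by
  have hfin : {n : ℕ | Sum.inr n ∈ G.1.support}.Finite :=
    G.finite_support.preimage Sum.inr_injective.injOn
  have : Finite {n : ℕ | (Sum.inr n : L ⊕ ℕ) ∈ G.1.support} := hfin.to_subtype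
  obtain ⟨σ, hσ⟩ := Equiv.Perm.exists_extending_pair
    (fun n : {n : ℕ | (Sum.inr n : L ⊕ ℕ) ∈ G.1.support} => (n : ℕ)) (fun n => f n)
    Subtype.val_injective (hf.comp Subtype.val_injective)
  refine ⟨σ, map_congr G ?_⟩
  rintro (l | n) hx
  · rfl
  · exact congrArg Sum.inr (hσ ⟨n, hx⟩)

/-- Gluing: the unlabeled vertices of the two graphs are made disjoint (they are renamed to even and
to odd numbers), vertices with the same label are identified, doubled edges are kept once. -/
def glue (G H : RawGraph L) : RawGraph L :=
  (G.rename fun n => 2 * n).union (H.rename fun n => 2 * n + 1)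

/-- Number of edges. -/
noncomputable def edgeCount (G : RawGraph L) : ℕ := G.1.edgeSet.ncard

/-- Forgetting the labels: all vertices become unlabeled, labeled ones get even names and unlabeled
ones odd names. -/
def unlabel (G : RawGraph ℕ) : RawGraph Empty :=
  G.map fun x => Sum.inr (Sum.elim (fun l => 2 * l) (fun n => 2 * n + 1) x)

/-- The permutation of `ℕ` acting by `σ` on even and by `τ` on odd numbers. -/
def permEvenOdd (σ τ : Equiv.Perm ℕ) : Equiv.Perm ℕ :=
  (Equiv.natSumNatEquivNat.symm.trans (Equiv.sumCongr σ τ)).trans Equiv.natSumNatEquivNat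

theorem permEvenOdd_even (σ τ : Equiv.Perm ℕ) (n : ℕ) : permEvenOdd σ τ (2 * n) = 2 * σ n := by
  have h : Equiv.natSumNatEquivNat.symm (2 * n) = Sum.inl n := by
    rw [Equiv.symm_apply_eq]; simp
  simp [permEvenOdd, h]

theorem permEvenOdd_odd (σ τ : Equiv.Perm ℕ) (n : ℕ) :
    permEvenOdd σ τ (2 * n + 1) = 2 * τ n + 1 := by
  have h : Equiv.natSumNatEquivNat.symm (2 * n + 1) = Sum.inr n := by
    rw [Equiv.symm_apply_eq]; simp
  simp [permEvenOdd, h]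

theorem glue_congr {G G' H H' : RawGraph L} (hG : G ≈ G') (hH : H ≈ H') :
    G.glue H ≈ G'.glue H' := by
  obtain ⟨σ, rfl⟩ := hG
  obtain ⟨τ, rfl⟩ := hH
  refine ⟨permEvenOdd σ τ, ?_⟩
  simp only [glue, rename_union, rename_rename]
  congr 2
  · funext n; exact permEvenOdd_even σ τ n
  · funext n; exact permEvenOdd_odd σ τ n

theorem glue_assoc_equiv (G H K : RawGraph L) : (G.glue H).glue K ≈ G.glue (H.glue K) := by
  obtain ⟨e, hl, hr⟩ : ∃ e : ℕ ⊕ ℕ ≃ ℕ, (∀ n, e (Sum.inl n) = 2 * n) ∧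
      ∀ n, e (Sum.inr n) = 2 * n + 1 :=
    ⟨Equiv.natSumNatEquivNat, fun n => by simp, fun n => by simp⟩
  let σ : Equiv.Perm ℕ :=
    (((e.symm.trans (Equiv.sumCongr e.symm (Equiv.refl ℕ))).trans (Equiv.sumAssoc ℕ ℕ ℕ)).trans
      (Equiv.sumCongr (Equiv.refl ℕ) e)).trans e
  refine ⟨σ, ?_⟩
  simp only [glue, rename_union, rename_rename, union_assoc, ← hr]
  simp only [← hl]
  congr 2
  · funext n; simp [σ]
  · congr 1
    funext n; simp [σ]
  · congr 1
    funext n; simp [σ]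

theorem glue_comm_equiv (G H : RawGraph L) : G.glue H ≈ H.glue G := by
  let e := Equiv.natSumNatEquivNat
  have he : ∀ n, e.symm (2 * n) = Sum.inl n := fun n => by
    rw [Equiv.symm_apply_eq]; simp [e]
  have ho : ∀ n, e.symm (2 * n + 1) = Sum.inr n := fun n => by
    rw [Equiv.symm_apply_eq]; simp [e]
  refine ⟨(e.symm.trans (Equiv.sumComm ℕ ℕ)).trans e, ?_⟩
  simp only [glue, rename_union, rename_rename]
  rw [union_comm]
  congr 2
  · funext n; simp [ho, e]
  · funext n; simp [he, e]

theorem glue_empty_equiv (G : RawGraph L) : G.glue (empty L) ≈ G := by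
  have h : G.glue (empty L) = G.rename fun n => 2 * n := by
    refine Subtype.ext ?_
    have : (empty L).rename (fun n => 2 * n + 1) = empty L := map_empty _
    simp only [glue, this]
    simp [union, empty]
  rw [h]
  exact Setoid.symm (rename_equiv (fun a b hab => by simpa using hab) G)

theorem edgeCount_map (f : L ⊕ ℕ ↪ M ⊕ ℕ) (G : RawGraph L) :
    (G.map f).edgeCount = G.edgeCount := by
  simp only [edgeCount, map, SimpleGraph.edgeSet_map]
  exact Set.ncard_image_of_injective _ f.sym2Map.injective

theorem edgeCount_congr {G H : RawGraph L} (h : G ≈ H) : G.edgeCount = H.edgeCount := by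
  obtain ⟨σ, rfl⟩ := h
  exact (edgeCount_map (Equiv.sumCongr (Equiv.refl L) σ).toEmbedding G).symm

theorem unlabel_congr {G H : RawGraph ℕ} (h : G ≈ H) : G.unlabel ≈ H.unlabel := by
  obtain ⟨σ, rfl⟩ := h
  refine ⟨permEvenOdd 1 σ, ?_⟩
  simp only [unlabel, rename, map_map]
  congr 1
  funext x
  rcases x with l | n
  · simp [permEvenOdd_even]
  · simp [permEvenOdd_odd]

/-- A connected component of a graph, as a graph. -/
def component (G : RawGraph L) (c : G.1.ConnectedComponent) : RawGraph L :=
  ⟨c.toSimpleGraph.spanningCoe, by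
    refine G.2.subset (SimpleGraph.edgeSet_mono ?_)
    intro u v h
    exact (c.adj_spanningCoe_toSimpleGraph.mp h).2⟩

/-- The graph (on its vertex set `support`) is connected; in particular it is not empty. -/
def Connected (G : RawGraph L) : Prop := (G.1.induce G.1.support).Connected

theorem component_rename (G : RawGraph L) (σ : Equiv.Perm ℕ) :
    ∃ φ : G.1.ConnectedComponent ≃ (G.rename σ).1.ConnectedComponent,
      ∀ c, (G.component c).rename σ = (G.rename σ).component (φ c) := by
  let s : L ⊕ ℕ ≃ L ⊕ ℕ := Equiv.sumCongr (Equiv.refl L) σ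
  let ι : G.1 ≃g (G.rename σ).1 := SimpleGraph.Iso.map s G.1
  refine ⟨ι.connectedComponentEquiv, fun c => Subtype.ext ?_⟩
  have key : ∀ x, ι x ∈ (ι.connectedComponentEquiv c).supp ↔ x ∈ c.supp := fun x =>
    SimpleGraph.ConnectedComponent.iso_image_comp_eq_map_iff_eq_comp
  ext a b
  obtain ⟨a, rfl⟩ := ι.surjective a
  obtain ⟨b, rfl⟩ := ι.surjective b
  have h1 : ((G.component c).rename σ).1.Adj (ι a) (ι b) ↔ (G.component c).1.Adj a b :=
    SimpleGraph.map_adj_apply (f := s.toEmbedding)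
  rw [h1]
  simp only [component]
  rw [c.adj_spanningCoe_toSimpleGraph,
    (ι.connectedComponentEquiv c).adj_spanningCoe_toSimpleGraph, key, ι.map_adj_iff]

end RawGraph

/-- Partially labeled graphs (labels in `L`) without isolated vertices, up to isomorphism. -/
def PLGraph (L : Type) : Type := Quotient (RawGraph.setoid L)

/-- Unlabeled graphs without isolated vertices, up to isomorphism. -/
abbrev UGraph : Type := PLGraph Empty

namespace PLGraph

variable {L : Type}

/-- The isomorphism class of a graph. -/
def mk (G : RawGraph L) : PLGraph L := Quotient.mk (RawGraph.setoid L) G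

/-- The product is gluing along equal labels; the unit is the empty graph. -/
instance commMonoid (L : Type) : CommMonoid (PLGraph L) where
  mul := Quotient.map₂ RawGraph.glue fun _ _ h _ _ h' => RawGraph.glue_congr h h'
  one := mk (RawGraph.empty L)
  mul_assoc := by
    rintro ⟨G⟩ ⟨H⟩ ⟨K⟩
    exact Quotient.sound (RawGraph.glue_assoc_equiv G H K)
  mul_comm := by
    rintro ⟨G⟩ ⟨H⟩
    exact Quotient.sound (RawGraph.glue_comm_equiv G H)
  one_mul := by
    rintro ⟨G⟩
    exact Quotient.sound
      (Setoid.trans (RawGraph.glue_comm_equiv _ _) (RawGraph.glue_empty_equiv G))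
  mul_one := by
    rintro ⟨G⟩
    exact Quotient.sound (RawGraph.glue_empty_equiv G)

/-- Number of edges. -/
noncomputable def edgeCount (H : PLGraph L) : ℕ :=
  Quotient.lift RawGraph.edgeCount (fun _ _ h => RawGraph.edgeCount_congr h) H

/-- Forgetting the labels of a graph. -/
def unlabel (H : PLGraph ℕ) : UGraph :=
  Quotient.map RawGraph.unlabel (fun _ _ h => RawGraph.unlabel_congr h) H

/-- Every vertex carries a label. -/
def FullyLabeled (H : PLGraph ℕ) : Prop :=
  ∃ G : RawGraph ℕ, mk G = H ∧ G.1.support ⊆ Set.range Sum.inl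

/-- The graph is connected (and not empty). -/
def Connected (H : PLGraph L) : Prop := ∃ G : RawGraph L, mk G = H ∧ G.Connected

end PLGraph

/-- Connected unlabeled graphs other than the empty graph, up to isomorphism. -/
abbrev ConnGraph : Type := {C : UGraph // C.Connected}

namespace UGraph

/-- The class of a finite simple graph (its isolated vertices, if any, are dropped). The vertices are
named by an arbitrary enumeration; the class does not depend on it. -/
noncomputable def ofSimpleGraph {V : Type*} [Finite V] (G : SimpleGraph V) : UGraph :=
  PLGraph.mk ⟨G.map fun x => Sum.inr (Finite.equivFin V x : ℕ),
    RawGraph.finite_edgeSet_map (Set.toFinite _) _⟩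

/-- A trivial square: `H = [[F ^ 2]]` only if `F` is a fully labeled copy of `H`. -/
def IsTrivialSquare (H : UGraph) : Prop :=
  ∀ F : PLGraph ℕ, (F * F).unlabel = H → F.FullyLabeled ∧ F.unlabel = H

/-- The exponent of `C` in the factorization of `H` into connected graphs: the number of connected
components of `H` isomorphic to `C`. -/
noncomputable def multiplicity (C : ConnGraph) (H : UGraph) : ℕ :=
  Quotient.lift
    (fun G : RawGraph Empty =>
      Nat.card {c : G.1.ConnectedComponent // PLGraph.mk (G.component c) = C.1})
    (by
      rintro G _ ⟨σ, rfl⟩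
      obtain ⟨φ, hφ⟩ := G.component_rename σ
      refine Nat.card_congr (φ.subtypeEquiv fun c => ?_)
      rw [← hφ c]
      have : PLGraph.mk ((G.component c).rename σ) = PLGraph.mk (G.component c) :=
        (Quotient.sound ⟨σ, rfl⟩ : PLGraph.mk (G.component c) = _).symm
      rw [this]) H

/-- The value at the point `v` of the monomial in connected graphs that `H` is. -/
noncomputable def eval (v : ConnGraph → ℝ) (H : UGraph) : ℝ :=
  ∏ᶠ C : ConnGraph, v C ^ multiplicity C H

end UGraph

/-! ### The gluing algebra and sums of squares -/

/-- The algebra of graph combinations (finite formal real linear combinations of partially labeled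
graphs), with labels in `ℕ`. -/
abbrev LabeledCombination : Type := MonoidAlgebra ℝ (PLGraph ℕ)

/-- The algebra of unlabeled graph combinations. -/
abbrev GraphCombination : Type := MonoidAlgebra ℝ UGraph

/-- An unlabeled graph as a graph combination. -/
noncomputable def UGraph.toComb (H : UGraph) : GraphCombination := MonoidAlgebra.single H 1

/-- The unlabeling map `[[ · ]]`. -/
noncomputable def unlabel : LabeledCombination →ₗ[ℝ] GraphCombination :=
  MonoidAlgebra.mapDomainLinearMap ℝ ℝ PLGraph.unlabel

/-- The value of a graph combination at the point `v`. -/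
noncomputable def evalAt (v : ConnGraph → ℝ) (a : GraphCombination) : ℝ :=
  a.coeff.sum fun H r => r * UGraph.eval v H

/-- Sums of squares `∑ [[f_j ^ 2]]`. -/
def IsSos (a : GraphCombination) : Prop :=
  ∃ (n : ℕ) (f : Fin n → LabeledCombination), a = ∑ j, unlabel (f j ^ 2)

/-- Sums of squares `∑ [[f_j ^ 2]]` such that every constituent graph of every `f_j` has at most `d`
edges. -/
def IsDSos (d : ℕ) (a : GraphCombination) : Prop :=
  ∃ (n : ℕ) (f : Fin n → LabeledCombination),
    (∀ j, ∀ H ∈ (f j).coeff.support, H.edgeCount ≤ d) ∧ a = ∑ j, unlabel (f j ^ 2)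

/-- The `d`-sos-profile: the nonnegative points at which every `d`-sos graph combination is
nonnegative. Points have one coordinate for each connected graph; only the finitely many coordinates
that occur in a `d`-sos graph combination are constrained beyond nonnegativity. -/
def sosProfile (d : ℕ) : Set (ConnGraph → ℝ) :=
  {v | (∀ C, 0 ≤ v C) ∧ ∀ a, IsDSos d a → 0 ≤ evalAt v a}

/-- `a` is sos-testable: it is nonnegative on the `d`-sos-profile for some `d`. -/
def SosTestable (a : GraphCombination) : Prop :=
  ∃ d : ℕ, 0 < d ∧ ∀ v ∈ sosProfile d, 0 ≤ evalAt v a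

/-- `a` is a rational sum of squares: `a = c / b` with `b ≠ 0` and `b`, `c` sums of squares. -/
def IsRationalSos (a : GraphCombination) : Prop :=
  ∃ b c : GraphCombination, b ≠ 0 ∧ IsSos b ∧ IsSos c ∧ a * b = c

end GraphSOS

universe u v

/-! The argument is a tropical one. Call a real function W of unlabeled graphs additive if W(AB) =
W(A) + W(B). For every τ the function χ = exp(-τW) is a positive character, hence a point with
positive coordinates. Suppose that `midGap` W F G = 2W([[FG]]) - W([[F²]]) - W([[G²]]) is positive
for all distinct F, G in a finite family. Once its diagonal is scaled to 1, the matrix χ([[FG]]) has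
the off-diagonal entries exp(-τ · `midGap` / 2). For large τ it is diagonally dominant, so χ is
nonnegative on the squares formed from the family. If also W(Hbar) > W(Hund), then χ(Hbar) <
χ(Hund), and the difference is negative at a point of the profile. A rational representation ab = c
fails for the same reason: if W is injective on the graphs of b, the term of least weight dominates
and χ(b) ≠ 0 for large τ. Then χ(b) > 0 and χ(c) ≥ 0, although χ(a) < 0.

Two reductions make the family finite. Forgetting a label is an orthogonal projection for the form
χ([[ab]]), and these projections commute; splitting along them shows that 2d labels suffice for
graphs with at most d edges (`nonneg_of_bounded`). Unlabeled components contribute a scalar factor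
to χ([[FG]]), so only reduced graphs matter, those in which every component has a label.

The weight is a sum of four terms, each small compared with the one before (`exists_weight`). The
first is the sum over the vertices of `kink` p of the degree. Since `kink` p is concave and
increasing, the weak inequality 0 ≤ `midGap` holds. Both given graphs get the value 2e, with e the
common number of edges, because `kink` p is the identity up to p + 1. The second is the multiplicity
of a component C that is more frequent in Hbar than in Hund. It only has to satisfy the weak
inequality where the first gap vanishes. This holds because C is itself a trivial square with
degrees p and p + 1: a tie forces the two graphs to have the same neighborhood at every vertex of a
fully labeled copy of C (`RawGraph.multiplicity_glue_le`). The third is a sum of functions -log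
t(·), where t is a homomorphism density. The weak inequality is Cauchy-Schwarz, and Lovász-type
counting of homomorphisms makes it strict for distinct reduced graphs
(`RawGraph.exists_homDensity_lt`). The fourth is a generic linear function of the component
multiplicities, which gives injectivity on a finite set. -/

namespace GraphSOS

/-! ### Drawing graphs in a common vertex pool; transport of labels and gluing -/

namespace RawGraph

variable {L M N : Type}

theorem adj_map {f : L ⊕ ℕ → M ⊕ ℕ} (hf : Function.Injective f) (G : RawGraph L) (a b : M ⊕ ℕ) :
    (G.map f).1.Adj a b ↔ ∃ x y, G.1.Adj x y ∧ f x = a ∧ f y = b := by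
  simp only [map, SimpleGraph.map_adj']
  constructor
  · rintro ⟨-, h⟩; exact h
  · rintro ⟨x, y, h, rfl, rfl⟩
    exact ⟨fun e => h.ne (hf e), x, y, h, rfl, rfl⟩

theorem adj_map_apply {f : L ⊕ ℕ → M ⊕ ℕ} (hf : Function.Injective f) (G : RawGraph L)
    (x y : L ⊕ ℕ) : (G.map f).1.Adj (f x) (f y) ↔ G.1.Adj x y := by
  rw [adj_map hf]
  constructor
  · rintro ⟨x', y', h, hx, hy⟩
    rwa [← hf hx, ← hf hy]
  · intro h; exact ⟨x, y, h, rfl, rfl⟩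

theorem support_map {f : L ⊕ ℕ → M ⊕ ℕ} (hf : Function.Injective f) (G : RawGraph L) :
    (G.map f).1.support = f '' G.1.support := by
  ext a
  simp only [SimpleGraph.mem_support, adj_map hf, Set.mem_image]
  constructor
  · rintro ⟨b, x, y, h, rfl, rfl⟩; exact ⟨x, ⟨y, h⟩, rfl⟩
  · rintro ⟨x, ⟨y, h⟩, rfl⟩; exact ⟨f y, x, y, h, rfl, rfl⟩

theorem map_injective {f : L ⊕ ℕ → M ⊕ ℕ} (hf : Function.Injective f) :
    Function.Injective (map f) := by
  intro G H h
  refine Subtype.ext ?_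
  ext x y
  rw [← adj_map_apply hf, h, adj_map_apply hf]

@[simp] theorem adj_union (G H : RawGraph L) (a b : L ⊕ ℕ) :
    (G.union H).1.Adj a b ↔ G.1.Adj a b ∨ H.1.Adj a b := by
  simp [union, SimpleGraph.sup_adj]

theorem support_union (G H : RawGraph L) :
    (G.union H).1.support = G.1.support ∪ H.1.support := by
  ext a
  simp only [SimpleGraph.mem_support, adj_union, Set.mem_union, exists_or]

/-- Two ways of drawing two graphs in a common vertex pool give isomorphic unions if they identify
the same vertices and produce the same labels. -/
theorem union_map_equiv {F : RawGraph L} {G : RawGraph N} {f f' : L ⊕ ℕ → M ⊕ ℕ}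
    {g g' : N ⊕ ℕ → M ⊕ ℕ} (hf : Function.Injective f) (hf' : Function.Injective f')
    (hg : Function.Injective g) (hg' : Function.Injective g')
    (hfl : ∀ x ∈ F.1.support, ∀ m, f x = Sum.inl m ↔ f' x = Sum.inl m)
    (hgl : ∀ x ∈ G.1.support, ∀ m, g x = Sum.inl m ↔ g' x = Sum.inl m)
    (hfg : ∀ x ∈ F.1.support, ∀ y ∈ G.1.support, f x = g y ↔ f' x = g' y) :
    (F.map f).union (G.map g) ≈ (F.map f').union (G.map g') := by
  classical
  -- `X` collects the unlabeled names used in the first drawing. The hypotheses make the translation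
  -- `t` from old to new names well defined and injective, and an injection on a finite set extends
  -- to a permutation of `ℕ`.
  set X : Set ℕ := {n : ℕ | (∃ x ∈ F.1.support, f x = Sum.inr n) ∨
    ∃ y ∈ G.1.support, g y = Sum.inr n} with hX
  have hfin : X.Finite := by
    have : X ⊆ (Sum.inr : ℕ → M ⊕ ℕ) ⁻¹' (f '' F.1.support ∪ g '' G.1.support) := by
      rintro n (⟨x, hx, h⟩ | ⟨x, hx, h⟩)
      · exact Or.inl ⟨x, hx, h⟩
      · exact Or.inr ⟨x, hx, h⟩
    exact (Set.Finite.preimage Sum.inr_injective.injOn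
      ((F.finite_support.image f).union (G.finite_support.image g))).subset this
  have : Finite X := hfin.to_subtype
  have hex : ∀ n : X, ∃ m : ℕ, (∀ x ∈ F.1.support, f x = Sum.inr n.1 → f' x = Sum.inr m) ∧
      (∀ y ∈ G.1.support, g y = Sum.inr n.1 → g' y = Sum.inr m) := by
    rintro ⟨n, ⟨x, hx, h⟩ | ⟨y, hy, h⟩⟩
    · rcases h' : f' x with m | m
      · rw [(hfl x hx m).2 h'] at h; cases h
      · refine ⟨m, fun x' _ e => ?_, fun y hy e => ?_⟩
        · rw [hf (e.trans h.symm), h']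
        · rw [← (hfg x hx y hy).1 (h.trans e.symm), h']
    · rcases h' : g' y with m | m
      · rw [(hgl y hy m).2 h'] at h; cases h
      · refine ⟨m, fun x hx e => ?_, fun y' _ e => ?_⟩
        · rw [(hfg x hx y hy).1 (e.trans h.symm), h']
        · rw [hg (e.trans h.symm), h']
  choose t htF htG using hex
  have hinj : Function.Injective t := by
    rintro ⟨n, hn⟩ ⟨n', hn'⟩ e
    refine Subtype.ext ?_
    have key : ∀ k : X, (∃ x ∈ F.1.support, f x = Sum.inr k.1 ∧ f' x = Sum.inr (t k)) ∨
        ∃ y ∈ G.1.support, g y = Sum.inr k.1 ∧ g' y = Sum.inr (t k) := by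
      rintro ⟨k, ⟨x, hx, h⟩ | ⟨y, hy, h⟩⟩
      · exact Or.inl ⟨x, hx, h, htF _ x hx h⟩
      · exact Or.inr ⟨y, hy, h, htG _ y hy h⟩
    rcases key ⟨n, hn⟩ with ⟨x, hx, h1, h2⟩ | ⟨x, hx, h1, h2⟩ <;>
    rcases key ⟨n', hn'⟩ with ⟨y, hy, h3, h4⟩ | ⟨y, hy, h3, h4⟩ <;>
    rw [← e] at h4
    · rw [hf' (h2.trans h4.symm), h3] at h1; simpa using h1.symm
    · have := (hfg x hx y hy).2 (h2.trans h4.symm)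
      rw [h1, h3] at this; simpa using this
    · have := (hfg y hy x hx).2 (h4.trans h2.symm)
      rw [h1, h3] at this; simpa using this.symm
    · rw [hg' (h2.trans h4.symm), h3] at h1; simpa using h1.symm
  obtain ⟨σ, hσ⟩ := Equiv.Perm.exists_extending_pair (fun n : X => (n : ℕ)) t
    Subtype.val_injective hinj
  refine ⟨σ, ?_⟩
  rw [rename_union]
  simp only [rename, map_map]
  congr 1
  · refine map_congr F fun x hx => ?_
    rcases h : f x with m | n
    · simp [h, (hfl x hx m).1 h]
    · have hn : n ∈ X := Or.inl ⟨x, hx, h⟩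
      simp [h, htF ⟨n, hn⟩ x hx h, hσ ⟨n, hn⟩]
  · refine map_congr G fun x hx => ?_
    rcases h : g x with m | n
    · simp [h, (hgl x hx m).1 h]
    · have hn : n ∈ X := Or.inr ⟨x, hx, h⟩
      simp [h, htG ⟨n, hn⟩ x hx h, hσ ⟨n, hn⟩]

theorem union_self (G : RawGraph L) : G.union G = G := Subtype.ext (sup_idem _)

theorem union_empty (G : RawGraph L) : G.union (empty L) = G := Subtype.ext (by simp [union, empty])

/-- Two injections that produce the same labels give isomorphic graphs. -/
theorem map_equiv {F : RawGraph L} {f f' : L ⊕ ℕ → M ⊕ ℕ}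
    (hf : Function.Injective f) (hf' : Function.Injective f')
    (hfl : ∀ x ∈ F.1.support, ∀ m, f x = Sum.inl m ↔ f' x = Sum.inl m) :
    F.map f ≈ F.map f' := by
  have := union_map_equiv (F := F) (G := F) hf hf' hf hf' hfl hfl
    (fun x _ y _ => by rw [hf.eq_iff, hf'.eq_iff])
  rwa [union_self, union_self] at this

/-- The embedding of the vertex pool used for the left factor of a gluing product. -/
def evenMap (L : Type) : L ⊕ ℕ → L ⊕ ℕ := Sum.map id fun n => 2 * n

/-- The embedding of the vertex pool used for the right factor of a gluing product. -/
def oddMap (L : Type) : L ⊕ ℕ → L ⊕ ℕ := Sum.map id fun n => 2 * n + 1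

@[simp] theorem evenMap_inl (l : L) : evenMap L (Sum.inl l) = Sum.inl l := rfl
@[simp] theorem evenMap_inr (n : ℕ) : evenMap L (Sum.inr n) = Sum.inr (2 * n) := rfl
@[simp] theorem oddMap_inl (l : L) : oddMap L (Sum.inl l) = Sum.inl l := rfl
@[simp] theorem oddMap_inr (n : ℕ) : oddMap L (Sum.inr n) = Sum.inr (2 * n + 1) := rfl

theorem evenMap_injective : Function.Injective (evenMap L) :=
  Function.injective_id.sumMap fun a b h => by simpa using h

theorem oddMap_injective : Function.Injective (oddMap L) :=
  Function.injective_id.sumMap fun a b h => by simpa using h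

theorem evenMap_eq_oddMap_iff (x y : L ⊕ ℕ) :
    evenMap L x = oddMap L y ↔ ∃ l, x = Sum.inl l ∧ y = Sum.inl l := by
  rcases x with l | n <;> rcases y with m | k <;> simp [eq_comm]
  omega

@[simp] theorem evenMap_eq_inl_iff (x : L ⊕ ℕ) (l : L) :
    evenMap L x = Sum.inl l ↔ x = Sum.inl l := by
  rcases x with l | n <;> simp

@[simp] theorem oddMap_eq_inl_iff (x : L ⊕ ℕ) (l : L) :
    oddMap L x = Sum.inl l ↔ x = Sum.inl l := by
  rcases x with l | n <;> simp

theorem glue_eq (G H : RawGraph L) :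
    G.glue H = (G.map (evenMap L)).union (H.map (oddMap L)) := rfl

/-- The map of vertex pools induced by sending each label to a label or to an unlabeled vertex. -/
def transportMap (g : L → M ⊕ ℕ) : L ⊕ ℕ → M ⊕ ℕ :=
  Sum.elim (fun l => evenMap M (g l)) fun n => Sum.inr (2 * n + 1)

theorem transportMap_injective {g : L → M ⊕ ℕ} (hg : Function.Injective g) :
    Function.Injective (transportMap g) := by
  refine Function.Injective.sumElim (evenMap_injective.comp hg) (fun a b h => by simpa using h) ?_
  intro l n h
  rcases hgl : g l with m | k <;> simp [hgl] at h
  omega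

@[simp] theorem transportMap_inl_eq_inl_iff (g : L → M ⊕ ℕ) (x : L ⊕ ℕ) (m : M) :
    transportMap g x = Sum.inl m ↔ ∃ l, x = Sum.inl l ∧ g l = Sum.inl m := by
  rcases x with l | n <;> simp [transportMap]

theorem transport_congr {g : L → M ⊕ ℕ} (hg : Function.Injective g) {G H : RawGraph L}
    (h : G ≈ H) : G.map (transportMap g) ≈ H.map (transportMap g) := by
  obtain ⟨σ, rfl⟩ := h
  rw [rename, map_map]
  refine map_equiv (transportMap_injective hg)
    ((transportMap_injective hg).comp (Function.injective_id.sumMap σ.injective)) ?_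
  rintro (l | n) - m <;> simp

theorem unlabel_eq (G : RawGraph ℕ) : G.unlabel = G.map (transportMap (M := Empty) Sum.inr) := by
  refine map_congr G ?_
  rintro (l | n) - <;> rfl

theorem mk_eq_iff {G H : RawGraph L} : PLGraph.mk G = PLGraph.mk H ↔ G ≈ H := Quotient.eq

theorem edgeCount_map' {f : L ⊕ ℕ → M ⊕ ℕ} (hf : Function.Injective f) (G : RawGraph L) :
    (G.map f).edgeCount = G.edgeCount := edgeCount_map ⟨f, hf⟩ G

theorem edgeCount_mono {G H : RawGraph L} (h : G.1 ≤ H.1) : G.edgeCount ≤ H.edgeCount :=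
  Set.ncard_le_ncard (SimpleGraph.edgeSet_mono h) H.2

theorem eq_of_le_of_edgeCount_le {G H : RawGraph L} (h : G.1 ≤ H.1)
    (h' : H.edgeCount ≤ G.edgeCount) : G = H :=
  Subtype.ext (SimpleGraph.edgeSet_injective
    (Set.eq_of_subset_of_ncard_le (SimpleGraph.edgeSet_mono h) h' H.2))

/-- A union of two graphs without common unlabeled vertices is their gluing product. -/
theorem mk_union {A B : RawGraph L}
    (h : ∀ n, Sum.inr n ∈ A.1.support → Sum.inr n ∉ B.1.support) :
    PLGraph.mk (A.union B) = PLGraph.mk A * PLGraph.mk B := by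
  refine Quotient.sound ?_
  have := union_map_equiv (F := A) (G := B) (f := id) (f' := evenMap L) (g := id)
    (g' := oddMap L) Function.injective_id evenMap_injective Function.injective_id
    oddMap_injective (by simp) (by simp) (fun x hx y hy => by
      rw [evenMap_eq_oddMap_iff]
      constructor
      · rintro (rfl : x = y)
        rcases x with l | n
        · exact ⟨l, rfl, rfl⟩
        · exact (h n hx hy).elim
      · rintro ⟨l, rfl, rfl⟩; rfl)
  rwa [map_id, map_id] at this

end RawGraph

namespace PLGraph

open RawGraph

variable {L M N : Type}

theorem mk_mul_mk (G H : RawGraph L) : mk G * mk H = mk (G.glue H) := rfl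

theorem one_eq : (1 : PLGraph L) = mk (RawGraph.empty L) := rfl

theorem exists_rep (F : PLGraph L) : ∃ G, mk G = F := Quotient.exists_rep F

@[simp] theorem edgeCount_mk (G : RawGraph L) : (mk G).edgeCount = G.edgeCount := rfl

/-- Replacing labels, and forgetting some of them, along an injection `g` of the labels. -/
def transport (g : L → M ⊕ ℕ) (hg : Function.Injective g) : PLGraph L → PLGraph M :=
  Quotient.map (RawGraph.map (transportMap g)) fun _ _ h => transport_congr hg h

theorem transport_mk (g : L → M ⊕ ℕ) (hg : Function.Injective g) (G : RawGraph L) :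
    transport g hg (mk G) = mk (G.map (transportMap g)) := rfl

theorem unlabel_eq_transport (F : PLGraph ℕ) :
    F.unlabel = transport Sum.inr Sum.inr_injective F := by
  obtain ⟨G, rfl⟩ := F.exists_rep
  exact congrArg mk G.unlabel_eq

theorem edgeCount_transport (g : L → M ⊕ ℕ) (hg : Function.Injective g) (F : PLGraph L) :
    (transport g hg F).edgeCount = F.edgeCount := by
  obtain ⟨G, rfl⟩ := F.exists_rep
  exact edgeCount_map' (transportMap_injective hg) G

theorem edgeCount_mul (A B : UGraph) : (A * B).edgeCount = A.edgeCount + B.edgeCount := by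
  obtain ⟨G, rfl⟩ := A.exists_rep
  obtain ⟨H, rfl⟩ := B.exists_rep
  rw [mk_mul_mk, edgeCount_mk, edgeCount_mk, edgeCount_mk,
    ← edgeCount_map' evenMap_injective G, ← edgeCount_map' oddMap_injective H, glue_eq]
  simp only [RawGraph.edgeCount, RawGraph.union, SimpleGraph.edgeSet_sup]
  refine Set.ncard_union_eq ?_ (RawGraph.map _ G).2 (RawGraph.map _ H).2
  rw [Set.disjoint_left]
  intro e
  induction e with
  | h a b =>
    rw [SimpleGraph.mem_edgeSet, SimpleGraph.mem_edgeSet, adj_map evenMap_injective,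
      adj_map oddMap_injective]
    rintro ⟨x, y, -, rfl, -⟩ ⟨x', y', -, h, -⟩
    obtain ⟨l, -⟩ := (evenMap_eq_oddMap_iff x x').1 h.symm
    exact l.elim

theorem eq_one_of_edgeCount_eq_zero {A : PLGraph L} (h : A.edgeCount = 0) : A = 1 := by
  obtain ⟨G, rfl⟩ := A.exists_rep
  rw [one_eq]
  congr 1
  exact (eq_of_le_of_edgeCount_le (G := RawGraph.empty L) bot_le (by rw [← edgeCount_mk, h]; simp)).symm

/-- An unlabeled graph as a partially labeled graph. -/
def ofUnlabeled : UGraph → PLGraph ℕ :=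
  transport Empty.elim (Function.injective_of_subsingleton _)

/-- Forgetting the label `s`. -/
def forgetMap (s : ℕ) (l : ℕ) : ℕ ⊕ ℕ := if l = s then Sum.inr 0 else Sum.inl l

theorem forgetMap_injective (s : ℕ) : Function.Injective (forgetMap s) := by
  intro a b h
  simp only [forgetMap] at h
  split_ifs at h <;> simp_all

/-- Forgetting the label `s`. -/
def forget (s : ℕ) : PLGraph ℕ → PLGraph ℕ := transport (forgetMap s) (forgetMap_injective s)

theorem forgetMap_eq_inl_iff (s l m : ℕ) : forgetMap s l = Sum.inl m ↔ l = m ∧ l ≠ s := by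
  simp only [forgetMap]; split_ifs <;> simp_all

/-- Permuting the labels. -/
def relabel (π : Equiv.Perm ℕ) : PLGraph ℕ → PLGraph ℕ :=
  transport (fun l => Sum.inl (π l)) (Sum.inl_injective.comp π.injective)

theorem unlabel_mk (G : RawGraph ℕ) :
    (mk G).unlabel = mk (G.map (transportMap (M := Empty) Sum.inr)) := unlabel_eq_transport _

/-- Without labels a drawing matters only through the coincidences between its two parts, so any
drawing that identifies exactly the equal labels computes [[FG]]. -/
theorem unlabel_mul_mk {F G : RawGraph ℕ} {f g : ℕ ⊕ ℕ → Empty ⊕ ℕ}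
    (hf : Function.Injective f) (hg : Function.Injective g)
    (hfg : ∀ x ∈ F.1.support, ∀ y ∈ G.1.support, f x = g y ↔ ∃ l, x = Sum.inl l ∧ y = Sum.inl l) :
    (mk F * mk G).unlabel = mk ((F.map f).union (G.map g)) := by
  rw [mk_mul_mk, unlabel_mk, glue_eq, map_union, map_map, map_map]
  have ht := transportMap_injective (M := Empty) (Sum.inr_injective (α := Empty) (β := ℕ))
  refine Quotient.sound (union_map_equiv (ht.comp evenMap_injective) hf (ht.comp oddMap_injective)
    hg (fun _ _ m => m.elim) (fun _ _ m => m.elim) fun x hx y hy => ?_)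
  rw [hfg x hx y hy, ← evenMap_eq_oddMap_iff]
  exact ht.eq_iff

/-- A label carried by one factor only identifies nothing. This is what makes forgetting `s`
self-adjoint for the form [[FG]]. -/
theorem unlabel_forget_mul (s : ℕ) (F G : PLGraph ℕ) :
    (forget s F * forget s G).unlabel = (F * forget s G).unlabel := by
  obtain ⟨F, rfl⟩ := F.exists_rep
  obtain ⟨G, rfl⟩ := G.exists_rep
  rw [forget, transport_mk, transport_mk]
  have hφ := transportMap_injective (forgetMap_injective s)
  have ht := transportMap_injective (M := Empty) (Sum.inr_injective (α := Empty) (β := ℕ))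
  rw [mk_mul_mk, unlabel_mk, glue_eq, map_union, map_map, map_map, map_map, map_map]
  rw [mk_mul_mk, unlabel_mk, glue_eq, map_union, map_map, map_map, map_map]
  refine Quotient.sound (union_map_equiv ?_ ?_ ?_ ?_ (fun _ _ m => m.elim) (fun _ _ m => m.elim)
    fun x _ y _ => ?_)
  · exact (ht.comp evenMap_injective).comp hφ
  · exact ht.comp evenMap_injective
  · exact (ht.comp oddMap_injective).comp hφ
  · exact (ht.comp oddMap_injective).comp hφ
  · simp only [Function.comp_apply, ht.eq_iff, evenMap_eq_oddMap_iff, transportMap_inl_eq_inl_iff,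
      forgetMap_eq_inl_iff]
    grind

theorem forget_comm (s t : ℕ) (F : PLGraph ℕ) : forget s (forget t F) = forget t (forget s F) := by
  obtain ⟨F, rfl⟩ := F.exists_rep
  have hs := transportMap_injective (forgetMap_injective s)
  have ht := transportMap_injective (forgetMap_injective t)
  simp only [forget, transport_mk, RawGraph.map_map]
  refine Quotient.sound (map_equiv (hs.comp ht) (ht.comp hs) fun x _ m => ?_)
  simp only [Function.comp_apply, transportMap_inl_eq_inl_iff, forgetMap_eq_inl_iff]
  grind

/-- The graph carries the label `s`. -/
def HasLabel (F : PLGraph ℕ) (s : ℕ) : Prop := ∃ G, mk G = F ∧ Sum.inl s ∈ G.1.support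

theorem hasLabel_mk (G : RawGraph ℕ) (s : ℕ) : (mk G).HasLabel s ↔ Sum.inl s ∈ G.1.support := by
  constructor
  · rintro ⟨H, h, hs⟩
    obtain ⟨σ, rfl⟩ := RawGraph.mk_eq_iff.1 h
    rw [rename, RawGraph.support_map (Function.injective_id.sumMap σ.injective)]
    exact ⟨_, hs, rfl⟩
  · intro h; exact ⟨G, rfl, h⟩

theorem forget_eq_self {s : ℕ} {F : PLGraph ℕ} (h : ¬ F.HasLabel s) : forget s F = F := by
  obtain ⟨F, rfl⟩ := F.exists_rep
  rw [hasLabel_mk] at h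
  have hs := transportMap_injective (forgetMap_injective s)
  rw [forget, transport_mk]
  conv_rhs => rw [← RawGraph.map_id F]
  refine Quotient.sound (map_equiv hs Function.injective_id fun x hx m => ?_)
  simp only [transportMap_inl_eq_inl_iff, forgetMap_eq_inl_iff, id]
  constructor
  · rintro ⟨l, rfl, rfl, -⟩; rfl
  · rintro rfl; exact ⟨m, rfl, rfl, fun e => h (e ▸ hx)⟩

theorem hasLabel_transport (g : ℕ → ℕ ⊕ ℕ) (hg : Function.Injective g) (F : PLGraph ℕ) (m : ℕ) :
    (transport g hg F).HasLabel m ↔ ∃ l, F.HasLabel l ∧ g l = Sum.inl m := by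
  obtain ⟨F, rfl⟩ := F.exists_rep
  rw [transport_mk, hasLabel_mk, RawGraph.support_map (transportMap_injective hg)]
  simp only [Set.mem_image, transportMap_inl_eq_inl_iff, hasLabel_mk]
  grind

theorem hasLabel_forget (s : ℕ) (F : PLGraph ℕ) (m : ℕ) :
    (forget s F).HasLabel m ↔ F.HasLabel m ∧ m ≠ s := by
  rw [forget, hasLabel_transport]
  simp only [forgetMap_eq_inl_iff]
  grind

theorem hasLabel_relabel (π : Equiv.Perm ℕ) (F : PLGraph ℕ) (m : ℕ) :
    (relabel π F).HasLabel m ↔ F.HasLabel (π.symm m) := by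
  rw [relabel, hasLabel_transport]
  simp only [Sum.inl.injEq]
  constructor
  · rintro ⟨l, h, rfl⟩; simpa using h
  · intro h; exact ⟨_, h, by simp⟩

theorem forget_forget (s : ℕ) (F : PLGraph ℕ) : forget s (forget s F) = forget s F :=
  forget_eq_self (by rw [hasLabel_forget]; simp)

/-- Only the coincidence of labels matters for [[FG]], not their names; this later moves a finite
set of labels into an initial segment. -/
theorem unlabel_relabel_mul (π : Equiv.Perm ℕ) (F G : PLGraph ℕ) :
    (relabel π F * relabel π G).unlabel = (F * G).unlabel := by
  obtain ⟨F, rfl⟩ := F.exists_rep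
  obtain ⟨G, rfl⟩ := G.exists_rep
  have hφ := transportMap_injective (M := ℕ) (Sum.inl_injective.comp π.injective)
  have ht := transportMap_injective (M := Empty) (Sum.inr_injective (α := Empty) (β := ℕ))
  rw [relabel, transport_mk, transport_mk]
  rw [mk_mul_mk, unlabel_mk, glue_eq, map_union, map_map, map_map, map_map, map_map]
  symm
  refine unlabel_mul_mk ?_ ?_ fun x _ y _ => ?_
  · exact (ht.comp evenMap_injective).comp hφ
  · exact (ht.comp oddMap_injective).comp hφ
  · simp only [Function.comp_apply, ht.eq_iff, evenMap_eq_oddMap_iff, transportMap_inl_eq_inl_iff]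
    constructor
    · rintro ⟨l, ⟨a, rfl, h1⟩, b, rfl, h2⟩
      refine ⟨a, rfl, ?_⟩
      have := h1.trans h2.symm
      simp only [Sum.inl.injEq, π.injective.eq_iff] at this
      rw [this]
    · rintro ⟨l, rfl, rfl⟩; exact ⟨π l, ⟨l, rfl, rfl⟩, l, rfl, rfl⟩

/-- Unlabeled graphs can be taken out of the unlabeling of a product. -/
theorem unlabel_mul_ofUnlabeled (F : PLGraph ℕ) (U : UGraph) :
    (F * ofUnlabeled U).unlabel = F.unlabel * U := by
  obtain ⟨F, rfl⟩ := F.exists_rep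
  obtain ⟨U, rfl⟩ := U.exists_rep
  have hφ := transportMap_injective (L := Empty) (M := ℕ) (g := Empty.elim)
    (Function.injective_of_subsingleton _)
  have ht := transportMap_injective (M := Empty) (Sum.inr_injective (α := Empty) (β := ℕ))
  rw [ofUnlabeled, transport_mk, mk_mul_mk, unlabel_mk, unlabel_mk, glue_eq, map_union, map_map,
    map_map, map_map, mk_mul_mk, glue_eq, map_map]
  refine Quotient.sound (union_map_equiv ?_ ?_ ?_ ?_ (fun _ _ m => m.elim) (fun _ _ m => m.elim)
    fun x _ y _ => ?_)
  · exact ht.comp evenMap_injective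
  · exact evenMap_injective.comp ht
  · exact (ht.comp oddMap_injective).comp hφ
  · exact oddMap_injective
  · simp only [Function.comp_apply, ht.eq_iff, evenMap_eq_oddMap_iff, transportMap_inl_eq_inl_iff]
    simp

theorem ofUnlabeled_mul (A B : UGraph) : ofUnlabeled (A * B) = ofUnlabeled A * ofUnlabeled B := by
  obtain ⟨A, rfl⟩ := A.exists_rep
  obtain ⟨B, rfl⟩ := B.exists_rep
  have hφ := transportMap_injective (L := Empty) (M := ℕ) (g := Empty.elim)
    (Function.injective_of_subsingleton _)
  rw [ofUnlabeled, transport_mk, transport_mk, mk_mul_mk, mk_mul_mk, transport_mk, glue_eq, glue_eq,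
    map_union, map_map, map_map, map_map, map_map]
  refine Quotient.sound (union_map_equiv ?_ ?_ ?_ ?_ ?_ ?_ fun x _ y _ => ?_)
  · exact hφ.comp evenMap_injective
  · exact evenMap_injective.comp hφ
  · exact hφ.comp oddMap_injective
  · exact oddMap_injective.comp hφ
  · intro _ _ _; simp
  · intro _ _ _; simp
  · simp only [Function.comp_apply, hφ.eq_iff, evenMap_eq_oddMap_iff, transportMap_inl_eq_inl_iff]
    simp

end PLGraph

end GraphSOS

/-! ### Connected components and unique factorization -/

namespace GraphSOS

namespace RawGraph

variable {L M N : Type}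

theorem connected_iff (G : RawGraph L) : G.Connected ↔
    G.1.support.Nonempty ∧ ∀ x ∈ G.1.support, ∀ y ∈ G.1.support, G.1.Reachable x y := by
  rw [Connected, SimpleGraph.connected_iff]
  constructor
  · rintro ⟨h, ⟨x⟩⟩
    refine ⟨⟨x.1, x.2⟩, fun x hx y hy => ?_⟩
    exact (h ⟨x, hx⟩ ⟨y, hy⟩).map (SimpleGraph.Embedding.induce G.1.support).toHom
  · rintro ⟨⟨x, hx⟩, h⟩
    refine ⟨?_, ⟨⟨x, hx⟩⟩⟩
    -- A walk that starts in the support never leaves it, so reachability in the pool is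
    -- reachability in the induced graph.
    have key : ∀ {a b : L ⊕ ℕ} (_ : G.1.Walk a b) (ha : a ∈ G.1.support),
        ∃ hb : b ∈ G.1.support, (G.1.induce G.1.support).Reachable ⟨a, ha⟩ ⟨b, hb⟩ := by
      intro a b w
      induction w with
      | nil => intro ha; exact ⟨ha, SimpleGraph.Reachable.refl _⟩
      | cons e w ih =>
        intro ha
        obtain ⟨hb, h⟩ := ih e.mem_support_right
        refine ⟨hb, SimpleGraph.Reachable.trans (SimpleGraph.Adj.reachable ?_) h⟩
        exact e
    rintro ⟨a, ha⟩ ⟨b, hb⟩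
    obtain ⟨w⟩ := h a ha b hb
    exact (key w ha).2

theorem reachable_map {f : L ⊕ ℕ → M ⊕ ℕ} (hf : Function.Injective f) {G : RawGraph L}
    {x y : L ⊕ ℕ} : (G.map f).1.Reachable (f x) (f y) ↔ G.1.Reachable x y := by
  constructor
  · rintro ⟨w⟩
    have key : ∀ {a b : M ⊕ ℕ} (_ : (G.map f).1.Walk a b) (x : L ⊕ ℕ), f x = a →
        ∃ y, f y = b ∧ G.1.Reachable x y := by
      intro a b w
      induction w with
      | nil => rintro x rfl; exact ⟨x, rfl, SimpleGraph.Reachable.refl _⟩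
      | cons e w ih =>
        rintro x rfl
        obtain ⟨x', z, e', hx, rfl⟩ := (adj_map hf _ _ _).1 e
        rw [hf hx] at e'
        obtain ⟨y, rfl, h⟩ := ih z rfl
        exact ⟨y, rfl, e'.reachable.trans h⟩
    obtain ⟨y', h, hr⟩ := key w x rfl
    rwa [hf h] at hr
  · rintro ⟨w⟩
    induction w with
    | nil => exact SimpleGraph.Reachable.refl _
    | cons e w ih => exact ((adj_map_apply hf _ _ _).2 e).reachable.trans ih

theorem connected_map {f : L ⊕ ℕ → M ⊕ ℕ} (hf : Function.Injective f) {G : RawGraph L} :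
    (G.map f).Connected ↔ G.Connected := by
  rw [connected_iff, connected_iff, support_map hf, Set.image_nonempty]
  simp only [Set.forall_mem_image, reachable_map hf]

/-- `D` is a connected component of `G` that has an edge. -/
def IsBlock (G D : RawGraph L) : Prop :=
  D.1 ≤ G.1 ∧ D.Connected ∧ ∀ x ∈ D.1.support, ∀ y, G.1.Adj x y → D.1.Adj x y

/-- A walk in `D` that starts at a vertex of `D'` cannot leave `D'`, because `D'` contains all edges
of `G` at its own vertices. -/
theorem le_of_closed {G D D' : RawGraph L} (hD : D.1 ≤ G.1) (hc : D.Connected)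
    (hD' : ∀ x ∈ D'.1.support, ∀ y, G.1.Adj x y → D'.1.Adj x y) {x : L ⊕ ℕ}
    (hx : x ∈ D.1.support) (hx' : x ∈ D'.1.support) : D.1 ≤ D'.1 := by
  have key : ∀ {a b : L ⊕ ℕ} (_ : D.1.Walk a b), a ∈ D'.1.support → b ∈ D'.1.support := by
    intro a b w
    induction w with
    | nil => exact id
    | cons e w ih => intro ha; exact ih (hD' _ ha _ (hD e)).mem_support_right
  intro a b h
  obtain ⟨w⟩ := ((connected_iff D).1 hc).2 x hx a h.mem_support_left
  exact hD' a (key w hx') b (hD h)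

theorem IsBlock.eq_of_mem {G D D' : RawGraph L} (h : IsBlock G D) (h' : IsBlock G D')
    {x : L ⊕ ℕ} (hx : x ∈ D.1.support) (hx' : x ∈ D'.1.support) : D = D' :=
  Subtype.ext (le_antisymm (le_of_closed h.1 h.2.1 h'.2.2 hx hx')
    (le_of_closed h'.1 h'.2.1 h.2.2 hx' hx))

theorem IsBlock.nonempty {G D : RawGraph L} (h : IsBlock G D) : D.1.support.Nonempty :=
  ((connected_iff D).1 h.2.1).1

theorem exists_map_eq_of_le {f : L ⊕ ℕ → M ⊕ ℕ} (hf : Function.Injective f) {G : RawGraph L}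
    {D' : RawGraph M} (h : D'.1 ≤ (G.map f).1) : ∃ D : RawGraph L, D.1 ≤ G.1 ∧ D.map f = D' := by
  have hle : D'.1.comap f ≤ G.1 := fun x y e => (adj_map_apply hf _ _ _).1 (h e)
  refine ⟨⟨D'.1.comap f, G.2.subset (SimpleGraph.edgeSet_mono hle)⟩, hle, Subtype.ext ?_⟩
  ext a b
  rw [adj_map hf]
  constructor
  · rintro ⟨x, y, e, rfl, rfl⟩; exact e
  · intro e
    obtain ⟨x, y, -, rfl, rfl⟩ := (adj_map hf _ _ _).1 (h e)
    exact ⟨x, y, e, rfl, rfl⟩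

theorem isBlock_map {f : L ⊕ ℕ → M ⊕ ℕ} (hf : Function.Injective f) {G D : RawGraph L} :
    IsBlock (G.map f) (D.map f) ↔ IsBlock G D := by
  unfold IsBlock
  rw [connected_map hf, support_map hf]
  refine and_congr ?_ (and_congr_right fun _ => ?_)
  · constructor
    · intro h x y e
      exact (adj_map_apply hf _ _ _).1 (h ((adj_map_apply hf _ _ _).2 e))
    · intro h; exact SimpleGraph.map_monotone f h
  · constructor
    · intro h x hx y e
      exact (adj_map_apply hf _ _ _).1 (h (f x) ⟨x, hx, rfl⟩ (f y) ((adj_map_apply hf _ _ _).2 e))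
    · rintro h _ ⟨x, hx, rfl⟩ b e
      obtain ⟨x', y, e', hx', rfl⟩ := (adj_map hf _ _ _).1 e
      rw [hf hx'] at e'
      exact (adj_map_apply hf _ _ _).2 (h x hx y e')

/-- The components of `G` with an edge that satisfy `P`. -/
def blocks (G : RawGraph L) (P : RawGraph L → Prop) : Set (RawGraph L) :=
  {D | IsBlock G D ∧ P D}

theorem finite_le (G : RawGraph L) : {D : RawGraph L | D.1 ≤ G.1}.Finite := by
  refine Set.Finite.of_finite_image (f := fun D : RawGraph L => D.1.edgeSet)
    (G.2.finite_subsets.subset ?_) ?_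
  · rintro _ ⟨D, hD, rfl⟩; exact SimpleGraph.edgeSet_mono hD
  · intro D _ D' _ h; exact Subtype.ext (SimpleGraph.edgeSet_injective h)

theorem finite_blocks (G : RawGraph L) (P : RawGraph L → Prop) : (G.blocks P).Finite :=
  G.finite_le.subset fun _ h => h.1.1

theorem blocks_map {f : L ⊕ ℕ → M ⊕ ℕ} (hf : Function.Injective f) (G : RawGraph L)
    (P : RawGraph M → Prop) : (G.map f).blocks P = map f '' G.blocks fun D => P (D.map f) := by
  ext D'
  constructor
  · rintro ⟨h, hP⟩
    obtain ⟨D, -, rfl⟩ := exists_map_eq_of_le hf h.1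
    exact ⟨D, ⟨(isBlock_map hf).1 h, hP⟩, rfl⟩
  · rintro ⟨D, ⟨h, hP⟩, rfl⟩
    exact ⟨(isBlock_map hf).2 h, hP⟩

theorem adj_component (G : RawGraph L) (c : G.1.ConnectedComponent) (u v : L ⊕ ℕ) :
    (G.component c).1.Adj u v ↔ u ∈ c.supp ∧ G.1.Adj u v :=
  c.adj_spanningCoe_toSimpleGraph

theorem support_component_subset (G : RawGraph L) (c : G.1.ConnectedComponent) :
    (G.component c).1.support ⊆ c.supp := by
  rintro x ⟨y, h⟩
  exact ((adj_component G c x y).1 h).1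

theorem isBlock_component (G : RawGraph L) (c : G.1.ConnectedComponent) {x : L ⊕ ℕ}
    (hx : x ∈ G.1.support) (hc : x ∈ c.supp) : IsBlock G (G.component c) ∧
    x ∈ (G.component c).1.support := by
  have hxs : x ∈ (G.component c).1.support := by
    obtain ⟨y, h⟩ := hx
    exact ⟨y, (adj_component G c x y).2 ⟨hc, h⟩⟩
  refine ⟨⟨fun a b h => ((adj_component G c a b).1 h).2, ?_, fun a ha b h =>
    (adj_component G c a b).2 ⟨support_component_subset G c ha, h⟩⟩, hxs⟩
  rw [connected_iff]
  refine ⟨⟨x, hxs⟩, fun a ha b hb => ?_⟩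
  have key : ∀ {a b : L ⊕ ℕ} (_ : G.1.Walk a b), a ∈ c.supp →
      (G.component c).1.Reachable a b := by
    intro a b w
    induction w with
    | nil => intro _; exact SimpleGraph.Reachable.refl _
    | @cons u v _ e w ih =>
      intro ha
      have h1 : (G.component c).1.Adj u v := (adj_component G c u v).2 ⟨ha, e⟩
      exact h1.reachable.trans (ih (support_component_subset G c h1.mem_support_right))
  have ha' := support_component_subset G c ha
  have hb' := support_component_subset G c hb
  have : G.1.Reachable a b := by
    rw [SimpleGraph.ConnectedComponent.mem_supp_iff] at ha' hb'
    exact SimpleGraph.ConnectedComponent.exact (ha'.trans hb'.symm)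
  obtain ⟨w⟩ := this
  exact key w ha'

theorem exists_isBlock_mem (G : RawGraph L) {x : L ⊕ ℕ} (hx : x ∈ G.1.support) :
    ∃ D, IsBlock G D ∧ x ∈ D.1.support :=
  ⟨_, isBlock_component G (G.1.connectedComponentMk x) hx rfl⟩

/-- Removing the edges of `D`. -/
def remove (G D : RawGraph L) : RawGraph L :=
  ⟨G.1 \ D.1, G.2.subset (SimpleGraph.edgeSet_mono sdiff_le)⟩

theorem union_remove {G D : RawGraph L} (h : D.1 ≤ G.1) : D.union (G.remove D) = G :=
  Subtype.ext (sup_sdiff_cancel_right h)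

theorem adj_remove {G D : RawGraph L} (a b : L ⊕ ℕ) :
    (G.remove D).1.Adj a b ↔ G.1.Adj a b ∧ ¬ D.1.Adj a b := by
  simp [remove, SimpleGraph.sdiff_adj]

theorem IsBlock.disjoint_remove {G D : RawGraph L} (h : IsBlock G D) {x : L ⊕ ℕ}
    (hx : x ∈ D.1.support) : x ∉ (G.remove D).1.support := by
  rintro ⟨y, hy⟩
  have hy' := (adj_remove x y).1 hy
  exact hy'.2 (h.2.2 x hx y hy'.1)

theorem IsBlock.mk_eq {G D : RawGraph L} (h : IsBlock G D) :
    PLGraph.mk G = PLGraph.mk D * PLGraph.mk (G.remove D) := by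
  rw [← mk_union fun n hn => h.disjoint_remove hn, union_remove h.1]

/-- A component of a gluing product without labeled vertices is a component of one factor. -/
theorem IsBlock.of_glue {F G D : RawGraph L} (h : IsBlock (F.glue G) D)
    (hl : ∀ l, Sum.inl l ∉ D.1.support) :
    (∃ D', IsBlock F D' ∧ (∀ l, Sum.inl l ∉ D'.1.support) ∧ D'.map (evenMap L) = D) ∨
    (∃ D', IsBlock G D' ∧ (∀ l, Sum.inl l ∉ D'.1.support) ∧ D'.map (oddMap L) = D) := by
  have hadj : ∀ a b, (F.glue G).1.Adj a b ↔
      (F.map (evenMap L)).1.Adj a b ∨ (G.map (oddMap L)).1.Adj a b := adj_union _ _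
  obtain ⟨x, hx⟩ := h.nonempty
  have hlab : ∀ (D' : RawGraph L) (f : L ⊕ ℕ → L ⊕ ℕ), Function.Injective f →
      (∀ l, f (Sum.inl l) = Sum.inl l) → D'.map f = D → ∀ l, Sum.inl l ∉ D'.1.support := by
    rintro D' f hf hfl rfl l hm
    refine hl l ?_
    rw [support_map hf]
    exact ⟨_, hm, hfl l⟩
  -- The two drawings meet in labels only, and `D` has none. Hence a walk in `D` cannot pass from
  -- one factor to the other.
  have hpar : ∀ a, a ∈ (F.map (evenMap L)).1.support → a ∈ (G.map (oddMap L)).1.support →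
      a ∉ D.1.support := by
    intro a ha hb hD
    rw [support_map evenMap_injective] at ha
    rw [support_map oddMap_injective] at hb
    obtain ⟨u, -, rfl⟩ := ha
    obtain ⟨v, -, hv⟩ := hb
    obtain ⟨l, rfl, rfl⟩ := (evenMap_eq_oddMap_iff u v).1 hv.symm
    exact hl l hD
  obtain ⟨y, hy⟩ := id hx
  rcases (hadj _ _).1 (h.1 hy) with e | e
  · have hle : D.1 ≤ (F.map (evenMap L)).1 := by
      have h2 : ∀ {a b : L ⊕ ℕ} (_ : D.1.Walk a b), a ∈ (F.map (evenMap L)).1.support →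
          b ∈ (F.map (evenMap L)).1.support := by
        intro a b w
        induction w with
        | nil => exact id
        | cons e w ih =>
          intro ha
          rcases (hadj _ _).1 (h.1 e) with e' | e'
          · exact ih e'.mem_support_right
          · exact (hpar _ ha e'.mem_support_left e.mem_support_left).elim
      intro a b e'
      obtain ⟨w⟩ := ((connected_iff D).1 h.2.1).2 x hx a e'.mem_support_left
      rcases (hadj _ _).1 (h.1 e') with e'' | e''
      · exact e''
      · exact (hpar _ (h2 w e.mem_support_left) e''.mem_support_left e'.mem_support_left).elim
    left
    obtain ⟨D', -, rfl⟩ := exists_map_eq_of_le evenMap_injective hle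
    refine ⟨D', (isBlock_map evenMap_injective).1 ⟨hle, h.2.1, fun a ha b hb => ?_⟩,
      hlab D' _ evenMap_injective (fun _ => rfl) rfl, rfl⟩
    exact h.2.2 a ha b ((hadj _ _).2 (Or.inl hb))
  · have hle : D.1 ≤ (G.map (oddMap L)).1 := by
      have h2 : ∀ {a b : L ⊕ ℕ} (_ : D.1.Walk a b), a ∈ (G.map (oddMap L)).1.support →
          b ∈ (G.map (oddMap L)).1.support := by
        intro a b w
        induction w with
        | nil => exact id
        | cons e w ih =>
          intro ha
          rcases (hadj _ _).1 (h.1 e) with e' | e'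
          · exact (hpar _ e'.mem_support_left ha e.mem_support_left).elim
          · exact ih e'.mem_support_right
      intro a b e'
      obtain ⟨w⟩ := ((connected_iff D).1 h.2.1).2 x hx a e'.mem_support_left
      rcases (hadj _ _).1 (h.1 e') with e'' | e''
      · exact (hpar _ e''.mem_support_left (h2 w e.mem_support_left) e'.mem_support_left).elim
      · exact e''
    right
    obtain ⟨D', -, rfl⟩ := exists_map_eq_of_le oddMap_injective hle
    refine ⟨D', (isBlock_map oddMap_injective).1 ⟨hle, h.2.1, fun a ha b hb => ?_⟩,
      hlab D' _ oddMap_injective (fun _ => rfl) rfl, rfl⟩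
    exact h.2.2 a ha b ((hadj _ _).2 (Or.inr hb))

/-- A component survives gluing when the other factor adds no edge at its vertices. Such an edge
could only sit at a label, which is what `hD` controls. -/
theorem isBlock_glue_even {F G D : RawGraph L} (h : IsBlock F D)
    (hD : ∀ l, Sum.inl l ∈ D.1.support → ∀ y, G.1.Adj (Sum.inl l) y →
      (∃ m, y = Sum.inl m) ∧ D.1.Adj (Sum.inl l) y) :
    IsBlock (F.glue G) (D.map (evenMap L)) := by
  have hb := (isBlock_map evenMap_injective).2 h
  refine ⟨fun a b e => (adj_union _ _ a b).2 (Or.inl (hb.1 e)), hb.2.1, fun a ha b e => ?_⟩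
  rcases (adj_union _ _ a b).1 e with e | e
  · exact hb.2.2 a ha b e
  · change (G.map (oddMap L)).1.Adj a b at e
    obtain ⟨x, y, e', rfl, rfl⟩ := (adj_map oddMap_injective _ _ _).1 e
    rw [support_map evenMap_injective] at ha
    obtain ⟨z, hz, hzx⟩ := ha
    obtain ⟨l, rfl, rfl⟩ := (evenMap_eq_oddMap_iff _ _).1 hzx
    obtain ⟨⟨m, rfl⟩, hm⟩ := hD l hz y e'
    exact (adj_map_apply evenMap_injective D (Sum.inl l) (Sum.inl m)).2 hm

theorem isBlock_glue_odd {F G D : RawGraph L} (h : IsBlock G D)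
    (hD : ∀ l, Sum.inl l ∉ D.1.support) :
    IsBlock (F.glue G) (D.map (oddMap L)) := by
  have hb := (isBlock_map oddMap_injective).2 h
  refine ⟨fun a b e => (adj_union _ _ a b).2 (Or.inr (hb.1 e)), hb.2.1, fun a ha b e => ?_⟩
  rcases (adj_union _ _ a b).1 e with e | e
  · change (F.map (evenMap L)).1.Adj a b at e
    obtain ⟨x, y, e', rfl, rfl⟩ := (adj_map evenMap_injective _ _ _).1 e
    rw [support_map oddMap_injective] at ha
    obtain ⟨z, hz, hzx⟩ := ha
    obtain ⟨l, rfl, rfl⟩ := (evenMap_eq_oddMap_iff _ _).1 hzx.symm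
    exact (hD l hz).elim
  · exact hb.2.2 a ha b e

theorem map_even_ne_map_odd {D D' : RawGraph L} (hD : D.1.support.Nonempty)
    (hl : ∀ l, Sum.inl l ∉ D'.1.support) : D.map (evenMap L) ≠ D'.map (oddMap L) := by
  intro h
  have h2 : (D.map (evenMap L)).1.support = (D'.map (oddMap L)).1.support := by rw [h]
  rw [support_map evenMap_injective, support_map oddMap_injective] at h2
  obtain ⟨x, hx⟩ := hD
  have : evenMap L x ∈ oddMap L '' D'.1.support := h2 ▸ ⟨x, hx, rfl⟩
  obtain ⟨y, hy, hxy⟩ := this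
  obtain ⟨l, rfl, rfl⟩ := (evenMap_eq_oddMap_iff _ _).1 hxy.symm
  exact hl l hy

end RawGraph

namespace PLGraph

open RawGraph

theorem connected_mk {L : Type} (G : RawGraph L) : (mk G).Connected ↔ G.Connected := by
  constructor
  · rintro ⟨H, h, hH⟩
    obtain ⟨σ, rfl⟩ := RawGraph.mk_eq_iff.1 h
    exact (connected_map (Function.injective_id.sumMap σ.injective)).2 hH
  · intro h; exact ⟨G, rfl, h⟩

end PLGraph

namespace UGraph

open RawGraph

/-- Pool elements outside the graph form singleton components of the `SimpleGraph`. Their edge set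
is empty, so none of them is isomorphic to the connected graph `C`, and only blocks are counted. -/
theorem multiplicity_mk (C : ConnGraph) (G : RawGraph Empty) :
    multiplicity C (PLGraph.mk G) = (G.blocks fun D => PLGraph.mk D = C.1).ncard := by
  rw [← Nat.card_coe_set_eq]
  change Nat.card {c : G.1.ConnectedComponent // PLGraph.mk (G.component c) = C.1} = _
  have hne : ∀ c : G.1.ConnectedComponent, PLGraph.mk (G.component c) = C.1 →
      (G.component c).1.support.Nonempty := fun c hc =>
    ((connected_iff _).1 ((PLGraph.connected_mk _).1 (hc ▸ C.2))).1
  have hb : ∀ c : G.1.ConnectedComponent, PLGraph.mk (G.component c) = C.1 →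
      IsBlock G (G.component c) := by
    intro c hc
    obtain ⟨x, y, h⟩ := hne c hc
    have h' := (adj_component G c x y).1 h
    exact (isBlock_component G c h'.2.mem_support_left h'.1).1
  refine Nat.card_congr (Equiv.ofBijective
    (fun c => (⟨G.component c.1, hb c.1 c.2, c.2⟩ : G.blocks fun D => PLGraph.mk D = C.1))
    ⟨?_, ?_⟩)
  · rintro ⟨c, hc⟩ ⟨c', hc'⟩ h
    have h2 : G.component c = G.component c' := congrArg Subtype.val h
    obtain ⟨x, hx⟩ := hne c hc
    have h3 := support_component_subset G c hx
    rw [h2] at hx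
    have h4 := support_component_subset G c' hx
    rw [SimpleGraph.ConnectedComponent.mem_supp_iff] at h3 h4
    exact Subtype.ext (h3.symm.trans h4)
  · rintro ⟨D, hD, hC⟩
    obtain ⟨x, hx⟩ := hD.nonempty
    have hx' : x ∈ G.1.support := SimpleGraph.support_mono hD.1 hx
    obtain ⟨h1, h2⟩ := isBlock_component G (G.1.connectedComponentMk x) hx' rfl
    have h3 := h1.eq_of_mem hD h2 hx
    refine ⟨⟨G.1.connectedComponentMk x, by rw [h3]; exact hC⟩, Subtype.ext h3⟩

theorem multiplicity_unlabel_mk (C : ConnGraph) (G : RawGraph ℕ) :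
    multiplicity C (PLGraph.mk G).unlabel =
      (G.blocks fun D => (PLGraph.mk D).unlabel = C.1).ncard := by
  have ht := transportMap_injective (M := Empty) (Sum.inr_injective (α := Empty) (β := ℕ))
  rw [PLGraph.unlabel_mk, multiplicity_mk, blocks_map ht,
    Set.ncard_image_of_injective _ (map_injective ht)]
  simp only [PLGraph.unlabel_mk]

theorem multiplicity_mul (C : ConnGraph) (A B : UGraph) :
    multiplicity C (A * B) = multiplicity C A + multiplicity C B := by
  obtain ⟨F, rfl⟩ := A.exists_rep
  obtain ⟨G, rfl⟩ := B.exists_rep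
  rw [PLGraph.mk_mul_mk, multiplicity_mk, multiplicity_mk, multiplicity_mk]
  have he : ∀ D : RawGraph Empty, PLGraph.mk (D.map (evenMap Empty)) = PLGraph.mk D := by
    intro D
    conv_rhs => rw [← RawGraph.map_id D]
    exact Quotient.sound (map_equiv evenMap_injective Function.injective_id fun _ _ m => m.elim)
  have ho : ∀ D : RawGraph Empty, PLGraph.mk (D.map (oddMap Empty)) = PLGraph.mk D := by
    intro D
    conv_rhs => rw [← RawGraph.map_id D]
    exact Quotient.sound (map_equiv oddMap_injective Function.injective_id fun _ _ m => m.elim)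
  have : (F.glue G).blocks (fun D => PLGraph.mk D = C.1) =
      RawGraph.map (evenMap Empty) '' F.blocks (fun D => PLGraph.mk D = C.1) ∪
      RawGraph.map (oddMap Empty) '' G.blocks (fun D => PLGraph.mk D = C.1) := by
    ext D
    constructor
    · rintro ⟨h, hC⟩
      rcases h.of_glue fun l => l.elim with ⟨D', h', -, rfl⟩ | ⟨D', h', -, rfl⟩
      · exact Or.inl ⟨D', ⟨h', (he D').symm.trans hC⟩, rfl⟩
      · exact Or.inr ⟨D', ⟨h', (ho D').symm.trans hC⟩, rfl⟩
    · rintro (⟨D', ⟨h', hC⟩, rfl⟩ | ⟨D', ⟨h', hC⟩, rfl⟩)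
      · exact ⟨isBlock_glue_even h' fun l => l.elim, (he D').trans hC⟩
      · exact ⟨isBlock_glue_odd h' fun l => l.elim, (ho D').trans hC⟩
  rw [this, Set.ncard_union_eq ?_ ((finite_blocks _ _).image _) ((finite_blocks _ _).image _),
    Set.ncard_image_of_injective _ (map_injective evenMap_injective),
    Set.ncard_image_of_injective _ (map_injective oddMap_injective)]
  rw [Set.disjoint_left]
  rintro _ ⟨D, hD, rfl⟩ ⟨D', hD', h⟩
  exact map_even_ne_map_odd hD.1.nonempty (fun l => l.elim) h.symm

theorem finite_multiplicity (H : UGraph) : {C : ConnGraph | multiplicity C H ≠ 0}.Finite := by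
  obtain ⟨G, rfl⟩ := H.exists_rep
  refine Set.Finite.of_finite_image (f := Subtype.val)
    ((G.finite_le.image PLGraph.mk).subset ?_) Subtype.val_injective.injOn
  rintro _ ⟨C, hC, rfl⟩
  have hC' : multiplicity C (PLGraph.mk G) ≠ 0 := hC
  rw [multiplicity_mk] at hC'
  obtain ⟨D, hD, h⟩ := Set.nonempty_of_ncard_ne_zero hC'
  exact ⟨D, hD.1, h⟩

theorem multiplicity_one (C : ConnGraph) : multiplicity C 1 = 0 := by
  have := multiplicity_mul C 1 1
  rw [mul_one] at this
  omega

theorem multiplicity_coe [DecidableEq ConnGraph] (C C' : ConnGraph) :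
    multiplicity C C'.1 = if C' = C then 1 else 0 := by
  obtain ⟨C', hC'⟩ := C'
  obtain ⟨G, rfl⟩ := PLGraph.exists_rep C'
  have hG := (PLGraph.connected_mk G).1 hC'
  rw [multiplicity_mk]
  have hself : IsBlock G G := ⟨le_rfl, hG, fun _ _ _ h => h⟩
  have huniq : ∀ D, IsBlock G D → D = G := by
    intro D hD
    obtain ⟨x, hx⟩ := hD.nonempty
    exact hD.eq_of_mem hself hx (SimpleGraph.support_mono hD.1 hx)
  split_ifs with h
  · subst h
    rw [Set.ncard_eq_one]
    refine ⟨G, Set.ext fun D => ⟨fun hD => huniq D hD.1, ?_⟩⟩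
    rintro rfl
    exact ⟨hself, rfl⟩
  · rw [Set.ncard_eq_zero (finite_blocks _ _), Set.eq_empty_iff_forall_notMem]
    rintro D ⟨hD, hC⟩
    rw [huniq D hD] at hC
    exact h (Subtype.ext hC)

theorem exists_eq_mul {H : UGraph} (hH : H ≠ 1) :
    ∃ (C : ConnGraph) (H' : UGraph), H = C.1 * H' ∧ H'.edgeCount < H.edgeCount := by
  obtain ⟨G, rfl⟩ := H.exists_rep
  have hne : G.1 ≠ ⊥ := fun h => hH (congrArg PLGraph.mk (Subtype.ext h))
  obtain ⟨x, y, hxy⟩ := SimpleGraph.ne_bot_iff_exists_adj.1 hne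
  obtain ⟨D, hD, hx⟩ := G.exists_isBlock_mem hxy.mem_support_left
  refine ⟨⟨PLGraph.mk D, (PLGraph.connected_mk D).2 hD.2.1⟩, PLGraph.mk (G.remove D), hD.mk_eq, ?_⟩
  rw [hD.mk_eq, PLGraph.edgeCount_mul]
  have : (PLGraph.mk D).edgeCount ≠ 0 := by
    intro h
    obtain ⟨a, b⟩ := hx
    rw [PLGraph.edgeCount_mk, RawGraph.edgeCount, Set.ncard_eq_zero D.2] at h
    have : s(x, a) ∈ D.1.edgeSet := b
    rw [h] at this
    exact this
  omega

/-- Unlabeled graphs are products of connected ones. -/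
theorem induction_conn {P : UGraph → Prop} (one : P 1)
    (mul : ∀ (C : ConnGraph) (H : UGraph), P H → P (C.1 * H)) (H : UGraph) : P H := by
  induction hn : H.edgeCount using Nat.strong_induction_on generalizing H with
  | _ n ih =>
    by_cases hH : H = 1
    · rw [hH]; exact one
    · obtain ⟨C, H', h, hlt⟩ := exists_eq_mul hH
      rw [h]
      exact mul C H' (ih _ (hn ▸ hlt) H' rfl)

/-- The multiplicities of the connected graphs in the factorization of a graph. -/
noncomputable def factorization (H : UGraph) : ConnGraph →₀ ℕ :=
  Finsupp.ofSupportFinite (fun C => multiplicity C H) (finite_multiplicity H)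

theorem factorization_apply (H : UGraph) (C : ConnGraph) :
    H.factorization C = multiplicity C H := rfl

theorem factorization_mul (A B : UGraph) :
    (A * B).factorization = A.factorization + B.factorization :=
  Finsupp.ext fun C => multiplicity_mul C A B

theorem factorization_one : (1 : UGraph).factorization = 0 :=
  Finsupp.ext fun C => multiplicity_one C

theorem factorization_coe (C : ConnGraph) : C.1.factorization = Finsupp.single C 1 := by
  classical
  ext C'
  rw [factorization_apply, multiplicity_coe, Finsupp.single_apply]

/-- Unique factorization into connected graphs, for any multiplicative function. -/
theorem prod_factorization {R : Type*} [CommMonoid R] (χ : UGraph →* R) (H : UGraph) :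
    (H.factorization.prod fun C n => χ C.1 ^ n) = χ H := by
  induction H using induction_conn with
  | one => rw [factorization_one, Finsupp.prod_zero_index, map_one]
  | mul C H ih =>
    classical
    rw [factorization_mul, Finsupp.prod_add_index' (by simp) (by intros; rw [pow_add]), ih,
      factorization_coe, Finsupp.prod_single_index (by simp), pow_one, map_mul]

/-- The identity is a multiplicative function, so a graph is the product of its components with
their multiplicities. -/
theorem factorization_injective : Function.Injective factorization := by
  intro A B h
  have hA := prod_factorization (MonoidHom.id UGraph) A
  rw [h, prod_factorization] at hA
  exact hA.symm

/-- This turns characters into points: the values at connected graphs are the coordinates. -/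
theorem eval_eq (χ : UGraph →* ℝ) (H : UGraph) : eval (fun C => χ C.1) H = χ H := by
  rw [← prod_factorization χ H, eval, Finsupp.prod]
  refine finprod_eq_prod_of_mulSupport_subset _ ?_
  intro C hC
  rw [Finset.mem_coe, Finsupp.mem_support_iff, factorization_apply]
  intro h
  simp [h] at hC

/-- Two different graphs with equally many edges: some connected graph occurs more often in the
first one. -/
theorem exists_multiplicity_lt {A B : UGraph} (hne : A ≠ B) (he : A.edgeCount = B.edgeCount) :
    ∃ C, multiplicity C B < multiplicity C A := by
  by_contra! h
  have hle : A.factorization ≤ B.factorization := h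
  -- Otherwise `A` divides `B`. The quotient has no edges, hence is the unit.
  obtain ⟨f, hf⟩ := exists_add_of_le hle
  have hB : B = A * f.prod fun C n => C.1 ^ n := by
    have h1 := prod_factorization (MonoidHom.id UGraph) B
    rw [hf, Finsupp.prod_add_index' (by simp) (by intros; rw [pow_add]), prod_factorization] at h1
    exact h1.symm
  rw [hB, PLGraph.edgeCount_mul] at he
  have : (f.prod fun C n => C.1 ^ n) = (1 : UGraph) :=
    PLGraph.eq_one_of_edgeCount_eq_zero (by omega)
  rw [this, mul_one] at hB
  exact hne hB.symm

end UGraph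

end GraphSOS

namespace GraphSOS

/-! ### Degree weights -/

theorem finsum_eq_add_finsum {X A B : Type*} {i : A → X} {j : B → X} (hi : Function.Injective i)
    (hj : Function.Injective j) (hij : ∀ a b, i a ≠ j b) (h : ∀ x, (∃ a, i a = x) ∨ ∃ b, j b = x)
    {f : X → ℝ} (hf : (Function.support f).Finite) :
    ∑ᶠ x, f x = (∑ᶠ a, f (i a)) + ∑ᶠ b, f (j b) := by
  have hu : (Set.univ : Set X) = Set.range i ∪ Set.range j :=
    (Set.eq_univ_of_forall fun x => h x).symm
  have hd : Disjoint (Set.range i) (Set.range j) := by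
    rw [Set.disjoint_left]
    rintro _ ⟨a, rfl⟩ ⟨b, hb⟩
    exact hij a b hb.symm
  rw [← finsum_mem_univ, hu, finsum_mem_union' hd (hf.subset Set.inter_subset_right)
    (hf.subset Set.inter_subset_right), finsum_mem_range hi, finsum_mem_range hj]

namespace RawGraph

variable {L M : Type}

/-- The degree of a vertex. -/
noncomputable def deg (G : RawGraph L) (x : L ⊕ ℕ) : ℕ := (G.1.neighborSet x).ncard

theorem deg_eq_zero {G : RawGraph L} {x : L ⊕ ℕ} (h : x ∉ G.1.support) : G.deg x = 0 := by
  have : G.1.neighborSet x = ∅ := by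
    rw [Set.eq_empty_iff_forall_notMem]
    intro y hy
    exact h ⟨y, hy⟩
  rw [deg, this, Set.ncard_empty]

theorem deg_map {f : L ⊕ ℕ → M ⊕ ℕ} (hf : Function.Injective f) (G : RawGraph L) (x : L ⊕ ℕ) :
    (G.map f).deg (f x) = G.deg x := by
  have : (G.map f).1.neighborSet (f x) = f '' G.1.neighborSet x :=
    SimpleGraph.neighborSet_map G.1 (⟨f, hf⟩ : L ⊕ ℕ ↪ M ⊕ ℕ) x
  rw [deg, this, Set.ncard_image_of_injective _ hf, deg]

/-- The sum over the vertices of a function of the degree. -/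
noncomputable def degWeight (φ : ℕ → ℝ) (G : RawGraph L) : ℝ := ∑ᶠ x, φ (G.deg x)

theorem finite_support_deg {φ : ℕ → ℝ} (hφ : φ 0 = 0) (G : RawGraph L) :
    (Function.support fun x => φ (G.deg x)).Finite := by
  refine G.finite_support.subset fun x hx => ?_
  by_contra h
  exact hx (by simp [deg_eq_zero h, hφ])

/-- Pool elements outside the image have degree 0 and contribute nothing because φ 0 = 0. -/
theorem degWeight_map {φ : ℕ → ℝ} (hφ : φ 0 = 0) {f : L ⊕ ℕ → M ⊕ ℕ}
    (hf : Function.Injective f) (G : RawGraph L) : (G.map f).degWeight φ = G.degWeight φ := by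
  have h1 : (∑ᶠ y ∈ Set.range f, φ ((G.map f).deg y)) = G.degWeight φ := by
    rw [finsum_mem_range hf]
    simp only [deg_map hf, degWeight]
  rw [← h1, degWeight]
  refine finsum_congr fun y => ?_
  by_cases hy : y ∈ Set.range f
  · simp [hy]
  · have : y ∉ (G.map f).1.support := by
      rw [support_map hf]
      rintro ⟨x, -, rfl⟩
      exact hy ⟨x, rfl⟩
    simp only [hy, deg_eq_zero this, hφ, finsum_false]

/-- The labeled neighbors of a labeled vertex. -/
def labeledNbrs (G : RawGraph L) (l : L) : Set L := {m | G.1.Adj (Sum.inl l) (Sum.inl m)}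

/-- The unlabeled neighbors of a labeled vertex. -/
def freeNbrs (G : RawGraph L) (l : L) : Set ℕ := {n | G.1.Adj (Sum.inl l) (Sum.inr n)}

theorem finite_labeledNbrs (G : RawGraph L) (l : L) : (G.labeledNbrs l).Finite :=
  (G.finite_support.preimage Sum.inl_injective.injOn).subset
    fun m (h : G.1.Adj _ _) => (h.mem_support_right : Sum.inl m ∈ G.1.support)

theorem finite_freeNbrs (G : RawGraph L) (l : L) : (G.freeNbrs l).Finite :=
  (G.finite_support.preimage Sum.inr_injective.injOn).subset
    fun m (h : G.1.Adj _ _) => (h.mem_support_right : Sum.inr m ∈ G.1.support)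

theorem deg_inl (G : RawGraph L) (l : L) :
    G.deg (Sum.inl l) = (G.labeledNbrs l).ncard + (G.freeNbrs l).ncard := by
  have : G.1.neighborSet (Sum.inl l) = Sum.inl '' G.labeledNbrs l ∪ Sum.inr '' G.freeNbrs l := by
    ext y
    rcases y with m | n <;> simp [labeledNbrs, freeNbrs]
  rw [deg, this, Set.ncard_union_eq ?_ ((G.finite_labeledNbrs l).image _)
    ((G.finite_freeNbrs l).image _), Set.ncard_image_of_injective _ Sum.inl_injective,
    Set.ncard_image_of_injective _ Sum.inr_injective]
  rw [Set.disjoint_left]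
  rintro _ ⟨a, -, rfl⟩ ⟨b, -, h⟩
  cases h

theorem glue_adj (F G : RawGraph L) (a b : L ⊕ ℕ) : (F.glue G).1.Adj a b ↔
    (F.map (evenMap L)).1.Adj a b ∨ (G.map (oddMap L)).1.Adj a b := adj_union _ _ _ _

theorem labeledNbrs_glue (F G : RawGraph L) (l : L) :
    (F.glue G).labeledNbrs l = F.labeledNbrs l ∪ G.labeledNbrs l := by
  ext m
  simp only [labeledNbrs, Set.mem_ofPred_eq, Set.mem_union, glue_adj]
  exact or_congr (adj_map_apply evenMap_injective F (Sum.inl l) (Sum.inl m))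
    (adj_map_apply oddMap_injective G (Sum.inl l) (Sum.inl m))

theorem freeNbrs_glue (F G : RawGraph L) (l : L) : ((F.glue G).freeNbrs l).ncard =
    (F.freeNbrs l).ncard + (G.freeNbrs l).ncard := by
  have : (F.glue G).freeNbrs l = (fun n => 2 * n) '' F.freeNbrs l ∪
      (fun n => 2 * n + 1) '' G.freeNbrs l := by
    ext m
    simp only [freeNbrs, Set.mem_ofPred_eq, Set.mem_union, glue_adj, Set.mem_image]
    refine or_congr ?_ ?_
    · rw [adj_map evenMap_injective]
      constructor
      · rintro ⟨x, y, h, hx, hy⟩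
        rcases y with y | y
        · simp at hy
        · rw [evenMap_eq_inl_iff] at hx
          exact ⟨y, hx ▸ h, by simpa using hy⟩
      · rintro ⟨n, h, rfl⟩; exact ⟨_, _, h, rfl, rfl⟩
    · rw [adj_map oddMap_injective]
      constructor
      · rintro ⟨x, y, h, hx, hy⟩
        rcases y with y | y
        · simp at hy
        · rw [oddMap_eq_inl_iff] at hx
          exact ⟨y, hx ▸ h, by simpa using hy⟩
      · rintro ⟨n, h, rfl⟩; exact ⟨_, _, h, rfl, rfl⟩
  rw [this, Set.ncard_union_eq ?_ ((F.finite_freeNbrs l).image _) ((G.finite_freeNbrs l).image _),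
    Set.ncard_image_of_injective _ fun a b h => by simpa using h,
    Set.ncard_image_of_injective _ fun a b h => by simpa using h]
  rw [Set.disjoint_left]
  rintro _ ⟨a, -, rfl⟩ ⟨b, -, h⟩
  simp only at h
  omega

theorem deg_glue_even (F G : RawGraph L) (n : ℕ) :
    (F.glue G).deg (Sum.inr (2 * n)) = F.deg (Sum.inr n) := by
  rw [← deg_map evenMap_injective F (Sum.inr n)]
  unfold deg
  congr 1
  ext y
  simp only [SimpleGraph.mem_neighborSet, glue_adj, evenMap_inr, or_iff_left_iff_imp,
    adj_map oddMap_injective]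
  rintro ⟨x, -, -, h, -⟩
  rcases x with x | x
  · simp at h
  · simp at h; omega

theorem deg_glue_odd (F G : RawGraph L) (n : ℕ) :
    (F.glue G).deg (Sum.inr (2 * n + 1)) = G.deg (Sum.inr n) := by
  rw [← deg_map oddMap_injective G (Sum.inr n)]
  unfold deg
  congr 1
  ext y
  simp only [SimpleGraph.mem_neighborSet, glue_adj, oddMap_inr, or_iff_right_iff_imp,
    adj_map evenMap_injective]
  rintro ⟨x, -, -, h, -⟩
  rcases x with x | x
  · simp at h
  · simp at h; omega

/-- The part of the degree weight that comes from the unlabeled vertices. -/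
noncomputable def freeWeight (φ : ℕ → ℝ) (G : RawGraph L) : ℝ := ∑ᶠ n : ℕ, φ (G.deg (Sum.inr n))

theorem degWeight_eq {φ : ℕ → ℝ} (hφ : φ 0 = 0) (G : RawGraph L) :
    G.degWeight φ = (∑ᶠ l : L, φ ((G.labeledNbrs l).ncard + (G.freeNbrs l).ncard)) +
      G.freeWeight φ := by
  rw [degWeight, finsum_eq_add_finsum (i := (Sum.inl : L → L ⊕ ℕ)) (j := (Sum.inr : ℕ → L ⊕ ℕ))
    Sum.inl_injective Sum.inr_injective (by simp) (by simp) (finite_support_deg hφ G)]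
  simp only [deg_inl, freeWeight]

/-- Unlabeled vertices are not identified and keep their degrees, so they cancel in the midpoint
gap. All concavity comes from the labeled vertices. -/
theorem freeWeight_glue {φ : ℕ → ℝ} (hφ : φ 0 = 0) (F G : RawGraph L) :
    (F.glue G).freeWeight φ = F.freeWeight φ + G.freeWeight φ := by
  rw [freeWeight, finsum_eq_add_finsum (i := fun n : ℕ => 2 * n) (j := fun n : ℕ => 2 * n + 1)
    (fun a b h => by simpa using h) (fun a b h => by simpa using h) (by intros; omega)
    (fun x => by
      rcases Nat.even_or_odd' x with ⟨k, h | h⟩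
      · exact Or.inl ⟨k, h.symm⟩
      · exact Or.inr ⟨k, h.symm⟩)
    ((finite_support_deg hφ (F.glue G)).preimage Sum.inr_injective.injOn)]
  simp only [deg_glue_even, deg_glue_odd, freeWeight]

/-- At a label, edges to labeled neighbors may coincide in the two factors and are merged, while
edges to unlabeled neighbors are always distinct; hence the union in one count and the sum in the
other. -/
theorem degWeight_glue {φ : ℕ → ℝ} (hφ : φ 0 = 0) {F G : RawGraph L} {S : Finset L}
    (hF : ∀ l, Sum.inl l ∈ F.1.support → l ∈ S) (hG : ∀ l, Sum.inl l ∈ G.1.support → l ∈ S) :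
    (F.glue G).degWeight φ = (∑ l ∈ S, φ ((F.labeledNbrs l ∪ G.labeledNbrs l).ncard +
      ((F.freeNbrs l).ncard + (G.freeNbrs l).ncard))) + (F.freeWeight φ + G.freeWeight φ) := by
  rw [degWeight_eq hφ, freeWeight_glue hφ]
  simp only [labeledNbrs_glue, freeNbrs_glue]
  congr 1
  refine finsum_eq_sum_of_support_subset _ ?_
  intro l hl
  by_contra hlS
  have hF' : Sum.inl l ∉ F.1.support := fun h => hlS (hF l h)
  have hG' : Sum.inl l ∉ G.1.support := fun h => hlS (hG l h)
  have h1 := deg_inl F l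
  have h2 := deg_inl G l
  rw [deg_eq_zero hF'] at h1
  rw [deg_eq_zero hG'] at h2
  have h3 := Set.ncard_union_le (F.labeledNbrs l) (G.labeledNbrs l)
  refine hl ?_
  simp only
  rw [show (F.labeledNbrs l ∪ G.labeledNbrs l).ncard + ((F.freeNbrs l).ncard + (G.freeNbrs l).ncard)
    = 0 by omega, hφ]

end RawGraph

namespace UGraph

/-- The sum over the vertices of a function of the degree. -/
noncomputable def degWeight (φ : ℕ → ℝ) (hφ : φ 0 = 0) (H : UGraph) : ℝ :=
  Quotient.lift (RawGraph.degWeight φ) (by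
    rintro G _ ⟨σ, rfl⟩
    exact (RawGraph.degWeight_map hφ (Function.injective_id.sumMap σ.injective) G).symm) H

theorem degWeight_mk (φ : ℕ → ℝ) (hφ : φ 0 = 0) (G : RawGraph Empty) :
    degWeight φ hφ (PLGraph.mk G) = G.degWeight φ := rfl

theorem degWeight_mul (φ : ℕ → ℝ) (hφ : φ 0 = 0) (A B : UGraph) :
    degWeight φ hφ (A * B) = degWeight φ hφ A + degWeight φ hφ B := by
  obtain ⟨F, rfl⟩ := A.exists_rep
  obtain ⟨G, rfl⟩ := B.exists_rep
  rw [PLGraph.mk_mul_mk]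
  simp only [degWeight_mk]
  rw [RawGraph.degWeight_glue hφ (S := ∅) (fun l => l.elim) (fun l => l.elim),
    RawGraph.degWeight_eq hφ, RawGraph.degWeight_eq hφ]
  simp [finsum_of_isEmpty]

theorem degWeight_unlabel_mk (φ : ℕ → ℝ) (hφ : φ 0 = 0) (G : RawGraph ℕ) :
    degWeight φ hφ (PLGraph.mk G).unlabel = G.degWeight φ := by
  rw [PLGraph.unlabel_mk, degWeight_mk,
    RawGraph.degWeight_map hφ (RawGraph.transportMap_injective Sum.inr_injective)]

end UGraph

/-- A concave increasing function of the degree that is linear up to `p + 1` but not beyond. -/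
noncomputable def kink (p k : ℕ) : ℝ := min (k : ℝ) (Real.sqrt ((p + 1) * k))

theorem kink_zero (p : ℕ) : kink p 0 = 0 := by simp [kink]

theorem kink_le (p k : ℕ) : kink p k ≤ k := min_le_left _ _

theorem kink_le_sqrt (p k : ℕ) : kink p k ≤ Real.sqrt ((p + 1) * k) := min_le_right _ _

theorem kink_eq_iff (p k : ℕ) : kink p k = k ↔ k ≤ p + 1 := by
  rw [kink, min_eq_left_iff, Real.le_sqrt (by positivity), sq]
  swap
  · positivity
  rcases Nat.eq_zero_or_pos k with rfl | hk
  · simp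
  · have : (0 : ℝ) < k := by exact_mod_cast hk
    rw [mul_le_mul_iff_left₀ this]
    exact_mod_cast Iff.rfl

/-- Midpoint concavity and monotonicity in one inequality: a minimum of two concave increasing
functions is concave and increasing. -/
theorem kink_add_le (p : ℕ) {x y s : ℕ} (h : x + y ≤ 2 * s) :
    kink p x + kink p y ≤ 2 * kink p s := by
  have h' : (x : ℝ) + y ≤ 2 * s := by exact_mod_cast h
  have hx := kink_le p x
  have hy := kink_le p y
  have hx' := kink_le_sqrt p x
  have hy' := kink_le_sqrt p y
  set q : ℝ := (p : ℝ) + 1 with hq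
  have hq0 : 0 ≤ q := by positivity
  have ax := Real.sq_sqrt (show 0 ≤ q * x by positivity)
  have ay := Real.sq_sqrt (show 0 ≤ q * y by positivity)
  have as := Real.sq_sqrt (show 0 ≤ q * s by positivity)
  have ps := Real.sqrt_nonneg (q * s)
  have hsq : Real.sqrt (q * x) + Real.sqrt (q * y) ≤ 2 * Real.sqrt (q * s) := by
    refine abs_le_of_sq_le_sq' ?_ (by positivity) |>.2
    nlinarith [sq_nonneg (Real.sqrt (q * x) - Real.sqrt (q * y)), mul_le_mul_of_nonneg_left h' hq0]
  -- Whichever branch realizes the minimum at `s` also bounds the values at `x` and `y`, so the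
  -- inequality for that branch suffices.
  rcases min_choice (s : ℝ) (Real.sqrt (q * s)) with e | e
  · have e' : kink p s = s := e
    linarith
  · have e' : kink p s = Real.sqrt (q * s) := e
    linarith

/-- The equality case of midpoint concavity at one label. In the application `a` and `b` count the
labeled neighbors in the two factors, `k` those in the union, and `u` the unlabeled neighbors in the
second factor; the first has none. -/
theorem eq_of_kink_add_eq (p : ℕ) {a b k u : ℕ} (ha : a = p ∨ a = p + 1) (hak : a ≤ k)
    (hbk : b ≤ k) (h : kink p a + kink p (b + 2 * u) = 2 * kink p (k + u)) :
    k = a ∧ k = b ∧ u = 0 := by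
  have h1 := kink_le p a
  have h2 := kink_le p (b + 2 * u)
  rcases le_or_gt (k + u) (p + 1) with hs | hs
  · rw [(kink_eq_iff p (k + u)).2 hs] at h
    have h3 : 2 * (k + u) ≤ a + (b + 2 * u) := by
      have : (2 * (k + u : ℕ) : ℝ) ≤ a + (b + 2 * u : ℕ) := by linarith
      exact_mod_cast this
    have hka : k = a := by omega
    have hkb : k = b := by omega
    refine ⟨hka, hkb, ?_⟩
    have h4 : kink p (b + 2 * u) = (b + 2 * u : ℕ) := by
      refine le_antisymm h2 ?_
      have : ((a + (b + 2 * u) : ℕ) : ℝ) = 2 * (k + u : ℕ) := by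
        rw [← hka, ← hkb]; push_cast; ring
      push_cast at this h h1 ⊢
      linarith
    -- Now b + 2u ≤ p + 1, whereas b = a ≥ p. This leaves 2u ≤ 1, and u = 0 by parity; here degree p
    -- or p + 1 is needed.
    have := (kink_eq_iff _ _).1 h4
    omega
  -- Above p + 1 the midpoint lies on the square root branch. Strict concavity of the square root
  -- then forces both values to equal the one at `s`, but a ≤ p + 1 < s.
  · exfalso
    have hx' := kink_le_sqrt p a
    have hy' := kink_le_sqrt p (b + 2 * u)
    have hs' : kink p (k + u) = Real.sqrt ((p + 1) * (k + u : ℕ)) := by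
      refine (min_choice _ _).resolve_left fun e => ?_
      have := (kink_eq_iff p (k + u)).1 e
      omega
    rw [hs'] at h
    have hle : a + (b + 2 * u) ≤ 2 * (k + u) := by omega
    generalize b + 2 * u = y at *
    generalize k + u = s at *
    have hle' : (a : ℝ) + y ≤ 2 * s := by exact_mod_cast hle
    set q : ℝ := (p : ℝ) + 1 with hq
    have hq0 : 0 < q := by positivity
    have ax := Real.sq_sqrt (show 0 ≤ q * a by positivity)
    have ay := Real.sq_sqrt (show 0 ≤ q * y by positivity)
    have as := Real.sq_sqrt (show 0 ≤ q * s by positivity)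
    have ps := Real.sqrt_nonneg (q * s)
    have hm := mul_le_mul_of_nonneg_left hle' hq0.le
    have hAY : (Real.sqrt (q * a) - Real.sqrt (q * y)) ^ 2 ≤ 0 := by nlinarith
    have hAY' : Real.sqrt (q * a) = Real.sqrt (q * y) := by nlinarith
    have hSA : Real.sqrt (q * s) ≤ Real.sqrt (q * a) := by linarith
    have hlt : Real.sqrt (q * a) < Real.sqrt (q * s) := by
      refine Real.sqrt_lt_sqrt (by positivity) ?_
      refine mul_lt_mul_of_pos_left ?_ hq0
      exact_mod_cast (by omega : a < s)
    linarith

namespace RawGraph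

/-- The degrees of `l` in F² and G² add up to at most twice its degree in FG, since each
neighborhood is contained in the union. -/
theorem two_mul_kink_ge (p : ℕ) (F G : RawGraph ℕ) (l : ℕ) :
    kink p ((F.labeledNbrs l).ncard + ((F.freeNbrs l).ncard + (F.freeNbrs l).ncard)) +
      kink p ((G.labeledNbrs l).ncard + ((G.freeNbrs l).ncard + (G.freeNbrs l).ncard)) ≤
    2 * kink p ((F.labeledNbrs l ∪ G.labeledNbrs l).ncard +
      ((F.freeNbrs l).ncard + (G.freeNbrs l).ncard)) := by
  have hfin := (F.finite_labeledNbrs l).union (G.finite_labeledNbrs l)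
  have h1 := Set.ncard_le_ncard (Set.subset_union_left (s := F.labeledNbrs l)
    (t := G.labeledNbrs l)) hfin
  have h2 := Set.ncard_le_ncard (Set.subset_union_right (s := F.labeledNbrs l)
    (t := G.labeledNbrs l)) hfin
  exact kink_add_le p (by omega)

/-- Midpoint concavity of the degree weight for gluing products, with the equality case at the
vertices of degree `p` and `p + 1` with labeled neighbors only. -/
theorem degWeight_glue_le (p : ℕ) (F G : RawGraph ℕ) :
    (F.glue F).degWeight (kink p) + (G.glue G).degWeight (kink p) ≤
      2 * (F.glue G).degWeight (kink p) ∧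
    ((F.glue F).degWeight (kink p) + (G.glue G).degWeight (kink p) =
      2 * (F.glue G).degWeight (kink p) → ∀ l, F.freeNbrs l = ∅ →
      ((F.labeledNbrs l).ncard = p ∨ (F.labeledNbrs l).ncard = p + 1) →
      G.freeNbrs l = ∅ ∧ G.labeledNbrs l = F.labeledNbrs l) := by
  have hfin : {l : ℕ | Sum.inl l ∈ F.1.support ∪ G.1.support}.Finite :=
    (F.finite_support.union G.finite_support).preimage Sum.inl_injective.injOn
  have hFS : ∀ l, Sum.inl l ∈ F.1.support → l ∈ hfin.toFinset := by
    intro l hl; simp [hl]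
  have hGS : ∀ l, Sum.inl l ∈ G.1.support → l ∈ hfin.toFinset := by
    intro l hl; simp [hl]
  have hz := kink_zero p
  rw [degWeight_glue hz hFS hFS, degWeight_glue hz hGS hGS, degWeight_glue hz hFS hGS]
  simp only [Set.union_self]
  have hle := Finset.sum_le_sum fun l (_ : l ∈ hfin.toFinset) => two_mul_kink_ge p F G l
  rw [Finset.sum_add_distrib, ← Finset.mul_sum] at hle
  refine ⟨by linarith, fun heq l hlf hl => ?_⟩
  by_cases hlS : l ∈ hfin.toFinset
  · have heq' : ∑ l ∈ hfin.toFinset,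
        (kink p ((F.labeledNbrs l).ncard + ((F.freeNbrs l).ncard + (F.freeNbrs l).ncard)) +
      kink p ((G.labeledNbrs l).ncard + ((G.freeNbrs l).ncard + (G.freeNbrs l).ncard))) =
      ∑ l ∈ hfin.toFinset, 2 * kink p ((F.labeledNbrs l ∪ G.labeledNbrs l).ncard +
      ((F.freeNbrs l).ncard + (G.freeNbrs l).ncard)) := by
      rw [Finset.sum_add_distrib, ← Finset.mul_sum]; linarith
    have hl' := (Finset.sum_eq_sum_iff_of_le fun l _ => two_mul_kink_ge p F G l).1 heq' l hlS
    have hfin := (F.finite_labeledNbrs l).union (G.finite_labeledNbrs l)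
    have h1 := Set.ncard_le_ncard (Set.subset_union_left (s := F.labeledNbrs l)
      (t := G.labeledNbrs l)) hfin
    have h2 := Set.ncard_le_ncard (Set.subset_union_right (s := F.labeledNbrs l)
      (t := G.labeledNbrs l)) hfin
    simp only [hlf, Set.ncard_empty, zero_add, ← two_mul, mul_zero, add_zero] at hl'
    obtain ⟨e1, e2, e3⟩ := eq_of_kink_add_eq p hl h1 h2 hl'
    refine ⟨(Set.ncard_eq_zero (G.finite_freeNbrs l)).1 e3, ?_⟩
    exact (Set.eq_of_subset_of_ncard_le Set.subset_union_right e2.le hfin).trans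
      (Set.eq_of_subset_of_ncard_le Set.subset_union_left e1.le hfin).symm
  -- A label in neither graph has empty neighborhoods on both sides.
  · have hF' : Sum.inl l ∉ F.1.support := fun h => hlS (hFS l h)
    have hG' : Sum.inl l ∉ G.1.support := fun h => hlS (hGS l h)
    constructor
    · rw [Set.eq_empty_iff_forall_notMem]; intro n hn; exact hG' ⟨_, hn⟩
    · ext m
      exact ⟨fun h => (hG' ⟨_, h⟩).elim, fun h => (hF' ⟨_, h⟩).elim⟩

end RawGraph

end GraphSOS

/-! ### Components of squares and the multiplicity inequality -/

namespace GraphSOS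

namespace RawGraph

variable {L M : Type}

/-- The permutation of `ℕ` that exchanges `2 * n` and `2 * n + 1`. -/
def swapEvenOdd : Equiv.Perm ℕ :=
  (Equiv.natSumNatEquivNat.symm.trans (Equiv.sumComm ℕ ℕ)).trans Equiv.natSumNatEquivNat

theorem swapEvenOdd_even (n : ℕ) : swapEvenOdd (2 * n) = 2 * n + 1 := by
  have h : Equiv.natSumNatEquivNat.symm (2 * n) = Sum.inl n := by
    rw [Equiv.symm_apply_eq]; simp
  simp [swapEvenOdd, h]

theorem swapEvenOdd_odd (n : ℕ) : swapEvenOdd (2 * n + 1) = 2 * n := by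
  have h : Equiv.natSumNatEquivNat.symm (2 * n + 1) = Sum.inr n := by
    rw [Equiv.symm_apply_eq]; simp
  simp [swapEvenOdd, h]

/-- The involution of the vertex pool that exchanges the two copies in a square. -/
def swapMap (L : Type) : L ⊕ ℕ → L ⊕ ℕ := Sum.map id swapEvenOdd

theorem swapMap_injective : Function.Injective (swapMap L) :=
  Function.injective_id.sumMap swapEvenOdd.injective

theorem swapMap_evenMap (x : L ⊕ ℕ) : swapMap L (evenMap L x) = oddMap L x := by
  rcases x with l | n <;> simp [swapMap, swapEvenOdd_even]

theorem swapMap_oddMap (x : L ⊕ ℕ) : swapMap L (oddMap L x) = evenMap L x := by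
  rcases x with l | n <;> simp [swapMap, swapEvenOdd_odd]

theorem glue_self_map_swap (F : RawGraph L) : (F.glue F).map (swapMap L) = F.glue F := by
  rw [glue_eq, map_union, map_map, map_map, union_comm]
  congr 1
  · exact map_congr F fun x _ => swapMap_oddMap x
  · exact map_congr F fun x _ => swapMap_evenMap x

/-- A component of a square that contains a label is itself a square. -/
theorem IsBlock.exists_glue_self {F D : RawGraph L} (h : IsBlock (F.glue F) D) {l : L}
    (hl : Sum.inl l ∈ D.1.support) : ∃ D' : RawGraph L, D'.1 ≤ F.1 ∧ D = D'.glue D' := by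
  -- The exchange of the two copies is an automorphism of F² that fixes every label. It sends `D` to
  -- a component meeting `D` in `l`, that is, to `D`.
  have hswap : D.map (swapMap L) = D := by
    have h' : IsBlock (F.glue F) (D.map (swapMap L)) := by
      rw [← glue_self_map_swap F]
      exact (isBlock_map swapMap_injective).2 h
    refine h'.eq_of_mem h (x := Sum.inl l) ?_ hl
    rw [support_map swapMap_injective]
    exact ⟨_, hl, rfl⟩
  have hsw : ∀ a b, D.1.Adj (swapMap L a) (swapMap L b) ↔ D.1.Adj a b := by
    intro a b
    conv_lhs => rw [← hswap]
    exact adj_map_apply swapMap_injective D a b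
  -- The root of `D` is its trace on the even copy. An edge of the odd copy seen there joins two
  -- labels, so it is an edge of `F` as well.
  have hle : D.1.comap (evenMap L) ≤ F.1 := by
    intro a b e
    rcases (glue_adj _ _ _ _).1 (h.1 e) with e' | e'
    · exact (adj_map_apply evenMap_injective _ _ _).1 e'
    · obtain ⟨x, y, e'', hx, hy⟩ := (adj_map oddMap_injective _ _ _).1 e'
      obtain ⟨l, rfl, rfl⟩ := (evenMap_eq_oddMap_iff _ _).1 hx.symm
      obtain ⟨m, rfl, rfl⟩ := (evenMap_eq_oddMap_iff _ _).1 hy.symm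
      exact e''
  refine ⟨⟨D.1.comap (evenMap L), F.2.subset (SimpleGraph.edgeSet_mono hle)⟩, hle, Subtype.ext ?_⟩
  ext a b
  rw [glue_adj, adj_map evenMap_injective, adj_map oddMap_injective]
  constructor
  · intro e
    rcases (glue_adj _ _ _ _).1 (h.1 e) with e' | e'
    · obtain ⟨x, y, -, rfl, rfl⟩ := (adj_map evenMap_injective _ _ _).1 e'
      exact Or.inl ⟨x, y, e, rfl, rfl⟩
    · obtain ⟨x, y, -, rfl, rfl⟩ := (adj_map oddMap_injective _ _ _).1 e'
      refine Or.inr ⟨x, y, ?_, rfl, rfl⟩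
      rw [← hsw, swapMap_oddMap, swapMap_oddMap] at e
      exact e
  · rintro (⟨x, y, e, rfl, rfl⟩ | ⟨x, y, e, rfl, rfl⟩)
    · exact e
    · rw [← hsw, swapMap_oddMap, swapMap_oddMap]
      exact e

theorem map_eq_self_of_labeled {F : RawGraph L} (hF : F.1.support ⊆ Set.range Sum.inl)
    {f : L ⊕ ℕ → L ⊕ ℕ} (hf : ∀ l, f (Sum.inl l) = Sum.inl l) : F.map f = F := by
  conv_rhs => rw [← map_id F]
  refine map_congr F fun x hx => ?_
  obtain ⟨l, rfl⟩ := hF hx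
  exact hf l

theorem glue_self_of_labeled {F : RawGraph L} (hF : F.1.support ⊆ Set.range Sum.inl) :
    F.glue F = F := by
  rw [glue_eq, map_eq_self_of_labeled hF evenMap_inl, map_eq_self_of_labeled hF oddMap_inl,
    union_self]

end RawGraph

namespace PLGraph

open RawGraph

theorem fullyLabeled_mk (G : RawGraph ℕ) :
    (mk G).FullyLabeled ↔ G.1.support ⊆ Set.range Sum.inl := by
  constructor
  · rintro ⟨H, h, hs⟩
    obtain ⟨σ, rfl⟩ := RawGraph.mk_eq_iff.1 h
    rw [rename, RawGraph.support_map (Function.injective_id.sumMap σ.injective)]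
    rintro _ ⟨x, hx, rfl⟩
    obtain ⟨l, rfl⟩ := hs hx
    exact ⟨l, rfl⟩
  · intro h; exact ⟨G, rfl, h⟩

end PLGraph

namespace RawGraph

/-- Every vertex has degree `p` or `p + 1`. -/
def DegreesNear {L : Type} (p : ℕ) (G : RawGraph L) : Prop :=
  ∀ x ∈ G.1.support, G.deg x = p ∨ G.deg x = p + 1

theorem degreesNear_map {L M : Type} {p : ℕ} {f : L ⊕ ℕ → M ⊕ ℕ} (hf : Function.Injective f)
    (G : RawGraph L) : (G.map f).DegreesNear p ↔ G.DegreesNear p := by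
  unfold DegreesNear
  rw [support_map hf]
  simp only [Set.forall_mem_image, deg_map hf]

theorem IsBlock.deg_eq {L : Type} {G D : RawGraph L} (h : IsBlock G D) {x : L ⊕ ℕ}
    (hx : x ∈ D.1.support) : G.deg x = D.deg x := by
  unfold deg
  congr 1
  ext y
  exact ⟨fun e => h.2.2 x hx y e, fun e => h.1 e⟩

theorem IsBlock.degreesNear {L : Type} {p : ℕ} {G D : RawGraph L} (h : IsBlock G D)
    (hG : G.DegreesNear p) : D.DegreesNear p := by
  intro x hx
  rw [← h.deg_eq hx]
  exact hG x (SimpleGraph.support_mono h.1 hx)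

/-- Midpoint concavity of the number of components isomorphic to `C`, for two graphs for which the
degree weight is midpoint linear. -/
theorem multiplicity_glue_le {p : ℕ} {C : ConnGraph}
    (hsq : ∀ F : PLGraph ℕ, (F * F).unlabel = C.1 → F.FullyLabeled)
    (hdeg : ∀ D : RawGraph ℕ, (PLGraph.mk D).unlabel = C.1 → D.DegreesNear p)
    (F G : RawGraph ℕ) (htie : (F.glue F).degWeight (kink p) + (G.glue G).degWeight (kink p) =
      2 * (F.glue G).degWeight (kink p)) :
    UGraph.multiplicity C (PLGraph.mk (F.glue F)).unlabel +
      UGraph.multiplicity C (PLGraph.mk (G.glue G)).unlabel ≤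
    2 * UGraph.multiplicity C (PLGraph.mk (F.glue G)).unlabel := by
  classical
  simp only [UGraph.multiplicity_unlabel_mk]
  let P : RawGraph ℕ → Prop := fun D => (PLGraph.mk D).unlabel = C.1
  -- Copies of `C` among the components are sorted into those without labels (`U`) and those with
  -- labels only (`V`). Others cannot produce a copy of `C` in a square, so the proof bounds the
  -- squares by 2|U F| + |V F| and 2|U G| + |V G|, and FG below by |U F| + |U G| + |V F|.
  let U : RawGraph ℕ → Set (RawGraph ℕ) := fun F =>
    {D | IsBlock F D ∧ P D ∧ ∀ l, Sum.inl l ∉ D.1.support}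
  let V : RawGraph ℕ → Set (RawGraph ℕ) := fun F =>
    {D | IsBlock F D ∧ P D ∧ D.1.support ⊆ Set.range Sum.inl}
  have hUfin : ∀ F, (U F).Finite := fun F => F.finite_le.subset fun D h => h.1.1
  have hVfin : ∀ F, (V F).Finite := fun F => F.finite_le.subset fun D h => h.1.1
  have he : ∀ D : RawGraph ℕ, P (D.map (evenMap ℕ)) ↔ P D := by
    intro D
    have : PLGraph.mk (D.map (evenMap ℕ)) = PLGraph.mk D := by
      conv_rhs => rw [← RawGraph.map_id D]
      exact Quotient.sound (map_equiv evenMap_injective Function.injective_id fun _ _ m => by simp)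
    simp only [P, this]
  have ho : ∀ D : RawGraph ℕ, P (D.map (oddMap ℕ)) ↔ P D := by
    intro D
    have : PLGraph.mk (D.map (oddMap ℕ)) = PLGraph.mk D := by
      conv_rhs => rw [← RawGraph.map_id D]
      exact Quotient.sound (map_equiv oddMap_injective Function.injective_id fun _ _ m => by simp)
    simp only [P, this]
  have upper : ∀ F : RawGraph ℕ, ((F.glue F).blocks P).ncard ≤ 2 * (U F).ncard + (V F).ncard := by
    intro F
    have hsub : (F.glue F).blocks P ⊆
        (RawGraph.map (evenMap ℕ) '' U F ∪ RawGraph.map (oddMap ℕ) '' U F) ∪ V F := by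
      rintro D ⟨hD, hP⟩
      by_cases hl : ∀ l, Sum.inl l ∉ D.1.support
      · left
        rcases hD.of_glue hl with ⟨D', h', hl', rfl⟩ | ⟨D', h', hl', rfl⟩
        · exact Or.inl ⟨D', ⟨h', (he D').1 hP, hl'⟩, rfl⟩
        · exact Or.inr ⟨D', ⟨h', (ho D').1 hP, hl'⟩, rfl⟩
      · right
        push Not at hl
        obtain ⟨l, hl⟩ := hl
        -- A component of F² with a label is a square. Being a copy of `C`, it has a fully labeled
        -- root, so it was already a component of `F`.
        obtain ⟨D', hle, hDD'⟩ := hD.exists_glue_self hl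
        have hlab := (PLGraph.fullyLabeled_mk D').1 (hsq (PLGraph.mk D') (by
          rw [PLGraph.mk_mul_mk, ← hDD']; exact hP))
        have hDD : D = D' := hDD'.trans (glue_self_of_labeled hlab)
        subst hDD
        refine ⟨⟨hle, hD.2.1, fun x hx y e => hD.2.2 x hx y ?_⟩, hP, hlab⟩
        obtain ⟨m, rfl⟩ := hlab hx
        rcases y with k | n
        · exact (glue_adj _ _ _ _).2 (Or.inl ((adj_map_apply evenMap_injective F
            (Sum.inl m) (Sum.inl k)).2 e))
        · exfalso
          have h1 : (F.glue F).1.Adj (Sum.inl m) (Sum.inr (2 * n)) :=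
            (glue_adj _ _ _ _).2 (Or.inl ((adj_map_apply evenMap_injective F
            (Sum.inl m) (Sum.inr n)).2 e))
          obtain ⟨k, hk⟩ := hlab (hD.2.2 _ hx _ h1).mem_support_right
          cases hk
    have hfin : ((RawGraph.map (evenMap ℕ) '' U F ∪ RawGraph.map (oddMap ℕ) '' U F) ∪ V F).Finite :=
      (((hUfin F).image _).union ((hUfin F).image _)).union (hVfin F)
    refine (Set.ncard_le_ncard hsub hfin).trans ((Set.ncard_union_le _ _).trans ?_)
    have h1 := Set.ncard_union_le (RawGraph.map (evenMap ℕ) '' U F) (RawGraph.map (oddMap ℕ) '' U F)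
    have h2 := Set.ncard_image_le (f := RawGraph.map (evenMap ℕ)) (hUfin F)
    have h3 := Set.ncard_image_le (f := RawGraph.map (oddMap ℕ)) (hUfin F)
    omega
  have hVV : ∀ F G : RawGraph ℕ, (F.glue F).degWeight (kink p) + (G.glue G).degWeight (kink p) =
      2 * (F.glue G).degWeight (kink p) → ∀ D ∈ V F, D ∈ V G ∧ IsBlock (F.glue G) D := by
    intro F G htie D hD
    have hF : ∀ l, Sum.inl l ∈ D.1.support → F.freeNbrs l = ∅ ∧
        ((F.labeledNbrs l).ncard = p ∨ (F.labeledNbrs l).ncard = p + 1) := by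
      intro l hl
      have h1 : F.freeNbrs l = ∅ := by
        rw [Set.eq_empty_iff_forall_notMem]
        intro n hn
        obtain ⟨k, hk⟩ := hD.2.2 (hD.1.2.2 _ hl _ hn).mem_support_right
        cases hk
      refine ⟨h1, ?_⟩
      have h2 := hdeg D hD.2.1 _ hl
      rwa [← hD.1.deg_eq hl, deg_inl, h1, Set.ncard_empty, add_zero] at h2
    -- The tie in the degree weight gives `F` and `G` the same neighborhood at every vertex of `D`.
    -- Hence `D` is a component of `G` and of FG too.
    have hG : ∀ l, Sum.inl l ∈ D.1.support → ∀ y, G.1.Adj (Sum.inl l) y ↔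
        F.1.Adj (Sum.inl l) y := by
      intro l hl y
      obtain ⟨h1, h2⟩ := (degWeight_glue_le p F G).2 htie l (hF l hl).1 (hF l hl).2
      rcases y with k | n
      · exact Set.ext_iff.1 h2 k
      · rw [← (hF l hl).1] at h1
        exact Set.ext_iff.1 h1 n
    have hGD : ∀ x ∈ D.1.support, ∀ y, G.1.Adj x y → D.1.Adj x y := by
      intro x hx y e
      obtain ⟨l, rfl⟩ := hD.2.2 hx
      exact hD.1.2.2 _ hx y ((hG l hx y).1 e)
    refine ⟨⟨⟨?_, hD.1.2.1, hGD⟩, hD.2⟩, ?_⟩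
    · intro x y e
      obtain ⟨l, rfl⟩ := hD.2.2 e.mem_support_left
      exact (hG l e.mem_support_left y).2 (hD.1.1 e)
    · have := isBlock_glue_even (G := G) hD.1 fun l hl y e => by
        have e' := hGD _ hl y e
        obtain ⟨m, rfl⟩ := hD.2.2 e'.mem_support_right
        exact ⟨⟨m, rfl⟩, e'⟩
      rwa [map_eq_self_of_labeled hD.2.2 evenMap_inl] at this
  have hVFG : (V G).ncard ≤ (V F).ncard := by
    refine Set.ncard_le_ncard (fun D hD => (hVV G F ?_ D hD).1) (hVfin F)
    rw [add_comm, htie]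
    congr 1
    -- The tie is symmetric in the two graphs because gluing commutes up to isomorphism.
    have := congrArg (fun H : PLGraph ℕ => UGraph.degWeight (kink p) (kink_zero p) H.unlabel)
      (mul_comm (PLGraph.mk F) (PLGraph.mk G))
    simpa only [PLGraph.mk_mul_mk, UGraph.degWeight_unlabel_mk] using this
  have lower : (U F).ncard + (U G).ncard + (V F).ncard ≤ ((F.glue G).blocks P).ncard := by
    have hsub : (RawGraph.map (evenMap ℕ) '' U F ∪ RawGraph.map (oddMap ℕ) '' U G) ∪ V F ⊆
        (F.glue G).blocks P := by
      rintro _ ((⟨D, hD, rfl⟩ | ⟨D, hD, rfl⟩) | hD)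
      · exact ⟨isBlock_glue_even hD.1 fun l hl => (hD.2.2 l hl).elim, (he D).2 hD.2.1⟩
      · exact ⟨isBlock_glue_odd hD.1 hD.2.2, (ho D).2 hD.2.1⟩
      · exact ⟨(hVV F G htie _ hD).2, hD.2.1⟩
    refine le_trans (le_of_eq ?_) (Set.ncard_le_ncard hsub (finite_blocks _ _))
    rw [Set.ncard_union_eq ?_ (((hUfin F).image _).union ((hUfin G).image _)) (hVfin F),
      Set.ncard_union_eq ?_ ((hUfin F).image _) ((hUfin G).image _),
      Set.ncard_image_of_injective _ (map_injective evenMap_injective),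
      Set.ncard_image_of_injective _ (map_injective oddMap_injective)]
    · rw [Set.disjoint_left]
      rintro _ ⟨D, hD, rfl⟩ ⟨D', hD', h⟩
      exact map_even_ne_map_odd hD.1.nonempty hD'.2.2 h.symm
    · rw [Set.disjoint_left]
      rintro D hD hDV
      obtain ⟨x, hx⟩ := hDV.1.nonempty
      obtain ⟨l, rfl⟩ := hDV.2.2 hx
      rcases hD with ⟨D', hD', rfl⟩ | ⟨D', hD', rfl⟩
      · rw [support_map evenMap_injective] at hx
        obtain ⟨y, hy, hyl⟩ := hx
        rw [evenMap_eq_inl_iff] at hyl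
        exact hD'.2.2 l (hyl ▸ hy)
      · rw [support_map oddMap_injective] at hx
        obtain ⟨y, hy, hyl⟩ := hx
        rw [oddMap_eq_inl_iff] at hyl
        exact hD'.2.2 l (hyl ▸ hy)
  have h1 := upper F
  have h2 := upper G
  change ((F.glue F).blocks P).ncard + ((G.glue G).blocks P).ncard ≤
    2 * ((F.glue G).blocks P).ncard
  omega

/-- Components of trivial squares are trivial squares. -/
theorem IsBlock.fullyLabeled_of_isTrivialSquare {H D : RawGraph Empty} (h : IsBlock H D)
    (hH : UGraph.IsTrivialSquare (PLGraph.mk H)) (F : PLGraph ℕ)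
    (hF : (F * F).unlabel = PLGraph.mk D) : F.FullyLabeled := by
  obtain ⟨F, rfl⟩ := F.exists_rep
  have hfin : {l : ℕ | Sum.inl l ∈ F.1.support}.Finite :=
    F.finite_support.preimage Sum.inl_injective.injOn
  obtain ⟨N, hN⟩ := hfin.bddAbove
  -- The rest of `H` is fully labeled with labels above `N`, all unused in `F`. Adding it to `F`
  -- gives a root of `H`, which must be fully labeled; therefore so is `F`.
  let r : Empty ⊕ ℕ → ℕ ⊕ ℕ := Sum.elim Empty.elim fun n => Sum.inl (N + 1 + n)
  have hr : Function.Injective r := by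
    rintro (x | a) (y | b) hab
    · exact x.elim
    · exact x.elim
    · exact y.elim
    · simpa [r] using hab
  let R := (H.remove D).map r
  have hRs : R.1.support = r '' (H.remove D).1.support := support_map hr _
  have hRlab : R.1.support ⊆ Set.range Sum.inl := by
    rw [hRs]
    rintro _ ⟨x | n, -, rfl⟩
    · exact x.elim
    · exact ⟨_, rfl⟩
  have hFR : PLGraph.mk (F.union R) = PLGraph.mk F * PLGraph.mk R := by
    refine mk_union fun n _ hn => ?_
    obtain ⟨l, hl⟩ := hRlab hn
    cases hl
  have hRR : PLGraph.mk R * PLGraph.mk R = PLGraph.mk R := by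
    rw [PLGraph.mk_mul_mk, glue_self_of_labeled hRlab]
  have ht := transportMap_injective (M := Empty) (Sum.inr_injective (α := Empty) (β := ℕ))
  have key : ((PLGraph.mk F * PLGraph.mk F) * PLGraph.mk R).unlabel = PLGraph.mk H := by
    have hR' : PLGraph.mk (R.map (transportMap (M := Empty) Sum.inr)) = PLGraph.mk (H.remove D) := by
      rw [map_map]
      conv_rhs => rw [← RawGraph.map_id (H.remove D)]
      exact Quotient.sound (map_equiv (ht.comp hr) Function.injective_id fun _ _ m => m.elim)
    rw [h.mk_eq, ← hF, PLGraph.mk_mul_mk F F, PLGraph.unlabel_mk, ← hR']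
    refine (PLGraph.unlabel_mul_mk (evenMap_injective.comp ht) (oddMap_injective.comp ht)
      fun x hx y hy => ?_).trans (by rw [← map_map, ← map_map]; rfl)
    have hne : ∀ l, x = Sum.inl l → y = Sum.inl l → False := by
      rintro l rfl rfl
      rw [hRs] at hy
      obtain ⟨z | n, -, hz⟩ := hy
      · exact z.elim
      · have hl : Sum.inl l ∈ F.1.support := by
          obtain ⟨z, hz⟩ := hx
          rcases (glue_adj _ _ _ _).1 hz with e | e
          · obtain ⟨a, b, e, ha, -⟩ := (adj_map evenMap_injective _ _ _).1 e
            exact ((evenMap_eq_inl_iff a l).1 ha) ▸ e.mem_support_left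
          · obtain ⟨a, b, e, ha, -⟩ := (adj_map oddMap_injective _ _ _).1 e
            exact ((oddMap_eq_inl_iff a l).1 ha) ▸ e.mem_support_left
        have h1 : l ≤ N := hN hl
        have h2 : N + 1 + n = l := by simpa [r] using hz
        omega
    constructor
    · intro e
      obtain ⟨m, -⟩ := (evenMap_eq_oddMap_iff _ _).1 e
      exact m.elim
    · rintro ⟨l, hl, hl'⟩; exact (hne l hl hl').elim
  have := (hH (PLGraph.mk (F.union R)) (by rw [hFR, ← key, mul_mul_mul_comm, hRR])).1
  rw [PLGraph.fullyLabeled_mk, support_union] at this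
  exact (PLGraph.fullyLabeled_mk F).2 (Set.subset_union_left.trans this)

end RawGraph

end GraphSOS

namespace GraphSOS

/-! ### Homomorphism densities -/

namespace RawGraph

variable {L M κ : Type}

/-- The density of homomorphisms from `G` to the relation `R`. -/
noncomputable def homDensity (R : κ → κ → Prop) (G : RawGraph L) : ℝ :=
  Nat.card {h : G.1.support → κ // ∀ a b : G.1.support, G.1.Adj a b → R (h a) (h b)} /
    (Nat.card κ : ℝ) ^ Nat.card G.1.support

/-- The density can be computed with any finite set of vertices that contains the support. -/
theorem homDensity_mul_pow [Finite κ] [Nonempty κ] (R : κ → κ → Prop) (G : RawGraph L) {Y : Type*}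
    [Finite Y] {f : Y → L ⊕ ℕ} (hf : Function.Injective f) (hG : G.1.support ⊆ Set.range f) :
    G.homDensity R * (Nat.card κ : ℝ) ^ Nat.card Y =
      Nat.card {h : Y → κ // ∀ a b, G.1.Adj (f a) (f b) → R (h a) (h b)} := by
  classical
  let s : Set (L ⊕ ℕ) := G.1.support
  let p : Y → Prop := fun y => f y ∈ s
  have : Finite G.1.support := G.finite_support.to_subtype
  let e : {y // p y} ≃ s := Equiv.ofBijective (fun y => ⟨f y.1, y.2⟩) ⟨fun a b h =>
      Subtype.ext (hf (congrArg Subtype.val h)), fun ⟨z, hz⟩ => by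
      obtain ⟨y, rfl⟩ := hG hz
      exact ⟨⟨y, hz⟩, rfl⟩⟩
  -- Vertices of `Y` outside the support are unconstrained, so each contributes a factor |κ|.
  have e1 : {h : Y → κ // ∀ a b, G.1.Adj (f a) (f b) → R (h a) (h b)} ≃
      {h : s → κ // ∀ a b : s, G.1.Adj a b → R (h a) (h b)} × ({y // ¬ p y} → κ) :=
    { toFun := fun h => ⟨⟨fun z => h.1 (e.symm z).1, fun a b hab => h.2 _ _ (by
          have ha : f (e.symm a).1 = a := congrArg Subtype.val (e.apply_symm_apply a)
          have hb : f (e.symm b).1 = b := congrArg Subtype.val (e.apply_symm_apply b)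
          rwa [ha, hb])⟩, fun y => h.1 y⟩
      invFun := fun q => ⟨fun y => if hy : p y then q.1.1 ⟨f y, hy⟩ else q.2 ⟨y, hy⟩,
        fun a b hab => by
          have ha : p a := hab.mem_support_left
          have hb : p b := hab.mem_support_right
          simp only [ha, hb, dite_true]
          exact q.1.2 _ _ hab⟩
      left_inv := fun h => by
        refine Subtype.ext (funext fun y => ?_)
        simp only
        split_ifs with hy
        · exact congrArg h.1 (congrArg Subtype.val (e.symm_apply_apply ⟨y, hy⟩))
        · rfl
      right_inv := fun q => by
        refine Prod.ext (Subtype.ext (funext fun z => ?_)) (funext fun y => ?_)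
        · have hz : f (e.symm z).1 = z := congrArg Subtype.val (e.apply_symm_apply z)
          simp only [(e.symm z).2, dite_true]
          exact congrArg q.1.1 (Subtype.ext hz)
        · simp only [y.2, dite_false] }
  have hcard : Nat.card Y = Nat.card s + Nat.card {y // ¬ p y} := by
    rw [← Nat.card_congr (Equiv.sumCompl p), Nat.card_sum, Nat.card_congr e]
  have hκ : (Nat.card κ : ℝ) ≠ 0 := by exact_mod_cast Nat.card_pos.ne'
  rw [Nat.card_congr e1, Nat.card_prod, Nat.card_fun, hcard, pow_add, homDensity]
  push_cast
  rw [← mul_assoc, div_mul_cancel₀ _ (pow_ne_zero _ hκ)]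

theorem homDensity_map [Finite κ] [Nonempty κ] (R : κ → κ → Prop) (G : RawGraph L)
    {f : L ⊕ ℕ → M ⊕ ℕ} (hf : Function.Injective f) :
    (G.map f).homDensity R = G.homDensity R := by
  have : Finite G.1.support := G.finite_support.to_subtype
  have hκ : (Nat.card κ : ℝ) ≠ 0 := by exact_mod_cast Nat.card_pos.ne'
  have h1 := homDensity_mul_pow R (G.map f) (f := fun x : G.1.support => f x.1)
    (hf.comp Subtype.val_injective) (by
      rw [support_map hf]
      rintro _ ⟨x, hx, rfl⟩
      exact ⟨⟨x, hx⟩, rfl⟩)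
  simp only [adj_map_apply hf] at h1
  rw [homDensity.eq_def R G, ← h1, mul_div_cancel_right₀ _ (pow_ne_zero _ hκ)]

theorem homDensity_pos [Finite κ] {R : κ → κ → Prop} {k : κ} (hk : R k k) (G : RawGraph L) :
    0 < G.homDensity R := by
  have : Finite G.1.support := G.finite_support.to_subtype
  have : Nonempty κ := ⟨k⟩
  have : Nonempty {h : G.1.support → κ // ∀ a b : G.1.support, G.1.Adj a b → R (h a) (h b)} :=
    ⟨⟨fun _ => k, fun _ _ _ => hk⟩⟩
  have h1 : 0 < Nat.card {h : G.1.support → κ // ∀ a b : G.1.support, G.1.Adj a b → R (h a) (h b)} :=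
    Nat.card_pos
  have h2 : 0 < Nat.card κ := Nat.card_pos
  unfold homDensity
  positivity

/-- The unlabeled vertices. -/
abbrev FreeVertex (G : RawGraph L) : Type := {n : ℕ // Sum.inr n ∈ G.1.support}

instance (G : RawGraph L) : Finite G.FreeVertex :=
  (G.finite_support.preimage Sum.inr_injective.injOn).to_subtype

noncomputable instance (G : RawGraph L) : Fintype G.FreeVertex := Fintype.ofFinite _

/-- The inclusion of a set of labels and of the unlabeled vertices in the vertex pool. -/
def incl (S : Finset L) (G : RawGraph L) : S ⊕ G.FreeVertex → L ⊕ ℕ :=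
  Sum.map Subtype.val Subtype.val

theorem exists_incl_eq {S : Finset L} {G : RawGraph L}
    (hS : ∀ l, Sum.inl l ∈ G.1.support → l ∈ S) {x : L ⊕ ℕ} (hx : x ∈ G.1.support) :
    ∃ a, incl S G a = x := by
  rcases x with l | n
  · exact ⟨Sum.inl ⟨l, hS l hx⟩, rfl⟩
  · exact ⟨Sum.inr ⟨n, hx⟩, rfl⟩

/-- The extensions of a map `x` of the labels to a homomorphism. -/
def IsExt (R : κ → κ → Prop) (S : Finset L) (G : RawGraph L) (x : S → κ)
    (g : G.FreeVertex → κ) : Prop :=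
  ∀ a b, G.1.Adj (incl S G a) (incl S G b) → R (Sum.elim x g a) (Sum.elim x g b)

/-- The number of extensions of a map of the labels to a homomorphism. -/
noncomputable def extCount (R : κ → κ → Prop) (S : Finset L) (G : RawGraph L) (x : S → κ) : ℕ :=
  Nat.card {g : G.FreeVertex → κ // IsExt R S G x g}

/-- The vertices of a gluing product. -/
def glueIncl (S : Finset L) (F G : RawGraph L) : S ⊕ (F.FreeVertex ⊕ G.FreeVertex) → L ⊕ ℕ :=
  Sum.elim (fun s => Sum.inl s.1) (Sum.elim (fun n => Sum.inr (2 * n.1)) fun n => Sum.inr (2 * n.1 + 1))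

theorem glueIncl_injective (S : Finset L) (F G : RawGraph L) :
    Function.Injective (glueIncl S F G) := by
  rintro (s | n | n) (s' | n' | n') h <;> simp [glueIncl] at h
  · rw [h]
  · rw [Subtype.ext h]
  · omega
  · omega
  · rw [Subtype.ext h]

theorem glueIncl_left (S : Finset L) (F G : RawGraph L) (a : S ⊕ F.FreeVertex) :
    glueIncl S F G (Sum.map id Sum.inl a) = evenMap L (incl S F a) := by
  rcases a with s | n <;> rfl

theorem glueIncl_right (S : Finset L) (F G : RawGraph L) (a : S ⊕ G.FreeVertex) :
    glueIncl S F G (Sum.map id Sum.inr a) = oddMap L (incl S G a) := by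
  rcases a with s | n <;> rfl

theorem isExt_glue {R : κ → κ → Prop} {S : Finset L} {F G : RawGraph L}
    (hF : ∀ l, Sum.inl l ∈ F.1.support → l ∈ S) (hG : ∀ l, Sum.inl l ∈ G.1.support → l ∈ S)
    (h : S ⊕ (F.FreeVertex ⊕ G.FreeVertex) → κ) :
    (∀ a b, (F.glue G).1.Adj (glueIncl S F G a) (glueIncl S F G b) → R (h a) (h b)) ↔
    IsExt R S F (fun s => h (Sum.inl s)) (fun n => h (Sum.inr (Sum.inl n))) ∧
    IsExt R S G (fun s => h (Sum.inl s)) (fun n => h (Sum.inr (Sum.inr n))) := by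
  have hl : ∀ a : S ⊕ F.FreeVertex, Sum.elim (fun s => h (Sum.inl s))
      (fun n => h (Sum.inr (Sum.inl n))) a = h (Sum.map id Sum.inl a) := by
    rintro (s | n) <;> rfl
  have hr : ∀ a : S ⊕ G.FreeVertex, Sum.elim (fun s => h (Sum.inl s))
      (fun n => h (Sum.inr (Sum.inr n))) a = h (Sum.map id Sum.inr a) := by
    rintro (s | n) <;> rfl
  constructor
  · intro H
    constructor
    · intro a b hab
      rw [hl, hl]
      refine H _ _ ?_
      rw [glueIncl_left, glueIncl_left]
      exact (glue_adj _ _ _ _).2 (Or.inl ((adj_map_apply evenMap_injective _ _ _).2 hab))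
    · intro a b hab
      rw [hr, hr]
      refine H _ _ ?_
      rw [glueIncl_right, glueIncl_right]
      exact (glue_adj _ _ _ _).2 (Or.inr ((adj_map_apply oddMap_injective _ _ _).2 hab))
  · rintro ⟨H1, H2⟩ a b hab
    have hinj := glueIncl_injective S F G
    rcases (glue_adj _ _ _ _).1 hab with e | e
    · obtain ⟨x, y, e, hx, hy⟩ := (adj_map evenMap_injective _ _ _).1 e
      obtain ⟨a', rfl⟩ := exists_incl_eq hF e.mem_support_left
      obtain ⟨b', rfl⟩ := exists_incl_eq hF e.mem_support_right
      rw [← glueIncl_left S F G] at hx hy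
      rw [← hinj hx, ← hinj hy, ← hl, ← hl]
      exact H1 _ _ e
    · obtain ⟨x, y, e, hx, hy⟩ := (adj_map oddMap_injective _ _ _).1 e
      obtain ⟨a', rfl⟩ := exists_incl_eq hG e.mem_support_left
      obtain ⟨b', rfl⟩ := exists_incl_eq hG e.mem_support_right
      rw [← glueIncl_right S F G] at hx hy
      rw [← hinj hx, ← hinj hy, ← hr, ← hr]
      exact H2 _ _ e

/-- Once the images of the labels are fixed, a homomorphism from FG is a pair of independent
extensions to `F` and `G`. The density is thus an inner product of extension counts. -/
theorem homDensity_glue_mul_pow [Fintype κ] [Nonempty κ] [DecidableEq L] (R : κ → κ → Prop)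
    {S : Finset L} {F G : RawGraph L}
    (hF : ∀ l, Sum.inl l ∈ F.1.support → l ∈ S) (hG : ∀ l, Sum.inl l ∈ G.1.support → l ∈ S) :
    (F.glue G).homDensity R *
      (Nat.card κ : ℝ) ^ (Nat.card S + (Nat.card F.FreeVertex + Nat.card G.FreeVertex)) =
    ∑ x : S → κ, (extCount R S F x : ℝ) * extCount R S G x := by
  classical
  have hcov : (F.glue G).1.support ⊆ Set.range (glueIncl S F G) := by
    rintro z ⟨w, hz⟩
    rcases (glue_adj _ _ _ _).1 hz with e | e
    · obtain ⟨x, y, e', rfl, rfl⟩ := (adj_map evenMap_injective _ _ _).1 e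
      obtain ⟨a', rfl⟩ := exists_incl_eq hF e'.mem_support_left
      exact ⟨_, glueIncl_left S F G a'⟩
    · obtain ⟨x, y, e', rfl, rfl⟩ := (adj_map oddMap_injective _ _ _).1 e
      obtain ⟨a', rfl⟩ := exists_incl_eq hG e'.mem_support_left
      exact ⟨_, glueIncl_right S F G a'⟩
  rw [← Nat.card_sum, ← Nat.card_sum,
    homDensity_mul_pow R (F.glue G) (glueIncl_injective S F G) hcov]
  let e : {h : S ⊕ (F.FreeVertex ⊕ G.FreeVertex) → κ //
      ∀ a b, (F.glue G).1.Adj (glueIncl S F G a) (glueIncl S F G b) → R (h a) (h b)} ≃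
      Σ x : S → κ, {g : F.FreeVertex → κ // IsExt R S F x g} ×
        {g : G.FreeVertex → κ // IsExt R S G x g} :=
    { toFun := fun h => ⟨fun s => h.1 (Sum.inl s), ⟨_, ((isExt_glue hF hG h.1).1 h.2).1⟩,
        ⟨_, ((isExt_glue hF hG h.1).1 h.2).2⟩⟩
      invFun := fun q => ⟨Sum.elim q.1 (Sum.elim q.2.1.1 q.2.2.1),
        (isExt_glue hF hG _).2 ⟨q.2.1.2, q.2.2.2⟩⟩
      left_inv := fun h => by
        refine Subtype.ext (funext ?_)
        rintro (s | n | n) <;> rfl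
      right_inv := fun q => rfl }
  rw [Nat.card_congr e, Nat.card_sigma]
  push_cast
  refine Finset.sum_congr rfl fun x _ => ?_
  rw [Nat.card_prod]
  push_cast
  rfl

theorem homDensity_mul_pow_unlabeled [Fintype κ] [Nonempty κ] (R : κ → κ → Prop)
    (F : RawGraph Empty) (x : (∅ : Finset Empty) → κ) :
    F.homDensity R * (Nat.card κ : ℝ) ^ Nat.card F.FreeVertex = extCount R ∅ F x := by
  classical
  have h := homDensity_glue_mul_pow R (S := ∅) (F := F) (G := empty Empty) (fun l => l.elim)
    (fun l => l.elim)
  have hT : (F.glue (empty Empty)).homDensity R = F.homDensity R := by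
    have hemp : (empty Empty).map (oddMap Empty) = empty Empty := map_empty _
    rw [glue_eq, hemp, union_empty, homDensity_map R F evenMap_injective]
  have hE : IsEmpty (empty Empty).FreeVertex := ⟨fun n => by
    obtain ⟨y, hy⟩ := n.2
    exact hy⟩
  have hc : extCount R ∅ (empty Empty) x = 1 := by
    rw [extCount, Nat.card_eq_one_iff_unique]
    refine ⟨⟨fun a b => Subtype.ext (funext fun n => hE.elim n)⟩, ⟨⟨fun n => hE.elim n, ?_⟩⟩⟩
    rintro a b ⟨⟩
  have hE2 : Nat.card (empty Empty).FreeVertex = 0 := Nat.card_of_isEmpty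
  rw [hT, hE2, Fintype.sum_subsingleton _ x, hc] at h
  simpa using h

theorem homDensity_glue_unlabeled [Fintype κ] [Nonempty κ] (R : κ → κ → Prop)
    (F G : RawGraph Empty) : (F.glue G).homDensity R = F.homDensity R * G.homDensity R := by
  classical
  let x : (∅ : Finset Empty) → κ := fun s => (Finset.notMem_empty _ s.2).elim
  have h := homDensity_glue_mul_pow R (S := ∅) (F := F) (G := G) (fun l => l.elim)
    (fun l => l.elim)
  have hκ : (Nat.card κ : ℝ) ≠ 0 := by exact_mod_cast Nat.card_pos.ne'
  rw [Fintype.sum_subsingleton _ x, ← homDensity_mul_pow_unlabeled R F x,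
    ← homDensity_mul_pow_unlabeled R G x] at h
  have hz : Nat.card (∅ : Finset Empty) = 0 := by simp
  rw [hz, zero_add, pow_add] at h
  have hk := pow_ne_zero (Nat.card F.FreeVertex) hκ
  have hk' := pow_ne_zero (Nat.card G.FreeVertex) hκ
  refine mul_right_cancel₀ (mul_ne_zero hk hk') ?_
  rw [h]; ring

/-- Cauchy-Schwarz for homomorphism densities, with its equality case. -/
theorem homDensity_glue_sq_le [Fintype κ] [Nonempty κ] (R : κ → κ → Prop)
    {S : Finset ℕ} {F G : RawGraph ℕ}
    (hF : ∀ l, Sum.inl l ∈ F.1.support → l ∈ S) (hG : ∀ l, Sum.inl l ∈ G.1.support → l ∈ S) :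
    (F.glue G).homDensity R ^ 2 ≤ (F.glue F).homDensity R * (G.glue G).homDensity R ∧
    ((F.glue G).homDensity R ^ 2 = (F.glue F).homDensity R * (G.glue G).homDensity R →
      ∀ x y, (extCount R S F x : ℝ) * extCount R S G y = extCount R S F y * extCount R S G x) := by
  have hκ : (0 : ℝ) < Nat.card κ := by exact_mod_cast Nat.card_pos
  have hFG := homDensity_glue_mul_pow R hF hG
  have hFF := homDensity_glue_mul_pow R hF hF
  have hGG := homDensity_glue_mul_pow R hG hG
  set q : ℝ := (Nat.card κ : ℝ)
  set s := Nat.card S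
  set a := Nat.card F.FreeVertex
  set b := Nat.card G.FreeVertex
  set f : (S → κ) → ℝ := fun x => extCount R S F x
  set g : (S → κ) → ℝ := fun x => extCount R S G x
  have hpow : q ^ (s + (a + b)) * q ^ (s + (a + b)) = q ^ (s + (a + a)) * q ^ (s + (b + b)) := by
    rw [← pow_add, ← pow_add]; congr 1; ring
  have hpos : 0 < q ^ (s + (a + b)) * q ^ (s + (a + b)) := by positivity
  have e1 : (F.glue G).homDensity R ^ 2 * (q ^ (s + (a + b)) * q ^ (s + (a + b))) =
      (∑ x, f x * g x) ^ 2 := by rw [← hFG]; ring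
  have e2 : (F.glue F).homDensity R * (G.glue G).homDensity R *
      (q ^ (s + (a + b)) * q ^ (s + (a + b))) = (∑ x, f x ^ 2) * ∑ x, g x ^ 2 := by
    simp only [sq]
    rw [hpow, ← hFF, ← hGG]; ring
  constructor
  · refine le_of_mul_le_mul_right ?_ hpos
    rw [e1, e2]
    exact Finset.sum_mul_sq_le_sq_mul_sq _ _ _
  · intro h x y
    rw [h, e2] at e1
    set A := ∑ x, f x ^ 2 with hA
    set B := ∑ x, g x ^ 2 with hB
    set D := ∑ x, f x * g x with hD
    change f x * g y = f y * g x
    -- The sum expands to B(AB - D²), which vanishes in the equality case. Thus B · f = D · g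
    -- pointwise.
    have hz : ∑ x, (B * f x - D * g x) ^ 2 = 0 := by
      have : ∀ x, (B * f x - D * g x) ^ 2 = B ^ 2 * f x ^ 2 - 2 * B * D * (f x * g x) +
          D ^ 2 * g x ^ 2 := fun x => by ring
      simp only [this, Finset.sum_add_distrib, Finset.sum_sub_distrib, ← Finset.mul_sum]
      rw [← hA, ← hB, ← hD]
      linear_combination B * e1
    have hz' := fun x => pow_eq_zero_iff (two_ne_zero) |>.1
      ((Finset.sum_eq_zero_iff_of_nonneg fun x _ => sq_nonneg _).1 hz x (Finset.mem_univ x))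
    by_cases hB0 : B = 0
    · have hg := fun x => pow_eq_zero_iff (two_ne_zero) |>.1
        ((Finset.sum_eq_zero_iff_of_nonneg fun x _ => sq_nonneg (g x)).1 hB0 x (Finset.mem_univ x))
      rw [hg x, hg y]; ring
    · refine mul_left_cancel₀ hB0 ?_
      linear_combination g y * hz' x - g x * hz' y

end RawGraph

end GraphSOS

/-! ### Extension counts determine reduced graphs -/

namespace GraphSOS

theorem card_filter_subset_eq_sum {A γ : Type*} [DecidableEq γ] (s : Finset A) (f : A → Finset γ)
    (T : Finset γ) : (s.filter fun a => f a ⊆ T).card =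
      (∑ T' ∈ T.ssubsets, (s.filter fun a => f a = T').card) +
        (s.filter fun a => f a = T).card := by
  classical
  have h1 : (s.filter fun a => f a ⊆ T) =
      (s.filter fun a => f a ∈ T.ssubsets) ∪ s.filter fun a => f a = T := by
    ext a
    have : f a ⊆ T ↔ f a ⊂ T ∨ f a = T := le_iff_lt_or_eq
    simp only [Finset.mem_filter, Finset.mem_union, Finset.mem_ssubsets, this]
    tauto
  rw [h1, Finset.card_union_of_disjoint]
  · congr 1
    rw [Finset.card_eq_sum_card_fiberwise (f := f) (t := T.ssubsets)]
    · refine Finset.sum_congr rfl fun T' hT' => ?_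
      congr 1
      ext a
      simp only [Finset.mem_filter]
      constructor
      · rintro ⟨⟨h1, -⟩, h2⟩; exact ⟨h1, h2⟩
      · rintro ⟨h1, rfl⟩; exact ⟨⟨h1, hT'⟩, rfl⟩
    · intro a ha
      exact (Finset.mem_filter.1 (Finset.mem_coe.1 ha)).2
  · rw [Finset.disjoint_filter]
    rintro a - h2 rfl
    exact (Finset.mem_ssubsets.1 h2).ne rfl

/-- Möbius inversion over subsets, carried out as strong induction on `T`. -/
theorem card_filter_eq_of_card_filter_subset {A B γ : Type*} [DecidableEq γ]
    (s : Finset A) (t : Finset B) (f : A → Finset γ) (g : B → Finset γ)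
    (h : ∀ T, (s.filter fun a => f a ⊆ T).card = (t.filter fun b => g b ⊆ T).card) (T : Finset γ) :
    (s.filter fun a => f a = T).card = (t.filter fun b => g b = T).card := by
  induction T using Finset.strongInduction with
  | H T ih =>
    have h1 := h T
    have h2 := Finset.sum_congr rfl fun T' hT' => ih T' (Finset.mem_ssubsets.1 hT')
    have e1 := card_filter_subset_eq_sum s f T
    have e2 := card_filter_subset_eq_sum t g T
    omega

namespace RawGraph

variable {L : Type}

/-- Every component contains a label. -/
def Reduced (G : RawGraph L) : Prop :=
  ∀ x ∈ G.1.support, ∃ l, Sum.inl l ∈ G.1.support ∧ G.1.Reachable (Sum.inl l) x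

/-- The graph `P` with only the unlabeled vertices in `T` allowed, together with a disjoint loop. -/
def target (P : RawGraph L) (S : Finset L) (T : Finset P.FreeVertex) :
    Option (S ⊕ P.FreeVertex) → Option (S ⊕ P.FreeVertex) → Prop
  | none, none => True
  | some v, some w => P.1.Adj (incl S P v) (incl S P w) ∧ (∀ c, v = Sum.inr c → c ∈ T) ∧
      ∀ c, w = Sum.inr c → c ∈ T
  | none, some _ => False
  | some _, none => False

theorem incl_injective (S : Finset L) (G : RawGraph L) : Function.Injective (incl S G) :=
  Subtype.val_injective.sumMap Subtype.val_injective

/-- The added loop is a component of the target by itself. When all labels are sent there, every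
component of a reduced graph must follow, so the extension is unique; this normalizes the counts. -/
theorem extCount_none {P G : RawGraph L} {S : Finset L} {T : Finset P.FreeVertex}
    (hS : ∀ l, Sum.inl l ∈ G.1.support → l ∈ S) (hG : G.Reduced) :
    extCount (target P S T) S G (fun _ => none) = 1 := by
  rw [extCount, Nat.card_eq_one_iff_exists]
  refine ⟨⟨fun _ => none, ?_⟩, ?_⟩
  · intro a b _
    have : ∀ a : S ⊕ G.FreeVertex, Sum.elim (fun _ => none) (fun _ => none) a =
        (none : Option (S ⊕ P.FreeVertex)) := by rintro (s | n) <;> rfl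
    rw [this, this]
    trivial
  · rintro ⟨g, hg⟩
    refine Subtype.ext (funext fun n => ?_)
    obtain ⟨l, hl, ⟨w⟩⟩ := hG _ n.2
    have key : ∀ {u v : L ⊕ ℕ} (_ : G.1.Walk u v) (a b : S ⊕ G.FreeVertex), incl S G a = u →
        incl S G b = v → Sum.elim (fun _ => none) g a = none → Sum.elim (fun _ => none) g b = none := by
      intro u v w
      induction w with
      | nil =>
        rintro a b rfl hb ha
        rwa [incl_injective S G hb]
      | cons e w ih =>
        rintro a b rfl hb ha
        obtain ⟨a', rfl⟩ := exists_incl_eq hS e.mem_support_right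
        refine ih a' b rfl hb ?_
        have := hg a a' e
        rw [ha] at this
        match h : Sum.elim (fun _ => none) g a' with
        | none => rfl
        | some v => rw [h] at this; exact this.elim
    exact key w (Sum.inl ⟨l, hS l hl⟩) (Sum.inr n) rfl rfl rfl

/-- The unlabeled vertices in the image of `g`. -/
noncomputable def freeRange {P G : RawGraph L} {S : Finset L}
    (g : G.FreeVertex → Option (S ⊕ P.FreeVertex)) : Finset P.FreeVertex := by
  classical
  exact Finset.univ.filter fun c => ∃ n, g n = some (Sum.inr c)

theorem mem_freeRange {P G : RawGraph L} {S : Finset L}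
    {g : G.FreeVertex → Option (S ⊕ P.FreeVertex)} {c : P.FreeVertex} :
    c ∈ freeRange g ↔ ∃ n, g n = some (Sum.inr c) := by
  simp [freeRange]

/-- Each unlabeled vertex lies on an edge, so restricting the edges of the target to `T` restricts
the unlabeled vertices that can be hit. -/
theorem isExt_target_iff {P G : RawGraph L} {S : Finset L} {T : Finset P.FreeVertex}
    (hS : ∀ l, Sum.inl l ∈ G.1.support → l ∈ S) (g : G.FreeVertex → Option (S ⊕ P.FreeVertex)) :
    IsExt (target P S T) S G (fun s => some (Sum.inl s)) g ↔
      IsExt (target P S Finset.univ) S G (fun s => some (Sum.inl s)) g ∧ freeRange g ⊆ T := by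
  have hok : freeRange g ⊆ T → ∀ (a : S ⊕ G.FreeVertex) v,
      Sum.elim (fun s => some (Sum.inl s)) g a = some v → ∀ c, v = Sum.inr c → c ∈ T := by
    rintro hT (s | n) v h c rfl
    · simp at h
    · exact hT (mem_freeRange.2 ⟨n, h⟩)
  constructor
  · intro h
    constructor
    · intro a b hab
      have := h a b hab
      revert this
      generalize Sum.elim (fun s => some (Sum.inl s)) g a = u
      generalize Sum.elim (fun s => some (Sum.inl s)) g b = v
      rcases u with _ | u <;> rcases v with _ | v <;> simp +contextual [target]
    · intro c hc
      obtain ⟨n, hn⟩ := mem_freeRange.1 hc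
      obtain ⟨y, hy⟩ := n.2
      have hy' : G.1.Adj (incl S G (Sum.inr n)) y := hy
      obtain ⟨b, rfl⟩ := exists_incl_eq hS hy'.mem_support_right
      have := h _ _ hy'
      rw [Sum.elim_inr, hn] at this
      revert this
      generalize Sum.elim (fun s => some (Sum.inl s)) g b = v
      rcases v with _ | v
      · exact fun h => h.elim
      · exact fun h => h.2.1 c rfl
  · rintro ⟨h, hT⟩ a b hab
    have := h a b hab
    have ha := hok hT a
    have hb := hok hT b
    revert this ha hb
    generalize Sum.elim (fun s => some (Sum.inl s)) g a = u
    generalize Sum.elim (fun s => some (Sum.inl s)) g b = v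
    rcases u with _ | u <;> rcases v with _ | v <;> intro h1 h2 h3
    · trivial
    · exact h1.elim
    · exact h1.elim
    · exact ⟨h1.1, h2 u rfl, h3 v rfl⟩

/-- Inversion over `T` shows that `F` and `G` have equally many extensions into `F` that hit all
unlabeled vertices of `F`. For `F` the identity is one, so `G` has one too. -/
theorem exists_isExt_of_extCount_eq {F G : RawGraph L} {S : Finset L}
    (hF : ∀ l, Sum.inl l ∈ F.1.support → l ∈ S) (hG : ∀ l, Sum.inl l ∈ G.1.support → l ∈ S)
    (h : ∀ T, extCount (target F S T) S F (fun s => some (Sum.inl s)) =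
      extCount (target F S T) S G (fun s => some (Sum.inl s))) :
    ∃ g : G.FreeVertex → Option (S ⊕ F.FreeVertex),
      IsExt (target F S Finset.univ) S G (fun s => some (Sum.inl s)) g ∧
      ∀ c, ∃ n, g n = some (Sum.inr c) := by
  classical
  let A := fun G : RawGraph L => Finset.univ.filter
    fun g : G.FreeVertex → Option (S ⊕ F.FreeVertex) =>
      IsExt (target F S Finset.univ) S G (fun s => some (Sum.inl s)) g
  have hcard : ∀ (G : RawGraph L) (_ : ∀ l, Sum.inl l ∈ G.1.support → l ∈ S) T,
      extCount (target F S T) S G (fun s => some (Sum.inl s)) =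
      ((A G).filter fun g => freeRange g ⊆ T).card := by
    intro G hG T
    rw [extCount, Nat.card_eq_fintype_card, Fintype.card_subtype]
    congr 1
    ext g
    simp only [A, Finset.mem_filter, Finset.mem_univ, true_and, isExt_target_iff (T := T) hG]
  have key := card_filter_eq_of_card_filter_subset (A F) (A G) freeRange freeRange
    (fun T => by rw [← hcard F hF T, ← hcard G hG T]; exact h T) Finset.univ
  have hpos : 0 < ((A F).filter fun g => freeRange g = Finset.univ).card := by
    refine Finset.card_pos.2 ⟨fun n => some (Sum.inr n), ?_⟩
    simp only [A, Finset.mem_filter, Finset.mem_univ, true_and]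
    constructor
    · intro a b hab
      have : ∀ a : S ⊕ F.FreeVertex, Sum.elim (fun s => some (Sum.inl s))
          (fun n => some (Sum.inr n)) a = some a := by rintro (s | n) <;> rfl
      rw [this, this]
      exact ⟨hab, by simp, by simp⟩
    · ext c
      simp [mem_freeRange]
  rw [key] at hpos
  obtain ⟨g, hg⟩ := Finset.card_pos.1 hpos
  simp only [A, Finset.mem_filter, Finset.mem_univ, true_and] at hg
  refine ⟨g, hg.1, fun c => ?_⟩
  rw [← mem_freeRange, hg.2]
  exact Finset.mem_univ c

/-- With equally many unlabeled vertices on both sides, a homomorphism that fixes the labels and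
hits every unlabeled vertex is a bijection between them, so it embeds `G` in `F`. -/
theorem exists_rename_le_of_isExt {F G : RawGraph L} {S : Finset L}
    (hG : ∀ l, Sum.inl l ∈ G.1.support → l ∈ S)
    {g : G.FreeVertex → Option (S ⊕ F.FreeVertex)}
    (hg : IsExt (target F S Finset.univ) S G (fun s => some (Sum.inl s)) g)
    (hs : ∀ c, ∃ n, g n = some (Sum.inr c))
    (hcard : Fintype.card F.FreeVertex = Fintype.card G.FreeVertex) :
    ∃ σ : Equiv.Perm ℕ, (G.rename σ).1 ≤ F.1 := by
  choose n hn using hs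
  have hinj : Function.Injective n := by
    intro c c' h
    have := hn c
    rw [h, hn c'] at this
    simpa using this.symm
  obtain ⟨ρ, hρ⟩ : ∃ ρ : G.FreeVertex ≃ F.FreeVertex, ∀ m, g m = some (Sum.inr (ρ m)) := by
    let e := Equiv.ofBijective n ((Fintype.bijective_iff_injective_and_card n).2 ⟨hinj, hcard⟩)
    refine ⟨e.symm, fun m => ?_⟩
    rw [← hn]
    exact congrArg g (e.apply_symm_apply m).symm
  obtain ⟨σ, hσ⟩ := Equiv.Perm.exists_extending_pair (fun m : G.FreeVertex => (m : ℕ))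
    (fun m => (ρ m : ℕ)) Subtype.val_injective (Subtype.val_injective.comp ρ.injective)
  refine ⟨σ, ?_⟩
  intro x y hxy
  obtain ⟨x, y, e, rfl, rfl⟩ :=
    (adj_map (Function.injective_id.sumMap σ.injective) _ _ _).1 hxy
  obtain ⟨a, rfl⟩ := exists_incl_eq hG e.mem_support_left
  obtain ⟨b, rfl⟩ := exists_incl_eq hG e.mem_support_right
  have hval : ∀ a : S ⊕ G.FreeVertex, Sum.elim (fun s => some (Sum.inl s)) g a =
      some (Sum.map id ρ a) := by
    rintro (s | m)
    · rfl
    · exact hρ m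
  have hinc : ∀ a : S ⊕ G.FreeVertex, Sum.map id σ (incl S G a) = incl S F (Sum.map id ρ a) := by
    rintro (s | m)
    · rfl
    · exact congrArg Sum.inr (hσ m)
  have := hg a b e
  rw [hval, hval] at this
  rw [hinc, hinc]
  exact this.1

theorem card_le_of_isExt {F G : RawGraph L} {S : Finset L}
    {g : G.FreeVertex → Option (S ⊕ F.FreeVertex)}
    (hs : ∀ c, ∃ n, g n = some (Sum.inr c)) :
    Fintype.card F.FreeVertex ≤ Fintype.card G.FreeVertex := by
  choose n hn using hs
  refine Fintype.card_le_of_injective n fun c c' h => ?_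
  have := hn c
  rw [h, hn c'] at this
  simpa using this.symm

/-- Extension counts determine a graph up to isomorphism. -/
theorem equiv_of_extCount_eq {F G : RawGraph L} {S : Finset L}
    (hF : ∀ l, Sum.inl l ∈ F.1.support → l ∈ S) (hG : ∀ l, Sum.inl l ∈ G.1.support → l ∈ S)
    (h : ∀ T, extCount (target F S T) S F (fun s => some (Sum.inl s)) =
      extCount (target F S T) S G (fun s => some (Sum.inl s)))
    (h' : ∀ T, extCount (target G S T) S G (fun s => some (Sum.inl s)) =
      extCount (target G S T) S F (fun s => some (Sum.inl s))) :
    PLGraph.mk F = PLGraph.mk G := by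
  obtain ⟨g, hg, hgs⟩ := exists_isExt_of_extCount_eq hF hG h
  obtain ⟨f, hf, hfs⟩ := exists_isExt_of_extCount_eq hG hF h'
  have hc := le_antisymm (card_le_of_isExt hgs) (card_le_of_isExt hfs)
  obtain ⟨σ, hσ⟩ := exists_rename_le_of_isExt hG hg hgs hc
  obtain ⟨τ, hτ⟩ := exists_rename_le_of_isExt hF hf hfs hc.symm
  have h1 : (G.rename σ).edgeCount = G.edgeCount :=
    edgeCount_map' (Function.injective_id.sumMap σ.injective) G
  have h2 : (F.rename τ).edgeCount = F.edgeCount :=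
    edgeCount_map' (Function.injective_id.sumMap τ.injective) F
  have h3 := edgeCount_mono hτ
  have := eq_of_le_of_edgeCount_le hσ (by omega)
  exact (mk_eq_iff.2 ⟨σ, this⟩).symm

end RawGraph

/-- Homomorphism densities separate the reduced partially labeled graphs. -/
theorem RawGraph.exists_homDensity_lt {F G : RawGraph ℕ} {S : Finset ℕ}
    (hF : ∀ l, Sum.inl l ∈ F.1.support → l ∈ S) (hG : ∀ l, Sum.inl l ∈ G.1.support → l ∈ S)
    (hFr : F.Reduced) (hGr : G.Reduced) (hne : PLGraph.mk F ≠ PLGraph.mk G) :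
    ∃ (κ : Type) (_ : Fintype κ) (R : κ → κ → Prop) (k : κ), R k k ∧
      (F.glue G).homDensity R ^ 2 < (F.glue F).homDensity R * (G.glue G).homDensity R := by
  by_contra! hcon
  have key : ∀ (P : RawGraph ℕ) (T : Finset P.FreeVertex),
      extCount (target P S T) S F (fun s => some (Sum.inl s)) =
      extCount (target P S T) S G (fun s => some (Sum.inl s)) := by
    intro P T
    have h1 := homDensity_glue_sq_le (target P S T) hF hG
    -- Equality in Cauchy-Schwarz makes the two extension counts proportional. At the constant map
    -- to the loop both equal 1, so they also agree at the inclusion of the labels.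
    have h2 := h1.2 (le_antisymm h1.1 (hcon (Option (S ⊕ P.FreeVertex)) inferInstance (target P S T)
      none trivial)) (fun s => some (Sum.inl s)) (fun _ => none)
    rw [extCount_none hF hFr, extCount_none hG hGr] at h2
    simpa using h2
  exact hne (equiv_of_extCount_eq hF hG (key F) fun T => (key G T).symm)

end GraphSOS

/-! ### Finiteness and splitting off unlabeled components -/

namespace GraphSOS

namespace RawGraph

variable {L : Type}

theorem ncard_support_le (G : RawGraph L) : G.1.support.ncard ≤ 2 * G.edgeCount := by
  classical
  have hfin := G.2
  have hsub : G.1.support ⊆ ((hfin.toFinset.biUnion Sym2.toFinset : Finset (L ⊕ ℕ)) : Set (L ⊕ ℕ)) := by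
    rintro x ⟨y, hxy⟩
    simp only [Finset.coe_biUnion, Set.mem_iUnion, Set.Finite.coe_toFinset]
    exact ⟨s(x, y), hxy, by simp⟩
  refine (Set.ncard_le_ncard hsub (Finset.finite_toSet _)).trans ?_
  rw [Set.ncard_coe_finset, edgeCount, Set.ncard_eq_toFinset_card _ hfin, mul_comm]
  refine Finset.card_biUnion_le_card_mul _ _ _ fun e _ => ?_
  induction e with
  | h a b =>
    rw [Sym2.toFinset_mk_eq]
    exact Finset.card_le_two

theorem finite_support_subset {A : Set (L ⊕ ℕ)} (hA : A.Finite) :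
    {G : RawGraph L | G.1.support ⊆ A}.Finite := by
  have hE : ((fun q : (L ⊕ ℕ) × (L ⊕ ℕ) => s(q.1, q.2)) '' A ×ˢ A).Finite := (hA.prod hA).image _
  refine Set.Finite.of_finite_image (f := fun D : RawGraph L => D.1.edgeSet)
    (hE.finite_subsets.subset ?_) ?_
  · rintro _ ⟨D, hD, rfl⟩ e he
    induction e with
    | h a b =>
      have he' : D.1.Adj a b := he
      exact ⟨(a, b), ⟨hD he'.mem_support_left, hD he'.mem_support_right⟩, rfl⟩
  · intro D _ D' _ h; exact Subtype.ext (SimpleGraph.edgeSet_injective h)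

theorem exists_perm_lt (s : Set ℕ) (hs : s.Finite) {n : ℕ} (hn : s.ncard ≤ n) :
    ∃ σ : Equiv.Perm ℕ, ∀ k ∈ s, σ k < n := by
  have : Fintype s := hs.fintype
  have hc : Fintype.card s ≤ n := by
    rwa [← Nat.card_eq_fintype_card, Nat.card_coe_set_eq]
  obtain ⟨σ, hσ⟩ := Equiv.Perm.exists_extending_pair (fun k : s => (k : ℕ))
    (fun k => ((Fintype.equivFin s k : Fin _) : ℕ)) Subtype.val_injective
    (Fin.val_injective.comp (Fintype.equivFin s).injective)
  refine ⟨σ, fun k hk => ?_⟩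
  rw [show σ k = _ from hσ ⟨k, hk⟩]
  exact (Fin.is_lt _).trans_le hc

/-- Every partially labeled graph is a product of a reduced one and an unlabeled one. -/
theorem exists_reduced (F : RawGraph ℕ) : ∃ (R : RawGraph ℕ) (U : UGraph), R.Reduced ∧
    R.1 ≤ F.1 ∧ PLGraph.mk F = PLGraph.mk R * PLGraph.ofUnlabeled U := by
  let lab : ℕ ⊕ ℕ → Prop := fun x => ∃ l, Sum.inl l ∈ F.1.support ∧ F.1.Reachable (Sum.inl l) x
  have hlab : ∀ x y, F.1.Adj x y → lab x → lab y := by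
    rintro x y e ⟨l, hl, h⟩
    exact ⟨l, hl, h.trans e.reachable⟩
  let R : RawGraph ℕ := ⟨⟨fun x y => F.1.Adj x y ∧ lab x,
    ⟨fun x y h => ⟨h.1.symm, hlab _ _ h.1 h.2⟩⟩, ⟨fun x h => h.1.ne rfl⟩⟩,
    F.2.subset (SimpleGraph.edgeSet_mono fun x y h => h.1)⟩
  let V : RawGraph ℕ := ⟨⟨fun x y => F.1.Adj x y ∧ ¬ lab x,
    ⟨fun x y h => ⟨h.1.symm, fun h' => h.2 (hlab _ _ h.1.symm h')⟩⟩, ⟨fun x h => h.1.ne rfl⟩⟩,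
    F.2.subset (SimpleGraph.edgeSet_mono fun x y h => h.1)⟩
  have hRF : R.1 ≤ F.1 := fun x y h => h.1
  have hF : F = R.union V := by
    refine Subtype.ext ?_
    ext x y
    rw [adj_union]
    change _ ↔ (F.1.Adj x y ∧ lab x) ∨ (F.1.Adj x y ∧ ¬ lab x)
    rw [← and_or_left, and_iff_left (em _)]
  have hRV : PLGraph.mk F = PLGraph.mk R * PLGraph.mk V := by
    conv_lhs => rw [hF]
    exact mk_union fun n ⟨y, hy⟩ ⟨z, hz⟩ => hz.2 hy.2
  refine ⟨R, (PLGraph.mk V).unlabel, ?_, hRF, ?_⟩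
  · rintro x ⟨y, hxy, l, hl, ⟨w⟩⟩
    have hsup : Sum.inl l ∈ R.1.support := by
      obtain ⟨z, hz⟩ := hl
      exact ⟨z, hz, l, ⟨z, hz⟩, SimpleGraph.Reachable.refl _⟩
    refine ⟨l, hsup, ?_⟩
    have key : ∀ {u v : ℕ ⊕ ℕ} (_ : F.1.Walk u v), lab u → R.1.Reachable u v := by
      intro u v w
      induction w with
      | nil => intro _; exact SimpleGraph.Reachable.refl _
      | @cons u u' _ e w ih =>
        intro hu
        have e' : R.1.Adj u u' := ⟨e, hu⟩
        exact e'.reachable.trans (ih (hlab _ _ e hu))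
    exact key w ⟨l, hl, SimpleGraph.Reachable.refl _⟩
  · rw [hRV]
    congr 1
    have ht := transportMap_injective (M := Empty) (Sum.inr_injective (α := Empty) (β := ℕ))
    have hφ := transportMap_injective (L := Empty) (M := ℕ) (g := Empty.elim)
      (Function.injective_of_subsingleton _)
    rw [PLGraph.unlabel_mk, PLGraph.ofUnlabeled, PLGraph.transport_mk, map_map]
    conv_lhs => rw [← map_id V]
    refine Quotient.sound (map_equiv Function.injective_id (hφ.comp ht) fun x hx m => ?_)
    constructor
    · rintro rfl
      obtain ⟨y, hy, hn⟩ := hx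
      exact (hn ⟨m, ⟨y, hy⟩, SimpleGraph.Reachable.refl _⟩).elim
    · intro h
      simp at h

end RawGraph

namespace PLGraph

open RawGraph

/-- Every component contains a label. -/
def Reduced (F : PLGraph ℕ) : Prop := ∃ G, mk G = F ∧ G.Reduced

theorem exists_reduced (F : PLGraph ℕ) : ∃ (R : PLGraph ℕ) (U : UGraph), R.Reduced ∧
    R.edgeCount ≤ F.edgeCount ∧ (∀ l, R.HasLabel l → F.HasLabel l) ∧ F = R * ofUnlabeled U := by
  obtain ⟨F, rfl⟩ := F.exists_rep
  obtain ⟨R, U, h1, h2, h3⟩ := F.exists_reduced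
  refine ⟨mk R, U, ⟨R, rfl, h1⟩, edgeCount_mono h2, fun l => ?_, h3⟩
  rw [hasLabel_mk, hasLabel_mk]
  exact fun h => SimpleGraph.support_mono h2 h

theorem unlabel_mul_ofUnlabeled_mul (R R' : PLGraph ℕ) (U U' : UGraph) :
    ((R * ofUnlabeled U) * (R' * ofUnlabeled U')).unlabel = (R * R').unlabel * (U * U') := by
  rw [mul_mul_mul_comm, ← ofUnlabeled_mul, unlabel_mul_ofUnlabeled]

/-- Graphs with at most `d` edges and labels below `n`. -/
def Bounded (d n : ℕ) (F : PLGraph ℕ) : Prop := F.edgeCount ≤ d ∧ ∀ l, F.HasLabel l → l < n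

/-- At most d edges cover at most 2d vertices, so the unlabeled ones can be renamed below 2d and the
graph drawn in a fixed finite pool. -/
theorem finite_bounded (d n : ℕ) : {F | Bounded d n F}.Finite := by
  let A : Set (ℕ ⊕ ℕ) := Sum.inl '' Set.Iio n ∪ Sum.inr '' Set.Iio (2 * d)
  have hA : A.Finite := ((Set.finite_Iio _).image _).union ((Set.finite_Iio _).image _)
  refine ((finite_support_subset hA).image mk).subset ?_
  rintro F ⟨hd, hn⟩
  obtain ⟨G, rfl⟩ := F.exists_rep
  have hfin : {k : ℕ | Sum.inr k ∈ G.1.support}.Finite :=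
    G.finite_support.preimage Sum.inr_injective.injOn
  have hcard : {k : ℕ | Sum.inr k ∈ G.1.support}.ncard ≤ 2 * d := by
    rw [← Set.ncard_image_of_injective _ (Sum.inr_injective (α := ℕ))]
    refine (Set.ncard_le_ncard ?_ G.finite_support).trans (G.ncard_support_le.trans ?_)
    · rintro _ ⟨k, hk, rfl⟩; exact hk
    · exact Nat.mul_le_mul_left 2 hd
  obtain ⟨σ, hσ⟩ := exists_perm_lt _ hfin hcard
  refine ⟨G.rename σ, ?_, (RawGraph.mk_eq_iff.2 ⟨σ, rfl⟩).symm⟩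
  change (G.rename σ).1.support ⊆ A
  rw [rename, RawGraph.support_map (Function.injective_id.sumMap σ.injective)]
  rintro _ ⟨l | k, hx, rfl⟩
  · exact Or.inl ⟨l, hn l ((hasLabel_mk G l).2 hx), rfl⟩
  · exact Or.inr ⟨σ k, hσ k hx, rfl⟩

theorem finite_hasLabel (F : PLGraph ℕ) : {l | F.HasLabel l}.Finite := by
  obtain ⟨G, rfl⟩ := F.exists_rep
  simp only [hasLabel_mk]
  exact G.finite_support.preimage Sum.inl_injective.injOn

theorem ncard_hasLabel_le (F : PLGraph ℕ) : {l | F.HasLabel l}.ncard ≤ 2 * F.edgeCount := by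
  obtain ⟨G, rfl⟩ := F.exists_rep
  simp only [hasLabel_mk]
  rw [← Set.ncard_image_of_injective _ (Sum.inl_injective (β := ℕ))]
  refine (Set.ncard_le_ncard ?_ G.finite_support).trans G.ncard_support_le
  rintro _ ⟨k, hk, rfl⟩; exact hk

end PLGraph

/-! ### Reduction to a bounded number of labels -/

open PLGraph

/-- Evaluation of graph combinations at a multiplicative function of graphs. -/
noncomputable def evalHom (χ : UGraph →* ℝ) : GraphCombination →ₐ[ℝ] ℝ :=
  MonoidAlgebra.lift ℝ ℝ UGraph χ

theorem evalHom_single (χ : UGraph →* ℝ) (H : UGraph) (r : ℝ) :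
    evalHom χ (MonoidAlgebra.single H r) = r * χ H := by
  simp [evalHom, MonoidAlgebra.lift_single]

theorem evalAt_eq (χ : UGraph →* ℝ) (a : GraphCombination) :
    evalAt (fun C => χ C.1) a = evalHom χ a := by
  rw [evalAt, evalHom, MonoidAlgebra.lift_apply]
  simp only [UGraph.eval_eq, smul_eq_mul]

/-- Evaluation of a labeled graph combination after unlabeling. -/
noncomputable def evalUnlabel (χ : UGraph →* ℝ) : LabeledCombination →ₗ[ℝ] ℝ :=
  (evalHom χ).toLinearMap ∘ₗ unlabel

theorem evalUnlabel_single (χ : UGraph →* ℝ) (F : PLGraph ℕ) (r : ℝ) :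
    evalUnlabel χ (MonoidAlgebra.single F r) = r * χ F.unlabel := by
  rw [evalUnlabel, LinearMap.comp_apply, AlgHom.toLinearMap_apply, unlabel,
    MonoidAlgebra.mapDomainLinearMap_single, evalHom_single]

theorem evalUnlabel_mul (χ : UGraph →* ℝ) (a b : LabeledCombination) :
    evalUnlabel χ (a * b) = ∑ F ∈ a.coeff.support, ∑ G ∈ b.coeff.support,
      a.coeff F * b.coeff G * χ (F * G).unlabel := by
  rw [MonoidAlgebra.mul_def, Finsupp.sum, map_sum]
  refine Finset.sum_congr rfl fun F _ => ?_
  rw [Finsupp.sum, map_sum]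
  refine Finset.sum_congr rfl fun G _ => ?_
  rw [evalUnlabel_single]

/-- Two linear operators given by maps of graphs preserve the bilinear form if the maps do. -/
theorem evalUnlabel_map_mul (χ : UGraph →* ℝ) {f g f' g' : PLGraph ℕ → PLGraph ℕ}
    (h : ∀ F G, (f F * g G).unlabel = (f' F * g' G).unlabel) (a b : LabeledCombination) :
    evalUnlabel χ (MonoidAlgebra.mapDomain f a * MonoidAlgebra.mapDomain g b) =
      evalUnlabel χ (MonoidAlgebra.mapDomain f' a * MonoidAlgebra.mapDomain g' b) := by
  induction a using MonoidAlgebra.induction_linear with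
  | zero => simp
  | add a a' ha ha' => simp only [MonoidAlgebra.mapDomain_add, add_mul, map_add, ha, ha']
  | single F r =>
    induction b using MonoidAlgebra.induction_linear with
    | zero => simp
    | add b b' hb hb' => simp only [MonoidAlgebra.mapDomain_add, mul_add, map_add, hb, hb']
    | single G s =>
      simp only [MonoidAlgebra.mapDomain_single, MonoidAlgebra.single_mul_single,
        evalUnlabel_single, h]

theorem mapDomain_id_eq (a : LabeledCombination) : MonoidAlgebra.mapDomain (fun F => F) a = a := by
  induction a using MonoidAlgebra.induction_linear with
  | zero => simp
  | add a b ha hb => rw [MonoidAlgebra.mapDomain_add, ha, hb]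
  | single F r => simp

/-- Forgetting the label `s`, as a linear operator. -/
noncomputable def forgetLin (s : ℕ) : Module.End ℝ LabeledCombination :=
  MonoidAlgebra.mapDomainLinearMap ℝ ℝ (forget s)

theorem forgetLin_eq (s : ℕ) (a : LabeledCombination) :
    forgetLin s a = MonoidAlgebra.mapDomain (forget s) a := rfl

theorem forgetLin_single (s : ℕ) (F : PLGraph ℕ) (r : ℝ) :
    forgetLin s (MonoidAlgebra.single F r) = MonoidAlgebra.single (forget s F) r := by
  rw [forgetLin_eq, MonoidAlgebra.mapDomain_single]

theorem linearMap_ext_single {f g : Module.End ℝ LabeledCombination}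
    (h : ∀ F r, f (MonoidAlgebra.single F r) = g (MonoidAlgebra.single F r)) : f = g := by
  refine LinearMap.ext fun a => ?_
  induction a using MonoidAlgebra.induction_linear with
  | zero => simp
  | add a b ha hb => rw [map_add, map_add, ha, hb]
  | single F r => exact h F r

theorem forgetLin_comm (s t : ℕ) : Commute (forgetLin s) (forgetLin t) :=
  linearMap_ext_single fun F r => by
    simp only [Module.End.mul_apply, forgetLin_single, forget_comm s t]

theorem forgetLin_idem (s : ℕ) (a : LabeledCombination) :
    forgetLin s (forgetLin s a) = forgetLin s a := by
  have : forgetLin s * forgetLin s = forgetLin s := linearMap_ext_single fun F r => by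
    simp only [Module.End.mul_apply, forgetLin_single, forget_forget]
  exact LinearMap.congr_fun this a

/-- Pythagoras for the form χ([[ab]]): the part with `s` forgotten is orthogonal to the remainder.
-/
theorem evalUnlabel_sq_eq_add (χ : UGraph →* ℝ) (s : ℕ) (a : LabeledCombination) :
    evalUnlabel χ (a * a) = evalUnlabel χ (forgetLin s a * forgetLin s a) +
      evalUnlabel χ ((a - forgetLin s a) * (a - forgetLin s a)) := by
  have h1 : evalUnlabel χ (forgetLin s a * forgetLin s a) = evalUnlabel χ (a * forgetLin s a) := by
    have := evalUnlabel_map_mul χ (f := forget s) (g := forget s) (f' := fun F => F)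
      (g' := forget s) (fun F G => unlabel_forget_mul s F G) a a
    rwa [mapDomain_id_eq] at this
  have h2 : (a - forgetLin s a) * (a - forgetLin s a) =
      a * a - a * forgetLin s a - a * forgetLin s a + forgetLin s a * forgetLin s a := by ring
  rw [h2, map_add, map_sub, map_sub, h1]
  ring

theorem support_forgetLin {P : PLGraph ℕ → Prop} {s : ℕ} {a : LabeledCombination}
    (h : ∀ F ∈ a.coeff.support, P (forget s F)) :
    ∀ F ∈ (forgetLin s a).coeff.support, P F := by
  classical
  intro F hF
  have hF' : F ∈ (Finsupp.mapDomain (forget s) a.coeff).support := hF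
  obtain ⟨G, hG, rfl⟩ := Finset.mem_image.1 (Finsupp.mapDomain_support hF')
  exact h G hG

/-- With E_s for forgetting `s`, the product of all 1 - E_s, s ∈ S, fixes `a`. It also kills every
graph that lacks a label of `S`, since such a graph is fixed by some E_s and the factors commute. -/
theorem eq_zero_of_forgetLin_eq_zero {S : Finset ℕ} {a : LabeledCombination}
    (ha : ∀ s ∈ S, forgetLin s a = 0)
    (hF : ∀ F ∈ a.coeff.support, ∃ s ∈ S, ¬ F.HasLabel s) : a = 0 := by
  let l := S.toList.map fun s => (1 - forgetLin s : Module.End ℝ LabeledCombination)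
  have hfix : l.prod a = a := by
    have : ∀ m : List ℕ, (∀ s ∈ m, s ∈ S) →
        (m.map fun s => (1 - forgetLin s : Module.End ℝ LabeledCombination)).prod a = a := by
      intro m
      induction m with
      | nil => intro _; rfl
      | cons s m ih =>
        intro hm
        rw [List.map_cons, List.prod_cons, Module.End.mul_apply,
          ih fun t ht => hm t (List.mem_cons_of_mem _ ht), LinearMap.sub_apply,
          ha s (hm s List.mem_cons_self), sub_zero, Module.End.one_apply]
    exact this _ fun s hs => Finset.mem_toList.1 hs
  have hzero : ∀ F ∈ a.coeff.support, ∀ r, l.prod (MonoidAlgebra.single F r) = 0 := by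
    intro F hFa r
    obtain ⟨s, hs, hFs⟩ := hF F hFa
    have : ∀ m : List ℕ, s ∈ m →
        (m.map fun s => (1 - forgetLin s : Module.End ℝ LabeledCombination)).prod
          (MonoidAlgebra.single F r) = 0 := by
      intro m
      induction m with
      | nil => intro h; cases h
      | cons t m ih =>
        intro hm
        rw [List.map_cons, List.prod_cons]
        rcases List.mem_cons.1 hm with rfl | hm
        · have hc : Commute (1 - forgetLin s)
              (m.map fun s => (1 - forgetLin s : Module.End ℝ LabeledCombination)).prod := by
            refine Commute.list_prod_right _ _ fun x hx => ?_
            obtain ⟨t, -, rfl⟩ := List.mem_map.1 hx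
            exact ((Commute.one_left _).sub_left
              ((Commute.one_right _).sub_right (forgetLin_comm s t)))
          rw [hc.eq, Module.End.mul_apply, LinearMap.sub_apply, Module.End.one_apply,
            forgetLin_single, forget_eq_self hFs, sub_self, map_zero]
        · rw [Module.End.mul_apply, ih hm, map_zero]
    exact this _ (Finset.mem_toList.2 hs)
  rw [← hfix, ← MonoidAlgebra.sum_coeff_single a, Finsupp.sum, map_sum]
  exact Finset.sum_eq_zero fun F hFa => hzero F hFa _

/-- Repeated orthogonal splitting leaves pieces annihilated by forgetting any of their labels. Such
a piece vanishes if it has more than 2d labels, because no graph with d edges can carry them all. -/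
theorem nonneg_of_bounded (χ : UGraph →* ℝ) (d : ℕ)
    (h : ∀ a : LabeledCombination, (∀ F ∈ a.coeff.support, Bounded d (2 * d) F) →
      0 ≤ evalUnlabel χ (a * a))
    (a : LabeledCombination) (ha : ∀ F ∈ a.coeff.support, F.edgeCount ≤ d) :
    0 ≤ evalUnlabel χ (a * a) := by
  classical
  -- `T` holds the labels still to be split along, and `S` those whose forgetting already
  -- annihilates `a`.
  have key : ∀ (T S : Finset ℕ) (a : LabeledCombination),
      (∀ F ∈ a.coeff.support, F.edgeCount ≤ d ∧ ∀ s, F.HasLabel s → s ∈ T ∪ S) →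
      (∀ s ∈ S, forgetLin s a = 0) → 0 ≤ evalUnlabel χ (a * a) := by
    intro T
    induction T using Finset.induction_on with
    | empty =>
      intro S a ha hS
      simp only [Finset.empty_union] at ha
      rcases le_or_gt S.card (2 * d) with hc | hc
      · obtain ⟨σ, hσ⟩ := RawGraph.exists_perm_lt (S : Set ℕ) S.finite_toSet (n := 2 * d)
          (by rwa [Set.ncard_coe_finset])
        have := evalUnlabel_map_mul χ (f := relabel σ) (g := relabel σ) (f' := fun F => F)
          (g' := fun F => F) (fun F G => unlabel_relabel_mul σ F G) a a
        rw [mapDomain_id_eq] at this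
        rw [← this]
        refine h _ fun F hF => ?_
        have hF' : F ∈ (Finsupp.mapDomain (relabel σ) a.coeff).support := hF
        obtain ⟨G, hG, rfl⟩ := Finset.mem_image.1 (Finsupp.mapDomain_support hF')
        refine ⟨(edgeCount_transport _ _ G).trans_le (ha G hG).1, fun l hl => ?_⟩
        rw [hasLabel_relabel] at hl
        simpa using hσ _ ((ha G hG).2 _ hl)
      · have : a = 0 := by
          refine eq_zero_of_forgetLin_eq_zero hS fun F hF => ?_
          by_contra! hcon
          have h1 := (Set.ncard_le_ncard (show (S : Set ℕ) ⊆ {l | F.HasLabel l} from hcon)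
            F.finite_hasLabel).trans F.ncard_hasLabel_le
          rw [Set.ncard_coe_finset] at h1
          have := (ha F hF).1
          omega
        simp [this]
    | insert t T ht ih =>
      intro S a ha hS
      rw [evalUnlabel_sq_eq_add χ t]
      have hE : ∀ F ∈ (forgetLin t a).coeff.support,
          F.edgeCount ≤ d ∧ ∀ s, F.HasLabel s → s ∈ T ∪ S := by
        refine support_forgetLin fun F hF => ⟨(edgeCount_transport _ _ F).trans_le (ha F hF).1,
          fun s hs => ?_⟩
        rw [hasLabel_forget] at hs
        have := (ha F hF).2 s hs.1
        simp only [Finset.mem_union, Finset.mem_insert] at this ⊢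
        tauto
      -- The forgotten part no longer carries `t`, while the remainder is annihilated by forgetting
      -- `t`. Commutation keeps both annihilated for the labels in `S`.
      refine add_nonneg (ih S _ hE fun s hs => ?_) (ih (insert t S) _ (fun F hF => ?_) fun s hs => ?_)
      · have := LinearMap.congr_fun (forgetLin_comm s t).eq a
        rw [Module.End.mul_apply, Module.End.mul_apply, hS s hs, map_zero] at this
        exact this
      · have hF' : F ∈ (a.coeff - (forgetLin t a).coeff).support := hF
        rcases Finset.mem_union.1 (Finsupp.support_sub hF') with h1 | h1
        · refine ⟨(ha F h1).1, fun s hs => ?_⟩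
          have := (ha F h1).2 s hs
          simp only [Finset.mem_union, Finset.mem_insert] at this ⊢
          tauto
        · refine ⟨(hE F h1).1, fun s hs => ?_⟩
          have := (hE F h1).2 s hs
          simp only [Finset.mem_union, Finset.mem_insert] at this ⊢
          tauto
      · rcases Finset.mem_insert.1 hs with rfl | hs
        · rw [map_sub, forgetLin_idem, sub_self]
        · have := LinearMap.congr_fun (forgetLin_comm s t).eq a
          rw [Module.End.mul_apply, Module.End.mul_apply, hS s hs, map_zero] at this
          rw [map_sub, hS s hs, this, sub_zero]
  refine key (a.coeff.support.biUnion fun F => F.finite_hasLabel.toFinset) ∅ a (fun F hF =>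
    ⟨ha F hF, fun s hs => ?_⟩) (by simp)
  simp only [Finset.union_empty, Finset.mem_biUnion, Set.Finite.mem_toFinset]
  exact ⟨F, hF, hs⟩

/-! ### Diagonally dominant forms -/

/-- Collecting the coefficients over the fibers of `r` gives a form in |t| variables. It is at least
Σ C_j² - (Σ |C_j|)² / |t|, which is nonnegative by Cauchy-Schwarz. The map `r` is needed because
many graphs share a reduced part. -/
theorem sum_mul_nonneg_of_dominant {I J : Type*} (s : Finset I) (c : I → ℝ) (r : I → J)
    (t : Finset J) (hr : ∀ i ∈ s, r i ∈ t) (N : J → J → ℝ) (hdiag : ∀ j, N j j = 1)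
    (hoff : ∀ j ∈ t, ∀ k ∈ t, j ≠ k → |N j k| ≤ (t.card : ℝ)⁻¹) :
    0 ≤ ∑ i ∈ s, ∑ i' ∈ s, c i * c i' * N (r i) (r i') := by
  classical
  let C : J → ℝ := fun j => ∑ i ∈ s with r i = j, c i
  have h1 : ∑ i ∈ s, ∑ i' ∈ s, c i * c i' * N (r i) (r i') = ∑ j ∈ t, ∑ k ∈ t, C j * C k * N j k := by
    rw [← Finset.sum_fiberwise_of_maps_to hr]
    refine Finset.sum_congr rfl fun j _ => ?_
    have : ∀ i ∈ s.filter (fun i => r i = j), ∑ i' ∈ s, c i * c i' * N (r i) (r i') =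
        ∑ k ∈ t, c i * (C k * N j k) := by
      intro i hi
      rw [← Finset.sum_fiberwise_of_maps_to hr]
      refine Finset.sum_congr rfl fun k _ => ?_
      rw [Finset.sum_mul, Finset.mul_sum]
      refine Finset.sum_congr rfl fun i' hi' => ?_
      rw [(Finset.mem_filter.1 hi).2, (Finset.mem_filter.1 hi').2, mul_assoc]
    rw [Finset.sum_congr rfl this, Finset.sum_comm]
    refine Finset.sum_congr rfl fun k _ => ?_
    rw [← Finset.sum_mul, mul_assoc]
  rw [h1]
  have h2 : ∀ j ∈ t, ∀ k ∈ t, (if j = k then C j ^ 2 else 0) - (t.card : ℝ)⁻¹ * (|C j| * |C k|) ≤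
      C j * C k * N j k := by
    intro j hj k hk
    split_ifs with hjk
    · subst hjk
      rw [hdiag]
      have : 0 ≤ (t.card : ℝ)⁻¹ * (|C j| * |C j|) := by positivity
      nlinarith
    · have h3 := hoff j hj k hk hjk
      have h4 : |C j * C k * N j k| ≤ (t.card : ℝ)⁻¹ * (|C j| * |C k|) := by
        rw [abs_mul, abs_mul, mul_comm]
        exact mul_le_mul_of_nonneg_right h3 (by positivity)
      linarith [neg_abs_le (C j * C k * N j k)]
  refine le_trans ?_ (Finset.sum_le_sum fun j hj => Finset.sum_le_sum fun k hk => h2 j hj k hk)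
  simp only [Finset.sum_sub_distrib]
  have h3 : ∑ j ∈ t, ∑ k ∈ t, (if j = k then C j ^ 2 else 0) = ∑ j ∈ t, |C j| ^ 2 := by
    refine Finset.sum_congr rfl fun j hj => ?_
    rw [Finset.sum_ite_eq, if_pos hj, sq_abs]
  have h4 : ∑ j ∈ t, ∑ k ∈ t, (t.card : ℝ)⁻¹ * (|C j| * |C k|) =
      (t.card : ℝ)⁻¹ * (∑ j ∈ t, |C j|) ^ 2 := by
    rw [sq, Finset.sum_mul_sum, Finset.mul_sum]
    simp only [Finset.mul_sum]
  rw [h3, h4, sub_nonneg]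
  have h5 := sq_sum_le_card_mul_sum_sq (s := t) (f := fun j => |C j|)
  rcases t.eq_empty_or_nonempty with rfl | ht
  · simp
  · have hpos : (0 : ℝ) < t.card := by exact_mod_cast ht.card_pos
    rw [inv_mul_le_iff₀ hpos]
    exact h5

end GraphSOS

namespace GraphSOS

open PLGraph Filter Topology

/-! ### Additive weights -/

/-- Additivity of a weight over disjoint unions. -/
def IsAdditive (W : UGraph → ℝ) : Prop := ∀ A B, W (A * B) = W A + W B

/-- Midpoint concavity of a weight for gluing products, as a nonnegative quantity. -/
noncomputable def midGap (W : UGraph → ℝ) (F G : PLGraph ℕ) : ℝ :=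
  2 * W (F * G).unlabel - W (F * F).unlabel - W (G * G).unlabel

theorem midGap_add_mul (W W' : UGraph → ℝ) (ε : ℝ) (F G : PLGraph ℕ) :
    midGap (fun H => W H + ε * W' H) F G = midGap W F G + ε * midGap W' F G := by
  simp only [midGap]; ring

theorem IsAdditive.add_mul {W W' : UGraph → ℝ} (h : IsAdditive W) (h' : IsAdditive W') (ε : ℝ) :
    IsAdditive fun H => W H + ε * W' H := by
  intro A B
  simp only [h A B, h' A B]; ring

theorem IsAdditive.map_one {W : UGraph → ℝ} (h : IsAdditive W) : W 1 = 0 := by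
  have := h 1 1
  rw [mul_one] at this
  linarith

theorem midGap_degWeight_nonneg (p : ℕ) (F G : PLGraph ℕ) :
    0 ≤ midGap (UGraph.degWeight (kink p) (kink_zero p)) F G := by
  obtain ⟨F, rfl⟩ := F.exists_rep
  obtain ⟨G, rfl⟩ := G.exists_rep
  have := (RawGraph.degWeight_glue_le p F G).1
  simp only [midGap, mk_mul_mk, UGraph.degWeight_unlabel_mk]
  linarith

theorem midGap_multiplicity_nonneg {p : ℕ} {C : ConnGraph}
    (hsq : ∀ F : PLGraph ℕ, (F * F).unlabel = C.1 → F.FullyLabeled)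
    (hdeg : ∀ D : RawGraph ℕ, (PLGraph.mk D).unlabel = C.1 → D.DegreesNear p) (F G : PLGraph ℕ)
    (h : midGap (UGraph.degWeight (kink p) (kink_zero p)) F G = 0) :
    0 ≤ midGap (fun H => (UGraph.multiplicity C H : ℝ)) F G := by
  obtain ⟨F, rfl⟩ := F.exists_rep
  obtain ⟨G, rfl⟩ := G.exists_rep
  simp only [midGap, mk_mul_mk, UGraph.degWeight_unlabel_mk] at h
  have := RawGraph.multiplicity_glue_le hsq hdeg F G (by linarith)
  simp only [midGap, mk_mul_mk]
  have : ((UGraph.multiplicity C (PLGraph.mk (F.glue F)).unlabel +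
      UGraph.multiplicity C (PLGraph.mk (G.glue G)).unlabel : ℕ) : ℝ) ≤
      (2 * UGraph.multiplicity C (PLGraph.mk (F.glue G)).unlabel : ℕ) := by exact_mod_cast this
  push_cast at this
  linarith

/-- The logarithm of the density of homomorphisms to a relation with a loop. -/
noncomputable def UGraph.negLogHom {κ : Type} [Fintype κ] [Nonempty κ] (R : κ → κ → Prop)
    (H : UGraph) : ℝ :=
  Quotient.lift (fun G : RawGraph Empty => -Real.log (G.homDensity R)) (by
    rintro G _ ⟨σ, rfl⟩
    exact congrArg (fun x => -Real.log x)
      (RawGraph.homDensity_map R G (Function.injective_id.sumMap σ.injective)).symm) H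

theorem UGraph.negLogHom_unlabel_mk {κ : Type} [Fintype κ] [Nonempty κ] (R : κ → κ → Prop)
    (G : RawGraph ℕ) :
    UGraph.negLogHom R (PLGraph.mk G).unlabel = -Real.log (G.homDensity R) := by
  rw [unlabel_mk]
  exact congrArg (fun x => -Real.log x)
    (RawGraph.homDensity_map R G (RawGraph.transportMap_injective Sum.inr_injective))

theorem isAdditive_negLogHom {κ : Type} [Fintype κ] [Nonempty κ] {R : κ → κ → Prop} {k : κ}
    (hk : R k k) : IsAdditive (UGraph.negLogHom R) := by
  intro A B
  obtain ⟨F, rfl⟩ := A.exists_rep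
  obtain ⟨G, rfl⟩ := B.exists_rep
  change -Real.log ((F.glue G).homDensity R) = -Real.log (F.homDensity R) + -Real.log (G.homDensity R)
  rw [RawGraph.homDensity_glue_unlabeled, Real.log_mul (RawGraph.homDensity_pos hk F).ne'
    (RawGraph.homDensity_pos hk G).ne']
  ring

theorem midGap_negLogHom_mk {κ : Type} [Fintype κ] [Nonempty κ] {R : κ → κ → Prop} {k : κ}
    (hk : R k k) (F G : RawGraph ℕ) : midGap (UGraph.negLogHom R) (PLGraph.mk F) (PLGraph.mk G) =
      Real.log ((F.glue F).homDensity R * (G.glue G).homDensity R) -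
        Real.log ((F.glue G).homDensity R ^ 2) := by
  simp only [midGap, mk_mul_mk, UGraph.negLogHom_unlabel_mk]
  rw [Real.log_mul (RawGraph.homDensity_pos hk _).ne' (RawGraph.homDensity_pos hk _).ne',
    Real.log_pow]
  push_cast; ring

theorem exists_labels (F G : RawGraph ℕ) : ∃ S : Finset ℕ,
    (∀ l, Sum.inl l ∈ F.1.support → l ∈ S) ∧ ∀ l, Sum.inl l ∈ G.1.support → l ∈ S := by
  have hfin : {l : ℕ | Sum.inl l ∈ F.1.support ∪ G.1.support}.Finite :=
    (F.finite_support.union G.finite_support).preimage Sum.inl_injective.injOn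
  exact ⟨hfin.toFinset, fun l hl => by simp [hl], fun l hl => by simp [hl]⟩

theorem midGap_negLogHom_nonneg {κ : Type} [Fintype κ] [Nonempty κ] {R : κ → κ → Prop} {k : κ}
    (hk : R k k) (F G : PLGraph ℕ) : 0 ≤ midGap (UGraph.negLogHom R) F G := by
  obtain ⟨F, rfl⟩ := F.exists_rep
  obtain ⟨G, rfl⟩ := G.exists_rep
  obtain ⟨S, hF, hG⟩ := exists_labels F G
  rw [midGap_negLogHom_mk hk, sub_nonneg]
  exact Real.log_le_log (pow_pos (RawGraph.homDensity_pos hk _) 2)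
    (RawGraph.homDensity_glue_sq_le R hF hG).1

theorem exists_midGap_pos {F G : PLGraph ℕ} (hF : F.Reduced) (hG : G.Reduced) (hne : F ≠ G) :
    ∃ u : UGraph → ℝ, IsAdditive u ∧ (∀ F G, 0 ≤ midGap u F G) ∧ 0 < midGap u F G := by
  obtain ⟨F, rfl, hF⟩ := hF
  obtain ⟨G, rfl, hG⟩ := hG
  obtain ⟨S, hFS, hGS⟩ := exists_labels F G
  obtain ⟨κ, _, R, k, hk, hlt⟩ := RawGraph.exists_homDensity_lt hFS hGS hF hG hne
  have : Nonempty κ := ⟨k⟩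
  refine ⟨UGraph.negLogHom R, isAdditive_negLogHom hk, midGap_negLogHom_nonneg hk, ?_⟩
  rw [midGap_negLogHom_mk hk, sub_pos]
  exact Real.log_lt_log (pow_pos (RawGraph.homDensity_pos hk _) 2) hlt

/-- One separating weight per pair is summed; all gaps are nonnegative, so the sum stays strict at
every pair. -/
theorem exists_forall_midGap_pos {J : Set (PLGraph ℕ)} (hJ : J.Finite)
    (hJr : ∀ F ∈ J, F.Reduced) : ∃ u : UGraph → ℝ, IsAdditive u ∧
      ∀ F ∈ J, ∀ G ∈ J, F ≠ G → 0 < midGap u F G := by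
  classical
  have h : ∀ q : PLGraph ℕ × PLGraph ℕ, ∃ u : UGraph → ℝ, IsAdditive u ∧
      (∀ F G, 0 ≤ midGap u F G) ∧ (q.1 ∈ J → q.2 ∈ J → q.1 ≠ q.2 → 0 < midGap u q.1 q.2) := by
    rintro ⟨F, G⟩
    by_cases hq : F ∈ J ∧ G ∈ J ∧ F ≠ G
    · obtain ⟨u, h1, h2, h3⟩ := exists_midGap_pos (hJr F hq.1) (hJr G hq.2.1) hq.2.2
      exact ⟨u, h1, h2, fun _ _ _ => h3⟩
    · refine ⟨fun _ => 0, fun _ _ => by simp, fun _ _ => by simp [midGap], fun h1 h2 h3 => ?_⟩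
      exact (hq ⟨h1, h2, h3⟩).elim
  choose u h1 h2 h3 using h
  refine ⟨fun H => ∑ q ∈ hJ.toFinset ×ˢ hJ.toFinset, u q H, fun A B => ?_, fun F hF G hG hne => ?_⟩
  · simp only [h1 _ A B, Finset.sum_add_distrib]
  · have : midGap (fun H => ∑ q ∈ hJ.toFinset ×ˢ hJ.toFinset, u q H) F G =
        ∑ q ∈ hJ.toFinset ×ˢ hJ.toFinset, midGap (u q) F G := by
      simp only [midGap, Finset.sum_sub_distrib, Finset.mul_sum]
    rw [this]
    exact Finset.sum_pos' (fun q _ => h2 q F G) ⟨(F, G), by simp [hF, hG], h3 (F, G) hF hG hne⟩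

/-- Additive weights separate finitely many graphs. -/
theorem exists_isAdditive_injOn (s : Finset UGraph) :
    ∃ r : UGraph → ℝ, IsAdditive r ∧ ∀ A ∈ s, ∀ B ∈ s, A ≠ B → r A ≠ r B := by
  let Φ : UGraph → (ConnGraph →₀ ℝ) := fun H => H.factorization.mapRange Nat.cast Nat.cast_zero
  have hΦ : Function.Injective Φ :=
    (Finsupp.mapRange_injective _ Nat.cast_zero Nat.cast_injective).comp
      UGraph.factorization_injective
  have hadd : ∀ A B, Φ (A * B) = Φ A + Φ B := by
    intro A B
    ext C
    simp [Φ, UGraph.factorization_mul]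
  let ι := {q : s × s // q.1 ≠ q.2}
  -- Distinct graphs have distinct multiplicity vectors, and some linear functional avoids zero on
  -- finitely many nonzero differences.
  obtain ⟨f, hf⟩ := Module.exists_dual_forall_apply_ne_zero (K := ℝ)
    (fun q : ι => Φ q.1.1.1 - Φ q.1.2.1) (fun q => sub_ne_zero.2 fun h =>
      q.2 (Subtype.ext (hΦ h)))
  refine ⟨fun H => f (Φ H), fun A B => by simp only [hadd, map_add], fun A hA B hB hne h => ?_⟩
  refine hf ⟨(⟨A, hA⟩, ⟨B, hB⟩), fun h => hne (congrArg Subtype.val h)⟩ ?_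
  rw [map_sub, sub_eq_zero]
  exact h

theorem eventually_add_mul_pos {a : ℝ} (ha : 0 < a) (b : ℝ) :
    ∀ᶠ ε in 𝓝[>] (0 : ℝ), 0 < a + ε * b := by
  have : Tendsto (fun ε : ℝ => a + ε * b) (𝓝[>] 0) (𝓝 (a + 0 * b)) :=
    ((continuous_const.add (continuous_id.mul continuous_const)).tendsto 0).mono_left
      nhdsWithin_le_nhds
  rw [zero_mul, add_zero] at this
  exact this.eventually (lt_mem_nhds ha)

theorem eventually_add_mul_ne (a : ℝ) {b : ℝ} (hb : b ≠ 0) :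
    ∀ᶠ ε in 𝓝[>] (0 : ℝ), a + ε * b ≠ 0 := by
  rcases lt_trichotomy a 0 with ha | rfl | ha
  · filter_upwards [eventually_add_mul_pos (neg_pos.2 ha) (-b)] with ε h1 h2
    nlinarith
  · filter_upwards [self_mem_nhdsWithin] with ε hε
    rw [zero_add]
    exact mul_ne_zero (ne_of_gt hε) hb
  · filter_upwards [eventually_add_mul_pos ha b] with ε h1
    exact h1.ne'

/-- An additive weight that is strictly midpoint concave on finitely many reduced graphs, bigger at
`Hb` than at `Hu`, and injective on a given finite set. -/
theorem exists_weight {p : ℕ} {Hb : RawGraph Empty} {Hu : UGraph}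
    (hdeg : Hb.DegreesNear p) (htriv : UGraph.IsTrivialSquare (PLGraph.mk Hb))
    (hne : PLGraph.mk Hb ≠ Hu) (he : (PLGraph.mk Hb).edgeCount = Hu.edgeCount)
    (hw : UGraph.degWeight (kink p) (kink_zero p) (PLGraph.mk Hb) =
      UGraph.degWeight (kink p) (kink_zero p) Hu)
    {J : Set (PLGraph ℕ)} (hJ : J.Finite) (hJr : ∀ F ∈ J, F.Reduced) (s : Finset UGraph) :
    ∃ W : UGraph → ℝ, IsAdditive W ∧ (∀ F ∈ J, ∀ G ∈ J, F ≠ G → 0 < midGap W F G) ∧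
      W Hu < W (PLGraph.mk Hb) ∧ ∀ A ∈ s, ∀ B ∈ s, A ≠ B → W A ≠ W B := by
  obtain ⟨C, hC⟩ := UGraph.exists_multiplicity_lt hne he
  obtain ⟨D, hD, hDC⟩ : ∃ D, RawGraph.IsBlock Hb D ∧ PLGraph.mk D = C.1 := by
    have h0 : UGraph.multiplicity C (PLGraph.mk Hb) ≠ 0 := by omega
    rw [UGraph.multiplicity_mk] at h0
    exact Set.nonempty_of_ncard_ne_zero h0
  have hsq : ∀ F : PLGraph ℕ, (F * F).unlabel = C.1 → F.FullyLabeled := fun F hF =>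
    hD.fullyLabeled_of_isTrivialSquare htriv F (hF.trans hDC.symm)
  have hCdeg : ∀ D : RawGraph ℕ, (PLGraph.mk D).unlabel = C.1 → D.DegreesNear p := by
    intro D' hD'
    rw [← hDC, unlabel_mk] at hD'
    obtain ⟨σ, hσ⟩ := RawGraph.mk_eq_iff.1 hD'
    have h1 := hD.degreesNear hdeg
    rw [← hσ, RawGraph.rename,
      RawGraph.degreesNear_map (Function.injective_id.sumMap σ.injective),
      RawGraph.degreesNear_map (RawGraph.transportMap_injective Sum.inr_injective)] at h1
    exact h1
  set w := UGraph.degWeight (kink p) (kink_zero p)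
  set m : UGraph → ℝ := fun H => UGraph.multiplicity C H
  have hwa : IsAdditive w := UGraph.degWeight_mul _ _
  have hma : IsAdditive m := fun A B => by
    simp only [m, UGraph.multiplicity_mul, Nat.cast_add]
  have hm : 0 < m (PLGraph.mk Hb) - m Hu := by
    rw [sub_pos]
    exact Nat.cast_lt.2 hC
  obtain ⟨u, hua, hu⟩ := exists_forall_midGap_pos hJ hJr
  obtain ⟨r, hra, hr⟩ := exists_isAdditive_injOn s
  -- The multiplicity gap may be negative, but only where the degree gap is positive; finitely many
  -- pairs allow one `δ`.
  obtain ⟨δ, hδ0, hδ⟩ : ∃ δ : ℝ, 0 < δ ∧ ∀ F ∈ J, ∀ G ∈ J, 0 ≤ midGap w F G + δ * midGap m F G := by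
    have : ∀ᶠ δ in 𝓝[>] (0 : ℝ), ∀ F ∈ J, ∀ G ∈ J, 0 ≤ midGap w F G + δ * midGap m F G := by
      rw [hJ.eventually_all]
      intro F _
      rw [hJ.eventually_all]
      intro G _
      rcases (midGap_degWeight_nonneg p F G).eq_or_lt with h | h
      · filter_upwards [self_mem_nhdsWithin] with δ hδ
        have h1 := midGap_multiplicity_nonneg hsq hCdeg F G h.symm
        rw [show midGap w F G = 0 from h.symm, zero_add]
        exact mul_nonneg (le_of_lt hδ) h1
      · exact (eventually_add_mul_pos h _).mono fun _ h => h.le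
    obtain ⟨δ, h1, h2⟩ := (this.and self_mem_nhdsWithin).exists
    exact ⟨δ, h2, h1⟩
  set W₁ : UGraph → ℝ := fun H => w H + δ * m H
  have hW₁ : 0 < W₁ (PLGraph.mk Hb) - W₁ Hu := by
    simp only [W₁, hw]
    nlinarith
  -- Any positive `η` makes the gaps strict. It is taken small enough to keep the advantage of `Hb`
  -- over `Hu` that `m` provides.
  obtain ⟨η, hη0, hη⟩ := ((eventually_add_mul_pos hW₁ (u (PLGraph.mk Hb) - u Hu)).and
    self_mem_nhdsWithin).exists.imp fun _ h => And.symm h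
  set W₂ : UGraph → ℝ := fun H => W₁ H + η * u H
  have hW₂ : 0 < W₂ (PLGraph.mk Hb) - W₂ Hu := by
    simp only [W₂]
    linarith
  have hgap₂ : ∀ F ∈ J, ∀ G ∈ J, F ≠ G → 0 < midGap W₂ F G := by
    intro F hF G hG hne
    rw [midGap_add_mul, midGap_add_mul]
    have h1 := hδ F hF G hG
    have h2 := mul_pos (show 0 < η from hη0) (hu F hF G hG hne)
    linarith
  -- The remaining strict inequalities are open conditions, and for small θ > 0 the term θ · r
  -- separates all ties on `s`.
  have hev : ∀ᶠ θ in 𝓝[>] (0 : ℝ),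
      (∀ F ∈ J, ∀ G ∈ J, F ≠ G → 0 < midGap W₂ F G + θ * midGap r F G) ∧
      0 < W₂ (PLGraph.mk Hb) - W₂ Hu + θ * (r (PLGraph.mk Hb) - r Hu) ∧
      ∀ A ∈ s, ∀ B ∈ s, A ≠ B → W₂ A - W₂ B + θ * (r A - r B) ≠ 0 := by
    refine Eventually.and ?_ ((eventually_add_mul_pos hW₂ _).and ?_)
    · rw [hJ.eventually_all]
      intro F hF
      rw [hJ.eventually_all]
      intro G hG
      rw [eventually_imp_distrib_left]
      exact fun hne => eventually_add_mul_pos (hgap₂ F hF G hG hne) _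
    · rw [Finset.eventually_all]
      intro A hA
      rw [Finset.eventually_all]
      intro B hB
      rw [eventually_imp_distrib_left]
      exact fun hne => eventually_add_mul_ne _ (sub_ne_zero.2 (hr A hA B hB hne))
  obtain ⟨θ, h1, h2, h3⟩ := hev.exists
  refine ⟨fun H => W₂ H + θ * r H, ((hwa.add_mul hma δ).add_mul hua η).add_mul hra θ,
    fun F hF G hG hne => ?_, ?_, fun A hA B hB hne h => h3 A hA B hB hne ?_⟩
  · rw [midGap_add_mul]; exact h1 F hF G hG hne
  · linarith
  · linarith

/-! ### Exponential characters -/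

/-- The character `exp (-τ W)`. -/
noncomputable def expChar {W : UGraph → ℝ} (hW : IsAdditive W) (τ : ℝ) : UGraph →* ℝ where
  toFun H := Real.exp (-τ * W H)
  map_one' := by rw [hW.map_one, mul_zero, Real.exp_zero]
  map_mul' A B := by rw [hW A B, mul_add, Real.exp_add]

theorem expChar_apply {W : UGraph → ℝ} (hW : IsAdditive W) (τ : ℝ) (H : UGraph) :
    expChar hW τ H = Real.exp (-τ * W H) := rfl

theorem tendsto_exp_neg_mul {x : ℝ} (hx : 0 < x) :
    Tendsto (fun τ : ℝ => Real.exp (-τ * x)) atTop (𝓝 0) := by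
  refine Real.tendsto_exp_atBot.comp ?_
  have : (fun τ : ℝ => -τ * x) = fun τ => -(τ * x) := by funext τ; ring
  rw [this]
  exact tendsto_neg_atTop_atBot.comp (tendsto_id.atTop_mul_const hx)

/-- Multiplied by exp(τ W(A)), where `A` is the unique graph of least weight in `b`, the value tends
to the nonzero coefficient of `A`. -/
theorem eventually_evalHom_ne {W : UGraph → ℝ} (hW : IsAdditive W) {b : GraphCombination}
    (hb : b ≠ 0) (hinj : ∀ A ∈ b.coeff.support, ∀ B ∈ b.coeff.support, A ≠ B → W A ≠ W B) :
    ∀ᶠ τ in atTop, evalHom (expChar hW τ) b ≠ 0 := by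
  classical
  have hne : b.coeff.support.Nonempty := by
    rw [Finsupp.support_nonempty_iff]
    exact fun h => hb (MonoidAlgebra.coeff_eq_zero.1 h)
  obtain ⟨A, hA, hmin⟩ := Finset.exists_min_image b.coeff.support W hne
  have hlim : Tendsto (fun τ : ℝ => ∑ H ∈ b.coeff.support,
      b.coeff H * Real.exp (-τ * (W H - W A))) atTop
      (𝓝 (∑ H ∈ b.coeff.support, if H = A then b.coeff A else 0)) := by
    refine tendsto_finsetSum _ fun H hH => ?_
    split_ifs with h
    · subst h
      simp
    · have h1 : 0 < W H - W A :=
        sub_pos.2 (lt_of_le_of_ne (hmin H hH) (hinj A hA H hH (Ne.symm h)))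
      simpa using (tendsto_exp_neg_mul h1).const_mul (b.coeff H)
  rw [Finset.sum_ite_eq', if_pos hA] at hlim
  filter_upwards [hlim.eventually_ne (Finsupp.mem_support_iff.1 hA)] with τ hτ h0
  refine hτ ?_
  have : ∀ H, b.coeff H * Real.exp (-τ * (W H - W A)) =
      (b.coeff H * Real.exp (-τ * W H)) * Real.exp (τ * W A) := by
    intro H
    rw [mul_assoc, ← Real.exp_add]
    congr 2
    ring
  simp only [this]
  rw [← Finset.sum_mul]
  rw [evalHom, MonoidAlgebra.lift_apply, Finsupp.sum] at h0
  simp only [smul_eq_mul, expChar_apply] at h0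
  rw [h0, zero_mul]

theorem eventually_evalUnlabel_nonneg {W : UGraph → ℝ} (hW : IsAdditive W) (d : ℕ)
    (hgap : ∀ F, F.Reduced ∧ Bounded d (2 * d) F → ∀ G, G.Reduced ∧ Bounded d (2 * d) G →
      F ≠ G → 0 < midGap W F G) :
    ∀ᶠ τ in atTop, ∀ a : LabeledCombination, (∀ F ∈ a.coeff.support, F.edgeCount ≤ d) →
      0 ≤ evalUnlabel (expChar hW τ) (a * a) := by
  have hfin : {F | F.Reduced ∧ Bounded d (2 * d) F}.Finite :=
    (finite_bounded d (2 * d)).subset fun F h => h.2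
  set t := hfin.toFinset
  have hmem : ∀ F, F ∈ t ↔ F.Reduced ∧ Bounded d (2 * d) F := fun F => hfin.mem_toFinset
  choose R U hR hRd hRl hRU using PLGraph.exists_reduced
  have hev : ∀ᶠ τ : ℝ in atTop, ∀ F ∈ t, ∀ G ∈ t, F ≠ G →
      Real.exp (-τ * (midGap W F G / 2)) ≤ (t.card : ℝ)⁻¹ := by
    rw [Finset.eventually_all]
    intro F hF
    rw [Finset.eventually_all]
    intro G hG
    rw [eventually_imp_distrib_left]
    intro hne
    have hc : (0 : ℝ) < (t.card : ℝ)⁻¹ := inv_pos.2 (Nat.cast_pos.2 (Finset.card_pos.2 ⟨F, hF⟩))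
    have h1 := hgap F ((hmem F).1 hF) G ((hmem G).1 hG) hne
    exact ((tendsto_exp_neg_mul (half_pos h1)).eventually (gt_mem_nhds hc)).mono fun _ h => h.le
  filter_upwards [hev] with τ hτ
  refine nonneg_of_bounded _ d fun a ha => ?_
  rw [evalUnlabel_mul]
  -- With F = R F · U F, the exponent W([[FG]]) is half the gap of R F and R G plus one term
  -- depending on F alone and one on G alone. These terms are absorbed in the coefficients.
  have key := sum_mul_nonneg_of_dominant a.coeff.support
    (fun F => a.coeff F * Real.exp (-τ * (W (U F) + W (R F * R F).unlabel / 2))) R t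
    (fun F hF => (hmem _).2 ⟨hR F, (hRd F).trans (ha F hF).1, fun l hl => (ha F hF).2 l (hRl F l hl)⟩)
    (fun F G => Real.exp (-τ * (midGap W F G / 2))) (fun F => by
      have h0 : midGap W F F = 0 := by rw [midGap]; ring
      change Real.exp (-τ * (midGap W F F / 2)) = 1
      rw [h0, zero_div, mul_zero, Real.exp_zero])
    (fun F hF G hG hne => by
      rw [Real.abs_exp]; exact hτ F hF G hG hne)
  refine key.trans_eq (Finset.sum_congr rfl fun F _ => Finset.sum_congr rfl fun G _ => ?_)
  have h1 : (F * G).unlabel = (R F * R G).unlabel * (U F * U G) := by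
    conv_lhs => rw [hRU F, hRU G]
    exact unlabel_mul_ofUnlabeled_mul _ _ _ _
  rw [h1, expChar_apply, hW, hW, midGap, mul_mul_mul_comm, mul_assoc (_ * _), ← Real.exp_add,
    ← Real.exp_add]
  congr 2
  ring

/-- A point of the profile at which `Hb - Hu` is negative and `b` does not vanish. -/
theorem exists_char {p : ℕ} {Hb : RawGraph Empty} {Hu : UGraph}
    (hdeg : Hb.DegreesNear p) (htriv : UGraph.IsTrivialSquare (PLGraph.mk Hb))
    (hne : PLGraph.mk Hb ≠ Hu) (he : (PLGraph.mk Hb).edgeCount = Hu.edgeCount)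
    (hw : UGraph.degWeight (kink p) (kink_zero p) (PLGraph.mk Hb) =
      UGraph.degWeight (kink p) (kink_zero p) Hu) (d : ℕ) {b : GraphCombination} (hb : b ≠ 0) :
    ∃ χ : UGraph →* ℝ, (∀ H, 0 < χ H) ∧
      (∀ a : LabeledCombination, (∀ F ∈ a.coeff.support, F.edgeCount ≤ d) →
        0 ≤ evalUnlabel χ (a * a)) ∧ χ (PLGraph.mk Hb) < χ Hu ∧ evalHom χ b ≠ 0 := by
  obtain ⟨W, hW, hgap, hlt, hinj⟩ := exists_weight hdeg htriv hne he hw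
    (J := {F | F.Reduced ∧ Bounded d (2 * d) F})
    ((finite_bounded d (2 * d)).subset fun F h => h.2) (fun F h => h.1) b.coeff.support
  obtain ⟨τ, h1, h2, h3⟩ := ((eventually_evalUnlabel_nonneg hW d hgap).and
    ((eventually_evalHom_ne hW hb hinj).and (eventually_gt_atTop (0 : ℝ)))).exists
  refine ⟨expChar hW τ, fun H => Real.exp_pos _, h1, ?_, h2⟩
  rw [expChar_apply, expChar_apply, Real.exp_lt_exp]
  nlinarith

theorem evalHom_sos_nonneg {χ : UGraph →* ℝ} {n : ℕ} {f : Fin n → LabeledCombination}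
    (h : ∀ j, 0 ≤ evalUnlabel χ (f j * f j)) : 0 ≤ evalHom χ (∑ j, unlabel (f j ^ 2)) := by
  rw [map_sum]
  refine Finset.sum_nonneg fun j _ => ?_
  rw [sq]
  exact h j

theorem not_sosTestable_and_not_isRationalSos {p : ℕ} {Hb : RawGraph Empty} {Hu : UGraph}
    (hdeg : Hb.DegreesNear p) (htriv : UGraph.IsTrivialSquare (PLGraph.mk Hb))
    (hne : PLGraph.mk Hb ≠ Hu) (he : (PLGraph.mk Hb).edgeCount = Hu.edgeCount)
    (hw : UGraph.degWeight (kink p) (kink_zero p) (PLGraph.mk Hb) =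
      UGraph.degWeight (kink p) (kink_zero p) Hu) :
    ¬ SosTestable (UGraph.toComb (PLGraph.mk Hb) - Hu.toComb) ∧
      ¬ IsRationalSos (UGraph.toComb (PLGraph.mk Hb) - Hu.toComb) := by
  have hval : ∀ χ : UGraph →* ℝ, evalHom χ (UGraph.toComb (PLGraph.mk Hb) - Hu.toComb) =
      χ (PLGraph.mk Hb) - χ Hu := by
    intro χ
    rw [map_sub, UGraph.toComb, UGraph.toComb, evalHom_single, evalHom_single, one_mul, one_mul]
  constructor
  · rintro ⟨d, -, hd⟩
    obtain ⟨χ, hpos, hsos, hlt, -⟩ := exists_char hdeg htriv hne he hw d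
      (b := 1) one_ne_zero
    have := hd (fun C => χ C.1) ⟨fun C => (hpos _).le, ?_⟩
    · rw [evalAt_eq, hval] at this
      linarith
    · rintro a ⟨n, f, hf, rfl⟩
      rw [evalAt_eq]
      exact evalHom_sos_nonneg fun j => hsos _ (hf j)
  · rintro ⟨b, c, hb, ⟨n, f, hf⟩, ⟨k, g, hg⟩, hc⟩
    -- Only finitely many graphs occur in the squares of `b` and `c`, so one `d` bounds the edges of
    -- all of them.
    let d : ℕ := (Finset.univ.sup fun j => (f j).coeff.support.sup edgeCount) ⊔
      Finset.univ.sup fun j => (g j).coeff.support.sup edgeCount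
    obtain ⟨χ, hpos, hsos, hlt, hbχ⟩ := exists_char hdeg htriv hne he hw d hb
    have h1 : 0 ≤ evalHom χ b := by
      rw [hf]
      refine evalHom_sos_nonneg fun j => hsos _ fun F hF => ?_
      refine le_trans (Finset.le_sup (f := edgeCount) hF) (le_trans ?_ le_sup_left)
      exact Finset.le_sup (f := fun j => (f j).coeff.support.sup edgeCount) (Finset.mem_univ j)
    have h2 : 0 ≤ evalHom χ c := by
      rw [hg]
      refine evalHom_sos_nonneg fun j => hsos _ fun F hF => ?_
      refine le_trans (Finset.le_sup (f := edgeCount) hF) (le_trans ?_ le_sup_right)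
      exact Finset.le_sup (f := fun j => (g j).coeff.support.sup edgeCount) (Finset.mem_univ j)
    rw [← hc, map_mul, hval] at h2
    have h3 : 0 < evalHom χ b := lt_of_le_of_ne h1 hbχ.symm
    nlinarith

end GraphSOS

namespace GraphSOS

/-! ### Simple graphs on finite vertex types -/

namespace RawGraph

section OfSimpleGraph

variable {V W : Type*}

/-- The embedding into the vertex pool given by the chosen enumeration of the vertices. -/
noncomputable def poolMap (V : Type*) [Finite V] (x : V) : Empty ⊕ ℕ :=
  Sum.inr (Finite.equivFin V x : ℕ)

theorem poolMap_injective [Finite V] : Function.Injective (poolMap V) :=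
  Sum.inr_injective.comp (Fin.val_injective.comp (Finite.equivFin V).injective)

/-- A finite simple graph drawn in the vertex pool. -/
noncomputable def ofSimpleGraph [Finite V] (G : SimpleGraph V) : RawGraph Empty :=
  ⟨G.map (poolMap V), finite_edgeSet_map (Set.toFinite _) _⟩

theorem mk_ofSimpleGraph [Finite V] (G : SimpleGraph V) :
    PLGraph.mk (ofSimpleGraph G) = UGraph.ofSimpleGraph G := rfl

theorem adj_ofSimpleGraph [Finite V] (G : SimpleGraph V) (x y : V) :
    (ofSimpleGraph G).1.Adj (poolMap V x) (poolMap V y) ↔ G.Adj x y :=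
  SimpleGraph.map_adj_apply (f := (⟨poolMap V, poolMap_injective⟩ : V ↪ Empty ⊕ ℕ))

theorem support_ofSimpleGraph_subset [Finite V] (G : SimpleGraph V) :
    (ofSimpleGraph G).1.support ⊆ Set.range (poolMap V) := by
  rintro _ ⟨b, -, x, y, -, rfl, -⟩
  exact ⟨x, rfl⟩

theorem support_ofSimpleGraph [Finite V] {G : SimpleGraph V} (hG : ∀ x, ∃ y, G.Adj x y) :
    (ofSimpleGraph G).1.support = Set.range (poolMap V) := by
  refine (support_ofSimpleGraph_subset G).antisymm ?_
  rintro _ ⟨x, rfl⟩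
  obtain ⟨y, hy⟩ := hG x
  exact ⟨_, (adj_ofSimpleGraph G x y).2 hy⟩

theorem deg_ofSimpleGraph [Fintype V] (G : SimpleGraph V) [DecidableRel G.Adj] (x : V) :
    (ofSimpleGraph G).deg (poolMap V x) = G.degree x := by
  have : (ofSimpleGraph G).1.neighborSet (poolMap V x) = poolMap V '' G.neighborSet x :=
    SimpleGraph.neighborSet_map G (⟨poolMap V, poolMap_injective⟩ : V ↪ Empty ⊕ ℕ) x
  rw [deg, this, Set.ncard_image_of_injective _ poolMap_injective, Set.ncard_eq_toFinset_card',
    ← SimpleGraph.card_neighborFinset_eq_degree]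
  rfl

theorem edgeCount_ofSimpleGraph [Finite V] (G : SimpleGraph V) :
    (ofSimpleGraph G).edgeCount = G.edgeSet.ncard := by
  have : (ofSimpleGraph G).1.edgeSet = _ :=
    SimpleGraph.edgeSet_map (⟨poolMap V, poolMap_injective⟩ : V ↪ Empty ⊕ ℕ) G
  rw [edgeCount, this]
  exact Set.ncard_image_of_injective _ (Function.Embedding.injective _)

theorem degWeight_ofSimpleGraph [Fintype V] (G : SimpleGraph V) [DecidableRel G.Adj] {φ : ℕ → ℝ}
    (hφ : φ 0 = 0) : (ofSimpleGraph G).degWeight φ = ∑ x, φ (G.degree x) := by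
  have h1 : (∑ᶠ y ∈ Set.range (poolMap V), φ ((ofSimpleGraph G).deg y)) =
      ∑ x, φ (G.degree x) := by
    rw [finsum_mem_range poolMap_injective, finsum_eq_sum_of_fintype]
    simp only [deg_ofSimpleGraph]
  rw [← h1, degWeight]
  refine finsum_congr fun y => ?_
  by_cases hy : y ∈ Set.range (poolMap V)
  · simp [hy]
  · simp only [hy, deg_eq_zero fun h => hy (support_ofSimpleGraph_subset G h), hφ, finsum_false]

/-- Without isolated vertices the support is the whole vertex set, so a renaming of the pool
restricts to an isomorphism. -/
theorem nonempty_iso_of_ofSimpleGraph_eq [Finite V] [Finite W] {A : SimpleGraph V}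
    {B : SimpleGraph W} (hA : ∀ x, ∃ y, A.Adj x y) (hB : ∀ x, ∃ y, B.Adj x y)
    (h : UGraph.ofSimpleGraph A = UGraph.ofSimpleGraph B) : Nonempty (A ≃g B) := by
  obtain ⟨σ, hσ⟩ := mk_eq_iff.1 h
  change (ofSimpleGraph A).map (Sum.map id σ) = ofSimpleGraph B at hσ
  have hs : Function.Injective (Sum.map (id : Empty → Empty) σ) :=
    Function.injective_id.sumMap σ.injective
  have hr : Set.range (Sum.map id σ ∘ poolMap V) = Set.range (poolMap W) := by
    rw [Set.range_comp, ← support_ofSimpleGraph hA, ← support_map hs, hσ, support_ofSimpleGraph hB]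
  let e : V ≃ W := ((Equiv.ofInjective _ (hs.comp poolMap_injective)).trans
    (Equiv.setCongr hr)).trans (Equiv.ofInjective _ poolMap_injective).symm
  have he : ∀ x, poolMap W (e x) = Sum.map id σ (poolMap V x) := fun x =>
    Equiv.apply_ofInjective_symm poolMap_injective _
  refine ⟨⟨e, fun {x y} => ?_⟩⟩
  rw [← adj_ofSimpleGraph B, he, he, ← hσ, adj_map_apply hs, adj_ofSimpleGraph]

end OfSimpleGraph

/-! ### The path with three edges is a trivial square -/

/-- The two copies of an unlabeled vertex lie in different factors, and a label is its own copy. -/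
theorem not_adj_swapMap {L : Type} (F : RawGraph L) (x : L ⊕ ℕ) :
    ¬ (F.glue F).1.Adj x (swapMap L x) := by
  intro h
  rcases (glue_adj _ _ _ _).1 h with e | e
  · obtain ⟨a, b, e, rfl, hb⟩ := (adj_map evenMap_injective _ _ _).1 e
    rw [swapMap_evenMap] at hb
    obtain ⟨l, rfl, rfl⟩ := (evenMap_eq_oddMap_iff _ _).1 hb
    exact e.ne rfl
  · obtain ⟨a, b, e, rfl, hb⟩ := (adj_map oddMap_injective _ _ _).1 e
    rw [swapMap_oddMap] at hb
    obtain ⟨l, rfl, rfl⟩ := (evenMap_eq_oddMap_iff _ _).1 hb.symm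
    exact e.ne rfl

theorem mem_range_inl_of_swapMap_eq {L : Type} {x : L ⊕ ℕ} (h : swapMap L x = x) :
    x ∈ Set.range Sum.inl := by
  rcases x with l | n
  · exact ⟨l, rfl⟩
  · exfalso
    rcases n.even_or_odd' with ⟨k, rfl | rfl⟩
    · have h1 := swapMap_evenMap (L := L) (Sum.inr k)
      rw [evenMap_inr, h, oddMap_inr, Sum.inr.injEq] at h1
      omega
    · have h1 := swapMap_oddMap (L := L) (Sum.inr k)
      rw [oddMap_inr, h, evenMap_inr, Sum.inr.injEq] at h1
      omega

end RawGraph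

open RawGraph

/-- The path has only the identity and the reversal, and the reversal exchanges the two inner
vertices. -/
theorem pathGraph_four_endomorphism {θ : Fin 4 → Fin 4} (hinj : Function.Injective θ)
    (hθ : ∀ i k, (SimpleGraph.pathGraph 4).Adj i k → (SimpleGraph.pathGraph 4).Adj (θ i) (θ k)) :
    θ = id ∨ θ 1 = 2 := by
  simp only [SimpleGraph.pathGraph_adj] at hθ
  have h1 := hθ 0 1 (by decide)
  have h2 := hθ 1 2 (by decide)
  have h3 := hθ 2 3 (by decide)
  have h4 : (θ 0).1 ≠ (θ 2).1 := fun h => by simpa using hinj (Fin.ext h)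
  have h5 : (θ 1).1 ≠ (θ 3).1 := fun h => by simpa using hinj (Fin.ext h)
  have h6 := (θ 0).2
  have h7 := (θ 3).2
  rcases eq_or_ne (θ 1) 2 with h | h
  · exact Or.inr h
  · left
    have h8 : (θ 1).1 ≠ 2 := fun e => h (Fin.ext e)
    funext i
    fin_cases i <;> refine Fin.ext ?_ <;> simp <;> omega

/-- The exchange of the two copies acts on the path F². The reversal would map an inner vertex to a
neighbor, which a copy never is. So the action is trivial, and a vertex fixed by the exchange is
labeled. -/
theorem isTrivialSquare_pathGraph_four :
    (UGraph.ofSimpleGraph (SimpleGraph.pathGraph 4)).IsTrivialSquare := by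
  intro F hF
  obtain ⟨F, rfl⟩ := F.exists_rep
  have hnbr : ∀ x, ∃ y, (SimpleGraph.pathGraph 4).Adj x y := by
    simp only [SimpleGraph.pathGraph_adj]; decide
  suffices h : (PLGraph.mk F).FullyLabeled by
    refine ⟨h, ?_⟩
    rw [PLGraph.fullyLabeled_mk] at h
    rwa [PLGraph.mk_mul_mk, glue_self_of_labeled h] at hF
  have hF' := hF
  rw [PLGraph.mk_mul_mk, PLGraph.unlabel_mk] at hF'
  obtain ⟨σ, hσ⟩ := mk_eq_iff.1 hF'
  rw [rename, RawGraph.map_map] at hσ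
  change _ = RawGraph.ofSimpleGraph (SimpleGraph.pathGraph 4) at hσ
  set X := F.glue F with hX
  set j := Sum.map (id : Empty → Empty) σ ∘ transportMap (M := Empty) Sum.inr with hj
  have hji : Function.Injective j := (Function.injective_id.sumMap σ.injective).comp
    (transportMap_injective (M := Empty) (Sum.inr_injective (α := Empty) (β := ℕ)))
  have hsupp : j '' X.1.support = Set.range (poolMap (Fin 4)) := by
    rw [← RawGraph.support_map hji, hσ, support_ofSimpleGraph hnbr]
  have hx : ∀ i, ∃ x ∈ X.1.support, j x = poolMap (Fin 4) i := fun i => by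
    have : poolMap (Fin 4) i ∈ j '' X.1.support := hsupp ▸ ⟨i, rfl⟩
    exact this
  choose x hxs hxj using hx
  have hex : ∀ y ∈ X.1.support, ∃ i, y = x i := fun y hy => by
    have : j y ∈ Set.range (poolMap (Fin 4)) := hsupp ▸ ⟨y, hy, rfl⟩
    obtain ⟨i, hi⟩ := this
    exact ⟨i, hji (hi.symm.trans (hxj i).symm)⟩
  have hadj : ∀ i k, X.1.Adj (x i) (x k) ↔ (SimpleGraph.pathGraph 4).Adj i k := fun i k => by
    rw [← adj_map_apply hji, hσ, hxj, hxj, adj_ofSimpleGraph]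
  have hxi : Function.Injective x := fun a b h =>
    poolMap_injective (by rw [← hxj, ← hxj, h])
  have hsw : ∀ a b, X.1.Adj a b → X.1.Adj (swapMap ℕ a) (swapMap ℕ b) := fun a b h => by
    rw [hX, ← glue_self_map_swap F]
    exact (adj_map_apply swapMap_injective _ _ _).2 h
  have hθ : ∀ i, ∃ k, swapMap ℕ (x i) = x k := fun i => by
    obtain ⟨y, hy⟩ := hxs i
    exact hex _ ⟨_, hsw _ _ hy⟩
  choose θ hθ using hθ
  have hθi : Function.Injective θ := fun a b h =>
    hxi (swapMap_injective (by rw [hθ, hθ, h]))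
  rcases pathGraph_four_endomorphism hθi (fun i k h => by
    rw [← hadj, ← hθ, ← hθ]
    exact hsw _ _ ((hadj i k).2 h)) with h | h
  · have hXl : X.1.support ⊆ Set.range Sum.inl := fun y hy => by
      obtain ⟨i, rfl⟩ := hex y hy
      refine mem_range_inl_of_swapMap_eq ?_
      rw [hθ, h, id]
    rw [PLGraph.fullyLabeled_mk]
    rintro y ⟨z, hyz⟩
    obtain ⟨l, hl⟩ := hXl ⟨_, (glue_adj _ _ _ _).2
      (Or.inl ((adj_map_apply evenMap_injective F y z).2 hyz))⟩
    exact ⟨l, ((evenMap_eq_inl_iff y l).1 hl.symm).symm⟩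
  · exact (not_adj_swapMap F (x 1) (by
      rw [hθ, h]
      exact (hadj 1 2).2 (by rw [SimpleGraph.pathGraph_adj]; decide))).elim

/-! ### The main theorem -/

/-- Up to p + 1 the kink is the identity, and the sum is the handshake lemma. -/
theorem degWeight_kink_ofSimpleGraph {V : Type*} [Fintype V] (G : SimpleGraph V)
    [DecidableRel G.Adj] {p : ℕ} (h : ∀ x, G.degree x ≤ p + 1) :
    UGraph.degWeight (kink p) (kink_zero p) (UGraph.ofSimpleGraph G) = 2 * G.edgeSet.ncard := by
  rw [← mk_ofSimpleGraph, UGraph.degWeight_mk, degWeight_ofSimpleGraph G (kink_zero p),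
    Finset.sum_congr rfl fun x _ => (kink_eq_iff _ _).2 (h x), ← Nat.cast_sum,
    SimpleGraph.sum_degrees_eq_twice_card_edges, Nat.cast_mul, Nat.cast_two,
    Set.ncard_eq_toFinset_card']
  rfl

theorem degreesNear_ofSimpleGraph {V : Type*} [Fintype V] (G : SimpleGraph V)
    [DecidableRel G.Adj] {p : ℕ} (h : ∀ x, G.degree x = p ∨ G.degree x = p + 1) :
    (ofSimpleGraph G).DegreesNear p := by
  intro y hy
  obtain ⟨x, rfl⟩ := support_ofSimpleGraph_subset G hy
  rw [deg_ofSimpleGraph]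
  exact h x

theorem degWeight_pow (φ : ℕ → ℝ) (hφ : φ 0 = 0) (H : UGraph) (n : ℕ) :
    UGraph.degWeight φ hφ (H ^ n) = n * UGraph.degWeight φ hφ H := by
  induction n with
  | zero =>
    have := UGraph.degWeight_mul φ hφ 1 1
    rw [mul_one] at this
    rw [pow_zero, Nat.cast_zero, zero_mul]
    linarith
  | succ n ih => rw [pow_succ, UGraph.degWeight_mul, ih]; push_cast; ring

theorem edgeCount_pow (H : UGraph) (n : ℕ) : (H ^ n).edgeCount = n * H.edgeCount := by
  induction n with
  | zero => simp [PLGraph.one_eq, edgeCount, RawGraph.empty]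
  | succ n ih => rw [pow_succ, PLGraph.edgeCount_mul, ih]; ring

theorem toComb_pow (H : UGraph) (n : ℕ) : H.toComb ^ n = (H ^ n).toComb := by
  simp only [UGraph.toComb, MonoidAlgebra.single_pow, one_pow]

instance : DecidableRel (SimpleGraph.pathGraph 4).Adj := fun _ _ =>
  decidable_of_iff _ SimpleGraph.pathGraph_adj.symm

theorem ncard_edgeSet_pathGraph_four : (SimpleGraph.pathGraph 4).edgeSet.ncard = 3 := by
  have h := (SimpleGraph.pathGraph 4).sum_degrees_eq_twice_card_edges
  rw [show ∑ v, (SimpleGraph.pathGraph 4).degree v = 6 by decide +kernel] at h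
  rw [Set.ncard_eq_toFinset_card']
  change _ = 2 * (SimpleGraph.pathGraph 4).edgeFinset.card at h
  rw [SimpleGraph.edgeFinset] at h
  omega

theorem degree_completeGraph_two (x : Fin 2) : (SimpleGraph.completeGraph (Fin 2)).degree x = 1 := by
  simp

theorem ncard_edgeSet_completeGraph_two :
    (SimpleGraph.completeGraph (Fin 2)).edgeSet.ncard = 1 := by
  have h := (SimpleGraph.completeGraph (Fin 2)).sum_degrees_eq_twice_card_edges
  simp only [degree_completeGraph_two, Finset.sum_const, Finset.card_univ, Fintype.card_fin,
    smul_eq_mul, mul_one] at h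
  rw [Set.ncard_eq_toFinset_card']
  rw [SimpleGraph.edgeFinset] at h
  omega

theorem pathGraph_four_ne_completeGraph_two_pow :
    UGraph.ofSimpleGraph (SimpleGraph.pathGraph 4) ≠
      UGraph.ofSimpleGraph (SimpleGraph.completeGraph (Fin 2)) ^ 3 := by
  intro h
  -- This degree weight counts the vertices: 4 for the path and 6 for three disjoint edges.
  let φ : ℕ → ℝ := fun k => if k = 0 then 0 else 1
  have hφ : φ 0 = 0 := if_pos rfl
  have h' := congrArg (UGraph.degWeight φ hφ) h
  have hdeg : ∀ x, (SimpleGraph.pathGraph 4).degree x ≠ 0 := by decide +kernel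
  rw [degWeight_pow, ← mk_ofSimpleGraph, ← mk_ofSimpleGraph, UGraph.degWeight_mk,
    UGraph.degWeight_mk, degWeight_ofSimpleGraph _ hφ, degWeight_ofSimpleGraph _ hφ,
    Finset.sum_congr rfl fun x _ => if_neg (hdeg x)] at h'
  simp [φ] at h'
  norm_num at h'

end GraphSOS

open GraphSOS in
theorem corollary5p2 :
    (∀ (V : Type u) (W : Type v) [Fintype V] [Fintype W]
      (Hbar : SimpleGraph V) (Hund : SimpleGraph W) [DecidableRel Hbar.Adj] [DecidableRel Hund.Adj]
      (p : ℕ), 1 ≤ p →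
      (∀ x, Hbar.degree x = p ∨ Hbar.degree x = p + 1) →
      (∀ y, 1 ≤ Hund.degree y ∧ Hund.degree y ≤ p + 1) →
      Hbar.edgeSet.ncard = Hund.edgeSet.ncard →
      ¬ Nonempty (Hbar ≃g Hund) →
      (UGraph.ofSimpleGraph Hbar).IsTrivialSquare →
      ¬ SosTestable ((UGraph.ofSimpleGraph Hbar).toComb - (UGraph.ofSimpleGraph Hund).toComb) ∧
      ¬ IsRationalSos ((UGraph.ofSimpleGraph Hbar).toComb - (UGraph.ofSimpleGraph Hund).toComb)) ∧
    (¬ SosTestable ((UGraph.ofSimpleGraph (SimpleGraph.pathGraph 4)).toComb -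
        (UGraph.ofSimpleGraph (SimpleGraph.completeGraph (Fin 2))).toComb ^ 3) ∧
      ¬ IsRationalSos ((UGraph.ofSimpleGraph (SimpleGraph.pathGraph 4)).toComb -
        (UGraph.ofSimpleGraph (SimpleGraph.completeGraph (Fin 2))).toComb ^ 3)) := by
  constructor
  · intro V W _ _ Hbar Hund _ _ p hp hbar hund he hne htriv
    rw [← RawGraph.mk_ofSimpleGraph Hbar] at htriv ⊢
    refine not_sosTestable_and_not_isRationalSos (degreesNear_ofSimpleGraph Hbar hbar) htriv
      (fun h => hne (RawGraph.nonempty_iso_of_ofSimpleGraph_eq (fun x => ?_) (fun y => ?_) h)) ?_ ?_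
    · rw [← SimpleGraph.degree_pos_iff_exists_adj]
      rcases hbar x with h | h <;> omega
    · rw [← SimpleGraph.degree_pos_iff_exists_adj]
      exact (hund y).1
    · exact (RawGraph.edgeCount_ofSimpleGraph Hbar).trans
        (he.trans (RawGraph.edgeCount_ofSimpleGraph Hund).symm)
    · rw [RawGraph.mk_ofSimpleGraph, degWeight_kink_ofSimpleGraph Hbar fun x => by
        rcases hbar x with h | h <;> omega, he, degWeight_kink_ofSimpleGraph Hund fun y => (hund y).2]
  · have hdeg : ∀ x, (SimpleGraph.pathGraph 4).degree x = 1 ∨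
        (SimpleGraph.pathGraph 4).degree x = 1 + 1 := by decide +kernel
    have htriv := isTrivialSquare_pathGraph_four
    have hne := pathGraph_four_ne_completeGraph_two_pow
    rw [toComb_pow]
    rw [← RawGraph.mk_ofSimpleGraph (SimpleGraph.pathGraph 4)] at htriv hne ⊢
    refine not_sosTestable_and_not_isRationalSos (degreesNear_ofSimpleGraph _ hdeg) htriv hne ?_ ?_
    · rw [edgeCount_pow, ← RawGraph.mk_ofSimpleGraph (SimpleGraph.completeGraph (Fin 2)),
        PLGraph.edgeCount_mk, PLGraph.edgeCount_mk, RawGraph.edgeCount_ofSimpleGraph,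
        RawGraph.edgeCount_ofSimpleGraph, ncard_edgeSet_pathGraph_four,
        ncard_edgeSet_completeGraph_two]
    · rw [degWeight_pow, RawGraph.mk_ofSimpleGraph, degWeight_kink_ofSimpleGraph _ fun x => by
          rcases hdeg x with h | h <;> omega,
        degWeight_kink_ofSimpleGraph _ fun x => by rw [degree_completeGraph_two]; omega,
        ncard_edgeSet_pathGraph_four, ncard_edgeSet_completeGraph_two]
      norm_num
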